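/- Let $\alpha\in\{1,-1\}$, let $u_0,v_0\in\mathcal S(\mathbb R)$ be real-valued, and let $(u,v)$ be a real-valued solution on $\mathbb R\times[0,\infty)$ of the coupled mKdV system $$u_t+u_{xxx}-3\alpha(u_xv^2+uvv_x+2u^2u_x)=0,\qquad v_t+v_{xxx}-3\alpha(u^2v_x+uu_xv+2v^2v_x)=0,$$ with $u(\cdot,0)=u_0$, $v(\cdot,0)=v_0$, which is of Schwartz class in $x$, locally uniformly in $t\ge 0$. Put $\Lambda=\operatorname{diag}(-1,1,1)$, $Q=\begin{pmatrix}0&\alpha u&\alpha v\\u&0&0\\v&0&0\end{pmatrix}$, $\theta(k)=i\alpha k(x+4k^2t)$ and $\mathbb D_\pm=\{k\in\mathbb C:\pm\alpha\operatorname{Im}k>0\}$. The Jost solutions $J_1,J_2$ are defined columnwise as the bounded continuous (in $x$) solutions of $$J_1(x,t;k)=I+\int_{-\infty}^x e^{i\alpha k(x-s)\Lambda}Q(s,t)J_1(s,t;k)e^{-i\alpha k(x-s)\Lambda}ds,\qquad J_2(x,t;k)=I-\int_x^{\infty}e^{i\alpha k(x-s)\Lambda}Q(s,t)J_2(s,t;k)e^{-i\alpha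 k(x-s)\Lambda}ds .$$ Write $J_{i1},J_{i2},J_{i3}$ for the columns of $J_i$. For real $k$ put $S(k)=(s_{ij}(k))=J_2(0,0;k)^{-1}J_1(0,0;k)$, which depends only on $u_0,v_0$. Let $s_{11}$ denote also its continuation to $\mathbb D_+$, and $s_{22},s_{23},s_{32},s_{33}$ their continuations to $\mathbb D_-$ (continuous up to $\mathbb R$, holomorphic inside; in both cases $s_{ij}(k)=\delta_{ij}+\int_{\mathbb R}(QJ_1)_{ij}(s,0;k)\,ds$). Put $\Delta=s_{22}s_{33}-s_{23}s_{32}$, $$M=\Big(\tfrac{J_{11}}{s_{11}},J_{22},J_{23}\Big)\ \text{on }\mathbb D_+,\qquad M=\Big(J_{21},\tfrac{s_{33}J_{12}-s_{32}J_{13}}{\Delta},\tfrac{-s_{23}J_{12}+s_{22}J_{13}}{\Delta}\Big)\ \text{on }\mathbb D_-,$$ $$G=\begin{pmatrix}\frac1{s_{11}\Delta}&e^{-2\theta}\frac{s_{13}s_{32}-s_{12}s_{33}}{\Delta}&e^{-2\theta}\frac{s_{12}s_{23}-s_{13}s_{22}}{\Delta}\\ e^{2\theta}\frac{s_{21}}{s_{11}}&1&0\\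 e^{2\theta}\frac{s_{31}}{s_{11}}&0&1\end{pmatrix}.$$ At a simple zero $\kappa\in\mathbb D_+$ of $s_{11}$ the norming constants $c_\kappa,d_\kappa$ are defined by $J_{11}(0,0;\kappa)=s_{11}'(\kappa)\,(c_\kappa J_{22}(0,0;\kappa)+d_\kappa J_{23}(0,0;\kappa))$. The Riemann--Hilbert problem at $(x,t)$ asks for a $3\times3$ matrix function $N(k)$ such that: (i) $N$ is meromorphic on $\mathbb C\setminus\mathbb R$, and analytic there except possibly at the zeros of $s_{11}$ in $\mathbb D_+$ and their conjugates; (ii) at each $k\in\mathbb R$ with $s_{11}(k)\ne0$ the boundary values $N_\pm$ from $\mathbb D_\pm$ exist and $N_+=N_-G$; (iii) $N(k)\to I$ as $k\to\infty$ in $\mathbb C\setminus\mathbb R$; (iv) at each simple zero $\kappa\in\mathbb D_+$ of $s_{11}$, $N$ has at most simple poles at $\kappa$ and $\bar\kappa$, with $$\operatorname*{Res}_{k=\kappa}N=\lim_{k\to\kappa}N\begin{pmatrix}0&0&0\\c_\kappa e^{2\theta(\kappa)}&0&0\\d_\kappa e^{2\theta(\kappa)}&0&0\end{pmatrix},\qquad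 \operatorname*{Res}_{k=\bar\kappa}N=\lim_{k\to\bar\kappa}N\begin{pmatrix}0&-\bar c_\kappa e^{-2\theta(\bar\kappa)}&-\bar d_\kappa e^{-2\theta(\bar\kappa)}\\0&0&0\\0&0&0\end{pmatrix}.$$ Then the following hold. (a) The columns $J_{11},J_{22},J_{23}$ exist and are unique for $k\in\overline{\mathbb D_+}$, and $J_{21},J_{12},J_{13}$ for $k\in\overline{\mathbb D_-}$. For real $k$ and all $x\in\mathbb R$, $t\ge0$ one has $J_1=J_2\,e^{\theta\Lambda}S(k)e^{-\theta\Lambda}$. The stated continuations of the $s_{ij}$ are continuous up to $\mathbb R$ and holomorphic inside. Norming constants exist. If $\alpha=1$, then $s_{11}\neq0$ on $\overline{\mathbb D_+}$. (b) For all $x\in\mathbb R$, $t\ge0$, the matrix $M(x,t;\cdot)$ solves the Riemann--Hilbert problem, and $$u(x,t)=2i\lim_{k\to\infty}kM_{12}(x,t;k),\qquad v(x,t)=2i\lim_{k\to\infty}kM_{13}(x,t;k)\qquad(k\in\mathbb C\setminus\mathbb R).$$ (c) If $s_{11}$ has no zero on $\mathbb R$ and only simple zeros in $\mathbb D_+$,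 then for all $x\in\mathbb R$, $t\ge 0$, every solution $N$ of the Riemann--Hilbert problem at $(x,t)$ satisfies $u(x,t)=2i\lim_{k\to\infty}kN_{12}(k)$ and $v(x,t)=2i\lim_{k\to\infty}kN_{13}(k)$. -/

import Mathlib

open Filter Topology Set MeasureTheory

noncomputable section

namespace CMKdV

/-- `(u, v)` is a solution on `ℝ × [0, ∞)` of the coupled mKdV system
`u_t + u_xxx - 3α(u_x v² + u v v_x + 2u² u_x) = 0`,
`v_t + v_xxx - 3α(u² v_x + u u_x v + 2v² v_x) = 0`
with initial data `(u₀, v₀)`, which is of Schwartz class in `x`, locally uniformly in `t`.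
The time derivative is one-sided at `t = 0`. -/
structure IsSchwartzSolution (α : ℝ) (u₀ v₀ : SchwartzMap ℝ ℝ) (u v : ℝ → ℝ → ℝ) : Prop where
  smooth_u : ∀ t, 0 ≤ t → ContDiff ℝ (⊤ : ℕ∞) (fun x => u x t)
  smooth_v : ∀ t, 0 ≤ t → ContDiff ℝ (⊤ : ℕ∞) (fun x => v x t)
  decay_u : ∀ (T : ℝ) (a b : ℕ), ∃ C : ℝ, ∀ t ∈ Icc 0 T, ∀ x : ℝ,
    |x| ^ a * |iteratedDeriv b (fun y => u y t) x| ≤ C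
  decay_v : ∀ (T : ℝ) (a b : ℕ), ∃ C : ℝ, ∀ t ∈ Icc 0 T, ∀ x : ℝ,
    |x| ^ a * |iteratedDeriv b (fun y => v y t) x| ≤ C
  eq_u : ∀ x t : ℝ, 0 ≤ t → ∃ u_t : ℝ, HasDerivWithinAt (fun τ => u x τ) u_t (Ici 0) t ∧
    u_t + iteratedDeriv 3 (fun y => u y t) x
      - 3 * α * (deriv (fun y => u y t) x * v x t ^ 2
          + u x t * v x t * deriv (fun y => v y t) x
          + 2 * u x t ^ 2 * deriv (fun y => u y t) x) = 0
  eq_v : ∀ x t : ℝ, 0 ≤ t → ∃ v_t : ℝ, HasDerivWithinAt (fun τ => v x τ) v_t (Ici 0) t ∧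
    v_t + iteratedDeriv 3 (fun y => v y t) x
      - 3 * α * (u x t ^ 2 * deriv (fun y => v y t) x
          + u x t * deriv (fun y => u y t) x * v x t
          + 2 * v x t ^ 2 * deriv (fun y => v y t) x) = 0
  init_u : ∀ x, u x 0 = u₀ x
  init_v : ∀ x, v x 0 = v₀ x

/-- The diagonal of `Λ = diag(-1, 1, 1)`. -/
def lam : Fin 3 → ℂ := ![-1, 1, 1]

/-- The potential matrix `Q` at a point where the two potentials take the values `p`, `q`. -/
def potential (α p q : ℝ) : Matrix (Fin 3) (Fin 3) ℂ :=
  !![0, (α : ℂ) * p, (α : ℂ) * q; (p : ℂ), 0, 0; (q : ℂ), 0, 0]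

/-- The region `D₊ = {α Im k > 0}`. -/
def Dplus (α : ℝ) : Set ℂ := {k | 0 < α * k.im}

/-- The region `D₋ = {α Im k < 0}`. -/
def Dminus (α : ℝ) : Set ℂ := {k | α * k.im < 0}

/-- `y` is the `j`-th column of the Jost solution `J₁` for the potentials `p, q`: a bounded
continuous solution of the `j`-th column of
`J₁(x) = I + ∫_{-∞}^x e^{iαk(x-s)Λ} Q(s) J₁(s) e^{-iαk(x-s)Λ} ds`. -/
def IsJostLeftColumn (α : ℝ) (p q : ℝ → ℝ) (k : ℂ) (j : Fin 3) (y : ℝ → Fin 3 → ℂ) : Prop :=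
  Continuous y ∧ (∃ C : ℝ, ∀ x, ‖y x‖ ≤ C) ∧
    ∀ (x : ℝ) (a : Fin 3), y x a = (1 : Matrix (Fin 3) (Fin 3) ℂ) a j +
      ∫ s in Iic x, Complex.exp (Complex.I * α * k * (x - s) * (lam a - lam j)) *
        (potential α (p s) (q s)).mulVec (y s) a

/-- `y` is the `j`-th column of the Jost solution `J₂` for the potentials `p, q`: a bounded
continuous solution of the `j`-th column of
`J₂(x) = I - ∫_x^∞ e^{iαk(x-s)Λ} Q(s) J₂(s) e^{-iαk(x-s)Λ} ds`. -/
def IsJostRightColumn (α : ℝ) (p q : ℝ → ℝ) (k : ℂ) (j : Fin 3) (y : ℝ → Fin 3 → ℂ) : Prop :=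
  Continuous y ∧ (∃ C : ℝ, ∀ x, ‖y x‖ ≤ C) ∧
    ∀ (x : ℝ) (a : Fin 3), y x a = (1 : Matrix (Fin 3) (Fin 3) ℂ) a j -
      ∫ s in Ioi x, Complex.exp (Complex.I * α * k * (x - s) * (lam a - lam j)) *
        (potential α (p s) (q s)).mulVec (y s) a

/-- Existence and uniqueness of the Jost columns where they are used: the first column of `J₁` and
the last two of `J₂` for `k` in the closure of `D₊`, the others for `k` in the closure of `D₋`.
In particular both full matrices are determined for real `k`. -/
def JostWellPosed (α : ℝ) (p q : ℝ → ℝ) : Prop :=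
  (∀ k : ℂ, 0 ≤ α * k.im →
    (∃! y, IsJostLeftColumn α p q k 0 y) ∧
    (∃! y, IsJostRightColumn α p q k 1 y) ∧ (∃! y, IsJostRightColumn α p q k 2 y)) ∧
  (∀ k : ℂ, α * k.im ≤ 0 →
    (∃! y, IsJostRightColumn α p q k 0 y) ∧
    (∃! y, IsJostLeftColumn α p q k 1 y) ∧ (∃! y, IsJostLeftColumn α p q k 2 y))

/-- The Jost solution `J₁` at `x`. A column is meaningful only for those `k` for which
it exists. -/
def jostLeft (α : ℝ) (p q : ℝ → ℝ) (x : ℝ) (k : ℂ) : Matrix (Fin 3) (Fin 3) ℂ :=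
  Matrix.of fun a j => Classical.epsilon (IsJostLeftColumn α p q k j) x a

/-- The Jost solution `J₂` at `x`. A column is meaningful only for those `k` for which
it exists. -/
def jostRight (α : ℝ) (p q : ℝ → ℝ) (x : ℝ) (k : ℂ) : Matrix (Fin 3) (Fin 3) ℂ :=
  Matrix.of fun a j => Classical.epsilon (IsJostRightColumn α p q k j) x a

open Classical in
/-- The scattering matrix of the potentials `p, q`. For real `k` it is `J₂(0;k)⁻¹ J₁(0;k)`.
For non-real `k` only `s₁₁` on `D₊` and the lower right `2 × 2` block on `D₋` are meaningful; there
`s_ij = δ_ij + ∫_ℝ (Q J₁)_ij ds`, which is the analytic continuation from the real axis. -/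
def scattering (α : ℝ) (p q : ℝ → ℝ) (k : ℂ) : Matrix (Fin 3) (Fin 3) ℂ :=
  if k.im = 0 then (jostRight α p q 0 k)⁻¹ * jostLeft α p q 0 k
  else Matrix.of fun i j => (1 : Matrix (Fin 3) (Fin 3) ℂ) i j +
    ∫ s : ℝ, (potential α (p s) (q s) * jostLeft α p q s k) i j

/-- `f` is continuous on the closed half-plane `{β Im k ≥ 0}` and holomorphic in its interior. -/
def HolomorphicUpTo (β : ℝ) (f : ℂ → ℂ) : Prop :=
  ContinuousOn f {k | 0 ≤ β * k.im} ∧ DifferentiableOn ℂ f {k | 0 < β * k.im}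

/-- `Δ = s₂₂ s₃₃ - s₂₃ s₃₂`. -/
def bigDelta (S : Matrix (Fin 3) (Fin 3) ℂ) : ℂ := S 1 1 * S 2 2 - S 1 2 * S 2 1

/-- The phase `θ(k) = iαk(x + 4k²t)`. -/
def theta (α x t : ℝ) (k : ℂ) : ℂ := Complex.I * α * k * (x + 4 * k ^ 2 * t)

/-- `e^{θ ad Λ} S = e^{θΛ} S e^{-θΛ}`. -/
def expAd (θ : ℂ) (S : Matrix (Fin 3) (Fin 3) ℂ) : Matrix (Fin 3) (Fin 3) ℂ :=
  Matrix.diagonal (fun a => Complex.exp (θ * lam a)) * S *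
    Matrix.diagonal (fun a => Complex.exp (-(θ * lam a)))

/-- The jump matrix, from the scattering matrix `S` and the phase `θ`. -/
def jump (S : Matrix (Fin 3) (Fin 3) ℂ) (θ : ℂ) : Matrix (Fin 3) (Fin 3) ℂ :=
  !![1 / (S 0 0 * bigDelta S),
      Complex.exp (-2 * θ) * ((S 0 2 * S 2 1 - S 0 1 * S 2 2) / bigDelta S),
      Complex.exp (-2 * θ) * ((S 0 1 * S 1 2 - S 0 2 * S 1 1) / bigDelta S);
    Complex.exp (2 * θ) * (S 1 0 / S 0 0), 1, 0;
    Complex.exp (2 * θ) * (S 2 0 / S 0 0), 0, 1]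

open Classical in
/-- The sectionally meromorphic matrix `M(k)` made of the Jost matrices `J₁`, `J₂` (at some `(x,t)`)
and the scattering matrix `S`, all functions of `k`. -/
def sectional (α : ℝ) (J₁ J₂ S : ℂ → Matrix (Fin 3) (Fin 3) ℂ) (k : ℂ) :
    Matrix (Fin 3) (Fin 3) ℂ :=
  Matrix.of fun a =>
    if k ∈ Dplus α then
      ![J₁ k a 0 / S k 0 0, J₂ k a 1, J₂ k a 2]
    else
      ![J₂ k a 0,
        (S k 2 2 * J₁ k a 1 - S k 2 1 * J₁ k a 2) / bigDelta (S k),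
        (-S k 1 2 * J₁ k a 1 + S k 1 1 * J₁ k a 2) / bigDelta (S k)]

/-- `M(x,t;k)`: the Jost solutions are those of the potentials `u(·,t), v(·,t)`, the scattering
matrix is that of the initial data. -/
def rhM (α : ℝ) (p₀ q₀ : ℝ → ℝ) (u v : ℝ → ℝ → ℝ) (x t : ℝ) : ℂ → Matrix (Fin 3) (Fin 3) ℂ :=
  sectional α (jostLeft α (fun y => u y t) (fun y => v y t) x)
    (jostRight α (fun y => u y t) (fun y => v y t) x) (scattering α p₀ q₀)

/-- The zeros of `s₁₁` in `D₊`. -/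
def zeros (α : ℝ) (p q : ℝ → ℝ) : Set ℂ := {k | k ∈ Dplus α ∧ scattering α p q k 0 0 = 0}

/-- The simple zeros of `s₁₁` in `D₊`. -/
def simpleZeros (α : ℝ) (p q : ℝ → ℝ) : Set ℂ :=
  {k | k ∈ zeros α p q ∧ deriv (fun z => scattering α p q z 0 0) k ≠ 0}

/-- `c, d` are the norming constants of the potentials `p, q`: at each simple zero `κ` of `s₁₁`,
`J₁₁(0;κ) = s₁₁'(κ) (c(κ) J₂₂(0;κ) + d(κ) J₂₃(0;κ))` (columns of `J₁` and `J₂`). -/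
def IsNorming (α : ℝ) (p q : ℝ → ℝ) (c d : ℂ → ℂ) : Prop :=
  ∀ κ ∈ simpleZeros α p q, ∀ a : Fin 3,
    jostLeft α p q 0 κ a 0 = deriv (fun z => scattering α p q z 0 0) κ *
      (c κ * jostRight α p q 0 κ a 1 + d κ * jostRight α p q 0 κ a 2)

/-- The filter of `k → ∞` in `ℂ ∖ ℝ`. -/
def atInfty : Filter ℂ := Bornology.cobounded ℂ ⊓ 𝓟 {k | k.im ≠ 0}

/-- `N` has at most a simple pole at `κ`, and its residue there is `lim_{k → κ} N(k) R`. -/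
def PoleCondition (N : ℂ → Matrix (Fin 3) (Fin 3) ℂ) (κ : ℂ) (R : Matrix (Fin 3) (Fin 3) ℂ) :
    Prop :=
  ∃ ρ : Matrix (Fin 3) (Fin 3) ℂ,
    Tendsto (fun k => (k - κ) • N k) (𝓝[≠] κ) (𝓝 ρ) ∧
    Tendsto (fun k => N k * R) (𝓝[≠] κ) (𝓝 ρ)

/-- `N` solves the Riemann-Hilbert problem at `(x, t)` whose data (jump matrix, poles and norming
constants) come from the potentials `p, q`. The jump matrix is defined at those real `k` with
`s₁₁(k) ≠ 0`; the boundary values are taken from `D₊` and from `D₋`. -/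
structure IsRHPSolution (α : ℝ) (p q : ℝ → ℝ) (c d : ℂ → ℂ) (x t : ℝ)
    (N : ℂ → Matrix (Fin 3) (Fin 3) ℂ) : Prop where
  meromorphic : ∀ k : ℂ, k.im ≠ 0 → ∀ a b, MeromorphicAt (fun z => N z a b) k
  analytic : ∀ k : ℂ, k.im ≠ 0 → k ∉ zeros α p q → (starRingEnd ℂ) k ∉ zeros α p q →
    ∀ a b, AnalyticAt ℂ (fun z => N z a b) k
  jump : ∀ k : ℝ, scattering α p q k 0 0 ≠ 0 → ∃ Np Nm : Matrix (Fin 3) (Fin 3) ℂ,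
    Tendsto N (𝓝[Dplus α] (k : ℂ)) (𝓝 Np) ∧ Tendsto N (𝓝[Dminus α] (k : ℂ)) (𝓝 Nm) ∧
    Np = Nm * CMKdV.jump (scattering α p q k) (theta α x t k)
  normalization : Tendsto N atInfty (𝓝 1)
  pole : ∀ κ ∈ simpleZeros α p q, PoleCondition N κ
    !![0, 0, 0;
       c κ * Complex.exp (2 * theta α x t κ), 0, 0;
       d κ * Complex.exp (2 * theta α x t κ), 0, 0]
  pole_conj : ∀ κ ∈ simpleZeros α p q, PoleCondition N ((starRingEnd ℂ) κ)
    !![0, -(starRingEnd ℂ) (c κ) * Complex.exp (-2 * theta α x t ((starRingEnd ℂ) κ)),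
          -(starRingEnd ℂ) (d κ) * Complex.exp (-2 * theta α x t ((starRingEnd ℂ) κ));
       0, 0, 0;
       0, 0, 0]

end CMKdV

end

noncomputable section
namespace CMKdV

/-! ### Volterra equations on the line -/

/-! The proof combines direct scattering for the potentials at a fixed time, an evolution argument
in time, and a Liouville argument for uniqueness.

Direct scattering. A Jost column solves a Volterra equation whose kernel is bounded by a multiple of
`1 / (1 + x²)`, uniformly for `k` in the closed half-plane where its exponents have nonpositive real
part. In a suitable weight the Volterra operator has norm at most `1 / 2`. This gives existence,
uniqueness and a bound, and since the Picard iterates converge uniformly in `k`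
(`exists_picard_limit`), also continuity up to the real axis and holomorphy inside. Columns of `J₂`
are reflected columns of `J₁` (`isJostRightColumn_iff`), so only the latter need analysis.

Symmetry. If `w` solves the spatial equation at `conj k` and `z` at `k`, then `w† diag(-α, 1, 1) z`
is constant in `x` up to an explicit exponential. Together with the Wronskian, evaluated at `±∞`,
this expresses the pairings between Jost columns by entries of `S` or shows that they vanish. It
yields `conj (Δ (conj k)) = s₁₁ k` (`blockDet_conj`), the absence of zeros for `α = 1`
(`leftLimit_ne_zero_of_defocusing`), and the relation `M(conj k)† G M(k) = G` with `G = diag(-α, 1,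
1)` (`rhM_conj_mul`).

Time. The formal time derivative of a Jost column solves the linearised Volterra equation. The zero
curvature identity `hasDerivAt_timeRhs` shows that `T y + 4ζ³λ_j y`, with `ζ = iαk`, solves it too,
so this is the derivative. Hence `e^{θλ_j}` times a column satisfies both equations of the Lax pair,
and a linear relation between such vectors at `(0, 0)` persists everywhere (`IsLaxSol.eq_zero`).
Applied to the definitions of `S` and of the norming constants, this gives the time dependence in
the jump (`jostLeft_eq`) and in the residues (`leftCol_eq_norming`).

Recovery. Integrations by parts give the expansion of the Jost columns at large `k`. The first term
of the entries in the top row is the potential divided by `2ik`.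

Uniqueness. For a solution `N` the product `N adj M` has no jump because `det G = 1` for the jump
matrix, no poles because `N` and `M` are regularised by the same unimodular factor, and tends to the
identity. By the theorems of Painlevé and Liouville it is the identity; as `det M = 1` off the real
axis and off the poles, `N = M` there. Neither a vanishing lemma nor knowledge of `det N` is needed.
-/

/-- The weight in which the Volterra operator of a potential bounded by `K / (1 + x²)` is a
contraction. -/
def weight (K x : ℝ) : ℝ := Real.exp (2 * K * (Real.arctan x + Real.pi / 2))

lemma weight_pos (K x : ℝ) : 0 < weight K x := Real.exp_pos _

lemma one_le_weight {K : ℝ} (hK : 0 ≤ K) (x : ℝ) : 1 ≤ weight K x := by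
  apply Real.one_le_exp
  have := Real.neg_pi_div_two_lt_arctan x
  have : 0 ≤ Real.arctan x + Real.pi / 2 := by linarith
  positivity

lemma weight_le {K : ℝ} (hK : 0 ≤ K) (x : ℝ) : weight K x ≤ Real.exp (2 * K * Real.pi) := by
  apply Real.exp_le_exp.2
  have := Real.arctan_lt_pi_div_two x
  gcongr
  linarith

/-- The factor 2 in the exponent of the weight is chosen for this identity: integrating the kernel
bound against the weight returns at most half of the weight. This is the contraction factor `1 / 2`
in `norm_volterra_mulVec_le`. -/
lemma hasDerivAt_weight (K x : ℝ) :
    HasDerivAt (fun x => weight K x / 2) (K / (1 + x ^ 2) * weight K x) x := by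
  have h := ((((Real.hasDerivAt_arctan x).add_const (Real.pi / 2)).const_mul (2 * K)).exp).div_const 2
  refine h.congr_deriv ?_
  unfold weight
  ring

lemma continuous_weight (K : ℝ) : Continuous (weight K) := by
  unfold weight
  fun_prop

lemma integrable_div_one_add_sq (K : ℝ) : Integrable (fun s : ℝ => K / (1 + s ^ 2)) := by
  simpa [div_eq_mul_inv] using integrable_inv_one_add_sq.const_mul K

lemma integrable_weight {K : ℝ} (hK : 0 ≤ K) :
    Integrable (fun s : ℝ => K / (1 + s ^ 2) * weight K s) := by
  refine (integrable_div_one_add_sq K).mul_bdd (c := Real.exp (2 * K * Real.pi))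
    (continuous_weight K).aestronglyMeasurable (ae_of_all _ fun x => ?_)
  rw [Real.norm_of_nonneg (weight_pos K x).le]
  exact weight_le hK x

lemma tendsto_weight_atBot (K : ℝ) : Tendsto (weight K) atBot (𝓝 1) := by
  have h : Tendsto (fun x => Real.arctan x + Real.pi / 2) atBot (𝓝 0) := by
    have := (tendsto_nhds_of_tendsto_nhdsWithin Real.tendsto_arctan_atBot).add_const (Real.pi / 2)
    simpa using this
  have h2 := (Real.continuous_exp.tendsto _).comp (h.const_mul (2 * K))
  unfold weight
  simpa [Function.comp_def] using h2

lemma integral_weight {K : ℝ} (hK : 0 ≤ K) (x : ℝ) :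
    ∫ s in Iic x, K / (1 + s ^ 2) * weight K s = (weight K x - 1) / 2 := by
  rw [integral_Iic_of_hasDerivAt_of_tendsto' (fun x _ => hasDerivAt_weight K x)
    (integrable_weight hK).integrableOn ((tendsto_weight_atBot K).div_const 2)]
  ring

/-- `Q` is continuous with operator norm at most `K / (1 + x²)`. -/
structure PotBound (K : ℝ) (Q : ℝ → Matrix (Fin 3) (Fin 3) ℂ) : Prop where
  nonneg : 0 ≤ K
  continuous : Continuous Q
  bound : ∀ s v, ‖(Q s).mulVec v‖ ≤ K / (1 + s ^ 2) * ‖v‖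

/-- The Volterra integral `∫_{-∞}^x e^{μ (x - s)} g(s) ds`. -/
def volterra (μ : Fin 3 → ℂ) (g : ℝ → Fin 3 → ℂ) (x : ℝ) : Fin 3 → ℂ :=
  fun a => ∫ s in Iic x, Complex.exp (μ a * (x - s)) * g s a

/-- `y` is a bounded continuous solution of `y = e + ∫_{-∞}^x e^{μ (x - s)} Q(s) y(s) ds`. -/
structure IsVolterraSol (μ e : Fin 3 → ℂ) (Q : ℝ → Matrix (Fin 3) (Fin 3) ℂ)
    (y : ℝ → Fin 3 → ℂ) : Prop where
  continuous : Continuous y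
  bounded : ∃ C : ℝ, ∀ x, ‖y x‖ ≤ C
  eq : ∀ x, y x = e + volterra μ (fun s => (Q s).mulVec (y s)) x

lemma norm_exp_mul_le {m : ℂ} (hm : m.re ≤ 0) {x s : ℝ} (h : s ≤ x) :
    ‖Complex.exp (m * (x - s))‖ ≤ 1 := by
  rw [Complex.norm_exp]
  apply Real.exp_le_one_iff.2
  have : (m * ((x : ℂ) - s)).re = m.re * (x - s) := by
    rw [← Complex.ofReal_sub, Complex.re_mul_ofReal]
  rw [this]
  exact mul_nonpos_of_nonpos_of_nonneg hm (by linarith)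

lemma norm_volterra_le {μ : Fin 3 → ℂ} (hμ : ∀ a, (μ a).re ≤ 0) {g : ℝ → Fin 3 → ℂ} {B : ℝ → ℝ}
    {x : ℝ} (hg : ∀ s, ‖g s‖ ≤ B s) (hB : IntegrableOn B (Iic x)) :
    ‖volterra μ g x‖ ≤ ∫ s in Iic x, B s := by
  have hB0 : ∀ s, 0 ≤ B s := fun s => (norm_nonneg _).trans (hg s)
  refine (pi_norm_le_iff_of_nonneg (integral_nonneg hB0)).2 fun a => ?_
  refine norm_integral_le_of_norm_le hB ?_
  filter_upwards [ae_restrict_mem measurableSet_Iic] with s hs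
  rw [norm_mul]
  calc _ ≤ 1 * ‖g s a‖ := by gcongr; exact norm_exp_mul_le (hμ a) hs
    _ ≤ B s := by rw [one_mul]; exact (norm_le_pi_norm _ a).trans (hg s)

lemma norm_volterra_mulVec_le {μ : Fin 3 → ℂ} (hμ : ∀ a, (μ a).re ≤ 0) {K : ℝ}
    {Q : ℝ → Matrix (Fin 3) (Fin 3) ℂ} (hQ : PotBound K Q) {f : ℝ → Fin 3 → ℂ} {C : ℝ}
    (hC : 0 ≤ C) (hf : ∀ s, ‖f s‖ ≤ C * weight K s) (x : ℝ) :
    ‖volterra μ (fun s => (Q s).mulVec (f s)) x‖ ≤ C / 2 * weight K x := by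
  have hK := hQ.nonneg
  calc _ ≤ ∫ s in Iic x, C * (K / (1 + s ^ 2) * weight K s) := by
        refine norm_volterra_le hμ (fun s => ?_) ((integrable_weight hK).const_mul C).integrableOn
        calc _ ≤ K / (1 + s ^ 2) * ‖f s‖ := hQ.bound s _
          _ ≤ K / (1 + s ^ 2) * (C * weight K s) := by gcongr; exact hf s
          _ = _ := by ring
    _ = C * ((weight K x - 1) / 2) := by rw [integral_const_mul, integral_weight hK]
    _ ≤ _ := by nlinarith

/-- The weighted supremum `B` of `w` is finite because `w` is bounded, and the contraction gives `B
≤ ε + B / 2`. The case `ε = 0` is uniqueness, `ε = 1` bounds the Jost columns, and an `ε` tending to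
zero controls difference quotients in time. -/
lemma norm_le_of_volterra {μ : Fin 3 → ℂ} (hμ : ∀ a, (μ a).re ≤ 0) {K : ℝ}
    {Q : ℝ → Matrix (Fin 3) (Fin 3) ℂ} (hQ : PotBound K Q) {w : ℝ → Fin 3 → ℂ} {ε : ℝ}
    (hb : ∃ C : ℝ, ∀ x, ‖w x‖ ≤ C)
    (hw : ∀ x, ‖w x - volterra μ (fun s => (Q s).mulVec (w s)) x‖ ≤ ε) (x : ℝ) :
    ‖w x‖ ≤ 2 * ε * weight K x := by
  obtain ⟨C, hC⟩ := hb
  have hK := hQ.nonneg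
  have hε : 0 ≤ ε := (norm_nonneg _).trans (hw 0)
  set r : ℝ → ℝ := fun x => ‖w x‖ / weight K x with hr
  have hbdd : BddAbove (range r) := by
    refine ⟨C, ?_⟩
    rintro _ ⟨x, rfl⟩
    have := hC x
    rw [hr]
    simp only
    rw [div_le_iff₀ (weight_pos K x)]
    nlinarith [one_le_weight hK x, norm_nonneg (w x)]
  set B := ⨆ x, r x with hBdef
  have hrB : ∀ x, r x ≤ B := fun x => le_ciSup hbdd x
  have hB0 : 0 ≤ B := le_trans (div_nonneg (norm_nonneg _) (weight_pos K 0).le) (hrB 0)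
  have hwB : ∀ x, ‖w x‖ ≤ B * weight K x := fun x => (div_le_iff₀ (weight_pos K x)).1 (hrB x)
  have key : ∀ x, r x ≤ ε + B / 2 := by
    intro x
    rw [hr]
    simp only
    rw [div_le_iff₀ (weight_pos K x)]
    have h1 := norm_volterra_mulVec_le hμ hQ hB0 hwB x
    have h2 := norm_le_norm_sub_add (w x) (volterra μ (fun s => (Q s).mulVec (w s)) x)
    have h3 := hw x
    nlinarith [one_le_weight hK x]
  have : B ≤ ε + B / 2 := ciSup_le key
  have hB : B ≤ 2 * ε := by linarith
  exact (hwB x).trans (by gcongr; exact (weight_pos K x).le)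

lemma integrableOn_exp_mul {m : ℂ} (hm : m.re ≤ 0) {g : ℝ → ℂ} (hg : Continuous g) {C : ℝ}
    (hC : ∀ s, ‖g s‖ ≤ C / (1 + s ^ 2)) (x : ℝ) :
    IntegrableOn (fun s : ℝ => Complex.exp (m * (x - s)) * g s) (Iic x) := by
  refine Integrable.mono' (integrable_div_one_add_sq C).integrableOn
    (Continuous.aestronglyMeasurable (by fun_prop)) ?_
  filter_upwards [ae_restrict_mem measurableSet_Iic] with s hs
  rw [norm_mul]
  calc _ ≤ 1 * ‖g s‖ := by gcongr; exact norm_exp_mul_le hm hs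
    _ ≤ _ := by rw [one_mul]; exact hC s

lemma hasDerivAt_integral_Iic {h : ℝ → ℂ} (hh : Continuous h) (hi : ∀ x, IntegrableOn h (Iic x))
    (x : ℝ) : HasDerivAt (fun x => ∫ s in Iic x, h s) (h x) x := by
  have e : (fun x => ∫ s in Iic x, h s) = fun x => (∫ s in Iic 0, h s) + ∫ s in (0 : ℝ)..x, h s := by
    funext z
    rw [← intervalIntegral.integral_Iic_sub_Iic (hi 0) (hi z)]
    ring
  rw [e]
  exact (intervalIntegral.integral_hasDerivAt_right (hh.intervalIntegrable _ _)
    (hh.stronglyMeasurableAtFilter _ _) hh.continuousAt).const_add _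

/-- Removing `x` from the integrand makes the fundamental theorem of calculus applicable. -/
lemma exp_volterra_split (m : ℂ) (g : ℝ → ℂ) (x : ℝ) :
    ∫ s in Iic x, Complex.exp (m * (x - s)) * g s =
      Complex.exp (m * x) * ∫ s in Iic x, Complex.exp (-(m * s)) * g s := by
  rw [← integral_const_mul]
  congr 1
  funext s
  rw [← mul_assoc, ← Complex.exp_add]
  congr 2
  ring

lemma hasDerivAt_volterra {μ : Fin 3 → ℂ} {a : Fin 3} (hμ : (μ a).re ≤ 0) {g : ℝ → Fin 3 → ℂ}
    (hg : Continuous g) {C : ℝ} (hC : ∀ s, ‖g s‖ ≤ C / (1 + s ^ 2)) (x : ℝ) :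
    HasDerivAt (fun x => volterra μ g x a) (μ a * volterra μ g x a + g x a) x := by
  have hg' : Continuous fun s => g s a := by fun_prop
  have hC' : ∀ s, ‖g s a‖ ≤ C / (1 + s ^ 2) := fun s => (norm_le_pi_norm _ a).trans (hC s)
  have hi : ∀ x : ℝ, IntegrableOn (fun s : ℝ => Complex.exp (-(μ a * s)) * g s a) (Iic x) := by
    intro x
    have := (integrableOn_exp_mul hμ hg' hC' x).const_mul (Complex.exp (-(μ a * x)))
    refine this.congr (ae_of_all _ fun s => ?_)
    simp only
    rw [← mul_assoc, ← Complex.exp_add]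
    congr 2
    ring
  have h1 := hasDerivAt_integral_Iic (h := fun s : ℝ => Complex.exp (-(μ a * s)) * g s a)
    (by fun_prop) hi x
  have h2 : HasDerivAt (fun x : ℝ => Complex.exp (μ a * x)) (Complex.exp (μ a * x) * μ a) x := by
    have := ((hasDerivAt_id x).ofReal_comp.const_mul (μ a)).cexp
    simpa using this
  have h3 := h2.mul h1
  have e : (fun x => volterra μ g x a) = fun x : ℝ => Complex.exp (μ a * x) *
      ∫ s in Iic x, Complex.exp (-(μ a * s)) * g s a := by
    funext x
    exact exp_volterra_split _ _ _
  rw [e]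
  refine h3.congr_deriv ?_
  have : volterra μ g x a = Complex.exp (μ a * x) *
      ∫ s in Iic x, Complex.exp (-(μ a * s)) * g s a := exp_volterra_split _ _ _
  rw [this, ← mul_assoc (Complex.exp _) (Complex.exp _), ← Complex.exp_add]
  simp
  ring

lemma continuous_volterra {μ : Fin 3 → ℂ} (hμ : ∀ a, (μ a).re ≤ 0) {g : ℝ → Fin 3 → ℂ}
    (hg : Continuous g) {C : ℝ} (hC : ∀ s, ‖g s‖ ≤ C / (1 + s ^ 2)) :
    Continuous (volterra μ g) := by
  refine continuous_pi fun a => ?_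
  exact continuous_iff_continuousAt.2 fun x => (hasDerivAt_volterra (hμ a) hg hC x).continuousAt

lemma volterra_sub {μ : Fin 3 → ℂ} (hμ : ∀ a, (μ a).re ≤ 0) {g h : ℝ → Fin 3 → ℂ}
    (hg : Continuous g) {C D : ℝ} (hC : ∀ s, ‖g s‖ ≤ C / (1 + s ^ 2))
    (hh : Continuous h) (hD : ∀ s, ‖h s‖ ≤ D / (1 + s ^ 2)) (x : ℝ) :
    volterra μ (fun s => g s - h s) x = volterra μ g x - volterra μ h x := by
  funext a
  simp only [volterra, Pi.sub_apply]
  rw [← integral_sub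
    (integrableOn_exp_mul (hμ a) (by fun_prop) (fun s => (norm_le_pi_norm _ a).trans (hC s)) x)
    (integrableOn_exp_mul (hμ a) (by fun_prop) (fun s => (norm_le_pi_norm _ a).trans (hD s)) x)]
  congr 1
  funext s
  ring

namespace PotBound

variable {K : ℝ} {Q : ℝ → Matrix (Fin 3) (Fin 3) ℂ}

lemma continuous_mulVec (hQ : PotBound K Q) {y : ℝ → Fin 3 → ℂ} (hy : Continuous y) :
    Continuous fun s => (Q s).mulVec (y s) :=
  hQ.continuous.matrix_mulVec hy

lemma norm_mulVec_le (hQ : PotBound K Q) {y : ℝ → Fin 3 → ℂ} {C : ℝ} (hC : ∀ s, ‖y s‖ ≤ C)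
    (s : ℝ) : ‖(Q s).mulVec (y s)‖ ≤ (K * C) / (1 + s ^ 2) := by
  have hK := hQ.nonneg
  calc _ ≤ K / (1 + s ^ 2) * ‖y s‖ := hQ.bound s _
    _ ≤ K / (1 + s ^ 2) * C := by gcongr; exact hC s
    _ = _ := by ring

lemma unique_sol (hQ : PotBound K Q) {μ e : Fin 3 → ℂ} (hμ : ∀ a, (μ a).re ≤ 0)
    {y z : ℝ → Fin 3 → ℂ} (hy : IsVolterraSol μ e Q y) (hz : IsVolterraSol μ e Q z) : y = z := by
  obtain ⟨C, hC⟩ := hy.bounded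
  obtain ⟨D, hD⟩ := hz.bounded
  funext x
  have h : ∀ x, ‖(y x - z x) - volterra μ (fun s => (Q s).mulVec (y s - z s)) x‖ ≤ 0 := by
    intro x
    have e1 : (fun s => (Q s).mulVec (y s - z s)) =
        fun s => (Q s).mulVec (y s) - (Q s).mulVec (z s) := by
      funext s
      rw [Matrix.mulVec_sub]
    rw [e1, volterra_sub hμ (hQ.continuous_mulVec hy.continuous) (hQ.norm_mulVec_le hC)
      (hQ.continuous_mulVec hz.continuous) (hQ.norm_mulVec_le hD), hy.eq x, hz.eq x]
    simp
  have := norm_le_of_volterra hμ hQ (w := fun x => y x - z x)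
    ⟨C + D, fun x => (norm_sub_le _ _).trans (add_le_add (hC x) (hD x))⟩ h x
  simp at this
  exact sub_eq_zero.1 this

lemma norm_sol_le (hQ : PotBound K Q) {μ e : Fin 3 → ℂ} (hμ : ∀ a, (μ a).re ≤ 0)
    (he : ‖e‖ ≤ 1) {y : ℝ → Fin 3 → ℂ} (hy : IsVolterraSol μ e Q y) (x : ℝ) :
    ‖y x‖ ≤ 2 * Real.exp (2 * K * Real.pi) := by
  have h := norm_le_of_volterra hμ hQ (w := y) (ε := 1) hy.bounded
    (fun x => by nth_rewrite 1 [hy.eq x]; simpa using he) x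
  have := weight_le hQ.nonneg x
  linarith

end PotBound

/-! ### Existence by successive approximation -/

/-- The Picard iterates of the Volterra equation. -/
def picard (μ e : Fin 3 → ℂ) (Q : ℝ → Matrix (Fin 3) (Fin 3) ℂ) : ℕ → ℝ → Fin 3 → ℂ
  | 0 => fun _ => e
  | n + 1 => fun x => e + volterra μ (fun s => (Q s).mulVec (picard μ e Q n s)) x

section Picard

variable {K : ℝ} {Q : ℝ → Matrix (Fin 3) (Fin 3) ℂ} {μ e : Fin 3 → ℂ}

lemma picard_regular (hQ : PotBound K Q) (hμ : ∀ a, (μ a).re ≤ 0) (he : ‖e‖ ≤ 1) (n : ℕ) :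
    Continuous (picard μ e Q n) ∧ ∀ x, ‖picard μ e Q n x‖ ≤ 2 * weight K x := by
  induction n with
  | zero =>
    refine ⟨continuous_const, fun x => ?_⟩
    have := one_le_weight hQ.nonneg x
    simp only [picard]
    linarith
  | succ n ih =>
    have hb : ∀ x, ‖picard μ e Q n x‖ ≤ 2 * Real.exp (2 * K * Real.pi) := fun x =>
      (ih.2 x).trans (by gcongr; exact weight_le hQ.nonneg x)
    refine ⟨continuous_const.add (continuous_volterra hμ (hQ.continuous_mulVec ih.1)
      (hQ.norm_mulVec_le hb)), fun x => ?_⟩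
    have h1 := norm_volterra_mulVec_le hμ hQ (by norm_num) ih.2 x
    have h2 := one_le_weight hQ.nonneg x
    simp only [picard]
    refine (norm_add_le _ _).trans ?_
    linarith

lemma picard_bounded (hQ : PotBound K Q) (hμ : ∀ a, (μ a).re ≤ 0) (he : ‖e‖ ≤ 1) (n : ℕ) (x : ℝ) :
    ‖picard μ e Q n x‖ ≤ 2 * Real.exp (2 * K * Real.pi) :=
  ((picard_regular hQ hμ he n).2 x).trans (by gcongr; exact weight_le hQ.nonneg x)

lemma picard_succ_sub (hQ : PotBound K Q) (hμ : ∀ a, (μ a).re ≤ 0) (he : ‖e‖ ≤ 1) (n : ℕ) (x : ℝ) :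
    ‖picard μ e Q (n + 1) x - picard μ e Q n x‖ ≤ (1 / 2) ^ n * weight K x := by
  induction n generalizing x with
  | zero =>
    have h := norm_volterra_mulVec_le hμ hQ (f := fun _ => e) (C := 1) (by norm_num)
      (fun s => by have := one_le_weight hQ.nonneg s; linarith) x
    have := weight_pos K x
    simp only [picard, add_sub_cancel_left, pow_zero, one_mul]
    linarith
  | succ n ih =>
    have h := norm_volterra_mulVec_le hμ hQ
      (f := fun s => picard μ e Q (n + 1) s - picard μ e Q n s) (by positivity) ih x
    simp only [Matrix.mulVec_sub] at h
    rw [volterra_sub hμ (hQ.continuous_mulVec (picard_regular hQ hμ he _).1)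
      (hQ.norm_mulVec_le (picard_bounded hQ hμ he _))
      (hQ.continuous_mulVec (picard_regular hQ hμ he _).1)
      (hQ.norm_mulVec_le (picard_bounded hQ hμ he _))] at h
    have e1 : picard μ e Q (n + 1 + 1) x - picard μ e Q (n + 1) x =
        volterra μ (fun s => (Q s).mulVec (picard μ e Q (n + 1) s)) x -
        volterra μ (fun s => (Q s).mulVec (picard μ e Q n s)) x :=
      add_sub_add_left_eq_sub _ _ _
    rw [e1]
    refine h.trans (le_of_eq ?_)
    ring

/-- Successive iterates differ by a geometric sequence in the weight. The rate depends on `K` alone,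
not on the exponents `μ`; this uniformity is what carries continuity and holomorphy in `k` from the
iterates over to the solution. -/
lemma exists_picard_limit (hQ : PotBound K Q) (hμ : ∀ a, (μ a).re ≤ 0) (he : ‖e‖ ≤ 1) :
    ∃ y, IsVolterraSol μ e Q y ∧ ∀ n x, ‖picard μ e Q n x - y x‖ ≤
      2 * Real.exp (2 * K * Real.pi) * (1 / 2) ^ n := by
  set D := 2 * Real.exp (2 * K * Real.pi) with hD
  have hstep : ∀ x n, dist (picard μ e Q n x) (picard μ e Q (n + 1) x) ≤ D / 2 / 2 ^ n := by
    intro x n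
    rw [dist_comm, dist_eq_norm]
    refine (picard_succ_sub hQ hμ he n x).trans ?_
    have := weight_le hQ.nonneg x
    rw [hD, one_div, inv_pow, mul_comm, ← div_eq_mul_inv]
    gcongr
    linarith
  have hlim : ∀ x, ∃ z, Tendsto (fun n => picard μ e Q n x) atTop (𝓝 z) := fun x =>
    cauchySeq_tendsto_of_complete (cauchySeq_of_le_geometric_two (hstep x))
  choose y hy using hlim
  have hdist : ∀ n x, ‖picard μ e Q n x - y x‖ ≤ D * (1 / 2) ^ n := by
    intro n x
    have := dist_le_of_le_geometric_two_of_tendsto (hstep x) (hy x) n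
    rw [dist_eq_norm] at this
    rw [one_div, inv_pow, ← div_eq_mul_inv]
    exact this
  have h0 : Tendsto (fun n : ℕ => D * (1 / 2 : ℝ) ^ n) atTop (𝓝 0) := by
    simpa using (tendsto_pow_atTop_nhds_zero_of_lt_one (by norm_num : (0 : ℝ) ≤ 1 / 2)
      (by norm_num)).const_mul D
  have hcont : Continuous y := by
    have hu : TendstoUniformly (fun n => picard μ e Q n) y atTop := by
      rw [Metric.tendstoUniformly_iff]
      intro ε hε
      filter_upwards [h0.eventually_lt_const hε] with n hn x
      rw [dist_comm, dist_eq_norm]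
      exact (hdist n x).trans_lt hn
    exact hu.continuous (Eventually.of_forall fun n => (picard_regular hQ hμ he n).1).frequently
  have hbd : ∀ x, ‖y x‖ ≤ D := fun x =>
    le_of_tendsto (hy x).norm (Eventually.of_forall fun n => picard_bounded hQ hμ he n x)
  refine ⟨y, ⟨hcont, ⟨D, hbd⟩, fun x => ?_⟩, hdist⟩
  refine tendsto_nhds_unique ((tendsto_add_atTop_iff_nat 1).2 (hy x)) ?_
  rw [tendsto_iff_norm_sub_tendsto_zero]
  refine squeeze_zero (fun _ => norm_nonneg _) (fun n => ?_)
    (g := fun n => D * (1 / 2) ^ n / 2 * weight K x) ?_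
  · simp only [picard, add_sub_add_left_eq_sub]
    rw [← volterra_sub hμ (hQ.continuous_mulVec (picard_regular hQ hμ he _).1)
      (hQ.norm_mulVec_le (picard_bounded hQ hμ he _))
      (hQ.continuous_mulVec hcont) (hQ.norm_mulVec_le hbd)]
    simp only [← Matrix.mulVec_sub]
    refine norm_volterra_mulVec_le hμ hQ (by positivity) (fun s => ?_) x
    refine (hdist n s).trans (le_mul_of_one_le_right (by positivity) (one_le_weight hQ.nonneg s))
  · simpa using (h0.div_const 2).mul_const (weight K x)

lemma PotBound.existsUnique_sol (hQ : PotBound K Q) (hμ : ∀ a, (μ a).re ≤ 0) (he : ‖e‖ ≤ 1) :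
    ∃! y, IsVolterraSol μ e Q y := by
  obtain ⟨y, hy, -⟩ := exists_picard_limit hQ hμ he
  exact ⟨y, hy, fun z hz => hQ.unique_sol hμ hz hy⟩

lemma PotBound.norm_picard_sub_le (hQ : PotBound K Q) (hμ : ∀ a, (μ a).re ≤ 0) (he : ‖e‖ ≤ 1)
    {y : ℝ → Fin 3 → ℂ} (hy : IsVolterraSol μ e Q y) (n : ℕ) (x : ℝ) :
    ‖picard μ e Q n x - y x‖ ≤ 2 * Real.exp (2 * K * Real.pi) * (1 / 2) ^ n := by
  obtain ⟨z, hz, h⟩ := exists_picard_limit hQ hμ he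
  rw [hQ.unique_sol hμ hy hz]
  exact h n x

end Picard

end CMKdV
end

noncomputable section
namespace CMKdV

/-! ### Dependence on the spectral parameter -/

/-- For holomorphic integrands a bound on `F` suffices: the Cauchy estimate on discs of a fixed
radius `r` bounds the derivative by `b / r`, and differentiation under the integral sign applies. -/
lemma differentiableOn_integral_of_dominated {ν : Measure ℝ} {U : Set ℂ} (hU : IsOpen U)
    {F : ℂ → ℝ → ℂ} {b : ℝ → ℝ} (hm : ∀ k ∈ U, AEStronglyMeasurable (F k) ν)
    (hd : ∀ᵐ s ∂ν, DifferentiableOn ℂ (fun k => F k s) U)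
    (hb : ∀ᵐ s ∂ν, ∀ k ∈ U, ‖F k s‖ ≤ b s) (hi : Integrable b ν) :
    DifferentiableOn ℂ (fun k => ∫ s, F k s ∂ν) U := by
  intro k₀ hk₀
  obtain ⟨ε, hε, hball⟩ := Metric.isOpen_iff.1 hU k₀ hk₀
  -- A disc of radius `ε / 3` about a point of the ball of the same radius stays inside the ball of
  -- radius `ε`.
  set r := ε / 3 with hr
  have hr0 : 0 < r := by positivity
  have hsub : ∀ k ∈ Metric.ball k₀ r, Metric.closedBall k r ⊆ U := by
    intro k hk
    refine (Metric.closedBall_subset_ball' ?_).trans hball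
    have := Metric.mem_ball.1 hk
    linarith
  have hkU : ∀ k ∈ Metric.ball k₀ r, k ∈ U := fun k hk =>
    hsub k hk (Metric.mem_closedBall_self hr0.le)
  have hderiv : ∀ᵐ s ∂ν, ∀ k ∈ Metric.ball k₀ r,
      HasDerivAt (fun k => F k s) (deriv (fun k => F k s) k) k := by
    filter_upwards [hd] with s hs k hk
    exact (hs.differentiableAt (hU.mem_nhds (hkU k hk))).hasDerivAt
  have hmeas : AEStronglyMeasurable (fun s => deriv (fun k => F k s) k₀) ν := by
    -- The derivative is measurable as a limit of difference quotients. The shift by 2 keeps every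
    -- increment, including that for `n = 0`, strictly below `r`.
    set h : ℕ → ℂ := fun n => ((r / (n + 2) : ℝ) : ℂ) with hh
    have hpos : ∀ n : ℕ, 0 < r / ((n : ℝ) + 2) := fun n => by positivity
    have hlim : Tendsto h atTop (𝓝[≠] 0) := by
      refine tendsto_nhdsWithin_iff.2 ⟨?_, Eventually.of_forall fun n => ?_⟩
      · have h1 : Tendsto (fun n : ℕ => r / ((n : ℝ) + 2)) atTop (𝓝 0) :=
          Tendsto.div_atTop tendsto_const_nhds
            (tendsto_atTop_add_const_right _ _ tendsto_natCast_atTop_atTop)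
        have h2 := (Complex.continuous_ofReal.tendsto 0).comp h1
        rwa [Complex.ofReal_zero] at h2
      · exact Complex.ofReal_ne_zero.2 (hpos n).ne'
    refine aestronglyMeasurable_of_tendsto_ae atTop
      (f := fun n s => (h n)⁻¹ • (F (k₀ + h n) s - F k₀ s)) (fun n => ?_) ?_
    · refine AEStronglyMeasurable.fun_const_smul (AEStronglyMeasurable.fun_sub (hm _ (hkU _ ?_)) (hm _ hk₀)) _
      rw [Metric.mem_ball, dist_eq_norm, add_sub_cancel_left, hh]
      simp only [Complex.norm_real, Real.norm_of_nonneg (hpos n).le]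
      apply div_lt_self hr0
      have : (0 : ℝ) ≤ n := n.cast_nonneg
      linarith
    · filter_upwards [hderiv] with s hs
      exact (hasDerivAt_iff_tendsto_slope_zero.1 (hs k₀ (Metric.mem_ball_self hr0))).comp hlim
  refine (hasDerivAt_integral_of_dominated_loc_of_deriv_le (bound := fun s => b s / r)
    (F' := fun k s => deriv (fun k => F k s) k)
    (Metric.ball_mem_nhds k₀ hr0) ?_ ?_ hmeas ?_ (hi.div_const r) hderiv).2.differentiableAt.differentiableWithinAt
  · filter_upwards [hU.mem_nhds hk₀] with k hk using hm k hk
  · refine hi.mono' (hm k₀ hk₀) ?_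
    filter_upwards [hb] with s hs using hs k₀ hk₀
  · filter_upwards [hd, hb] with s hs hbs k hk
    refine Complex.norm_deriv_le_of_forall_mem_sphere_norm_le hr0 ?_ fun z hz =>
      hbs z (hsub k hk (Metric.sphere_subset_closedBall hz))
    exact (hs.mono (hsub k hk)).diffContOnCl_ball subset_rfl

section Parameter

variable {K : ℝ} {Q : ℝ → Matrix (Fin 3) (Fin 3) ℂ} {μ : ℂ → Fin 3 → ℂ} {e : Fin 3 → ℂ} {D U : Set ℂ}
  {y : ℂ → ℝ → Fin 3 → ℂ}

lemma mulVec_apply_sum (A : Matrix (Fin 3) (Fin 3) ℂ) (v : Fin 3 → ℂ) (a : Fin 3) :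
    A.mulVec v a = ∑ b, A a b * v b := rfl

lemma picard_continuousOn (hQ : PotBound K Q) (hμc : ∀ a, Continuous fun k => μ k a)
    (hμ : ∀ k ∈ D, ∀ a, (μ k a).re ≤ 0) (he : ‖e‖ ≤ 1) (n : ℕ) (x : ℝ) (a : Fin 3) :
    ContinuousOn (fun k => picard (μ k) e Q n x a) D := by
  induction n generalizing x a with
  | zero => exact continuousOn_const
  | succ n ih =>
    refine continuousOn_const.add (continuousOn_of_dominated
      (bound := fun s => (K * (2 * Real.exp (2 * K * Real.pi))) / (1 + s ^ 2))
      (fun k hk => ?_) (fun k hk => ?_) (integrable_div_one_add_sq _).integrableOn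
      (ae_of_all _ fun s => ?_))
    · have h1 := (picard_regular hQ (hμ k hk) he n).1
      have h2 := hQ.continuous_mulVec h1
      exact Continuous.aestronglyMeasurable (by fun_prop)
    · filter_upwards [ae_restrict_mem measurableSet_Iic] with s hs
      rw [norm_mul]
      refine (mul_le_of_le_one_left (norm_nonneg _) (norm_exp_mul_le (hμ k hk a) hs)).trans ?_
      exact (norm_le_pi_norm _ a).trans (hQ.norm_mulVec_le (picard_bounded hQ (hμ k hk) he n) s)
    · simp only [mulVec_apply_sum]
      refine ContinuousOn.mul ?_ (continuousOn_finsetSum _ fun b _ => continuousOn_const.mul (ih s b))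
      exact Continuous.continuousOn (by have := hμc a; fun_prop)

lemma picard_differentiableOn (hQ : PotBound K Q) (hU : IsOpen U)
    (hμd : ∀ a, Differentiable ℂ fun k => μ k a)
    (hμ : ∀ k ∈ U, ∀ a, (μ k a).re ≤ 0) (he : ‖e‖ ≤ 1) (n : ℕ) (x : ℝ) (a : Fin 3) :
    DifferentiableOn ℂ (fun k => picard (μ k) e Q n x a) U := by
  induction n generalizing x a with
  | zero => exact differentiableOn_const _
  | succ n ih =>
    refine (differentiableOn_const _).add (differentiableOn_integral_of_dominated hU
      (b := fun s => (K * (2 * Real.exp (2 * K * Real.pi))) / (1 + s ^ 2))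
      (fun k hk => ?_) (ae_of_all _ fun s => ?_) ?_ (integrable_div_one_add_sq _).integrableOn)
    · have h1 := (picard_regular hQ (hμ k hk) he n).1
      have h2 := hQ.continuous_mulVec h1
      exact Continuous.aestronglyMeasurable (by fun_prop)
    · simp only [mulVec_apply_sum]
      refine DifferentiableOn.mul ?_ (DifferentiableOn.fun_sum fun b _ => (ih s b).const_mul _)
      exact Differentiable.differentiableOn (by have := hμd a; fun_prop)
    · filter_upwards [ae_restrict_mem measurableSet_Iic] with s hs k hk
      rw [norm_mul]
      refine (mul_le_of_le_one_left (norm_nonneg _) (norm_exp_mul_le (hμ k hk a) hs)).trans ?_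
      exact (norm_le_pi_norm _ a).trans (hQ.norm_mulVec_le (picard_bounded hQ (hμ k hk) he n) s)

lemma picard_tendstoUniformlyOn (hQ : PotBound K Q) (hμ : ∀ k ∈ D, ∀ a, (μ k a).re ≤ 0)
    (he : ‖e‖ ≤ 1) (hy : ∀ k ∈ D, IsVolterraSol (μ k) e Q (y k)) (x : ℝ) (a : Fin 3) :
    TendstoUniformlyOn (fun n k => picard (μ k) e Q n x a) (fun k => y k x a) atTop D := by
  rw [Metric.tendstoUniformlyOn_iff]
  intro ε hε
  have h0 : Tendsto (fun n : ℕ => 2 * Real.exp (2 * K * Real.pi) * (1 / 2 : ℝ) ^ n) atTop (𝓝 0) := by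
    simpa using (tendsto_pow_atTop_nhds_zero_of_lt_one (by norm_num : (0 : ℝ) ≤ 1 / 2)
      (by norm_num)).const_mul (2 * Real.exp (2 * K * Real.pi))
  filter_upwards [h0.eventually_lt_const hε] with n hn k hk
  rw [dist_comm, dist_eq_norm]
  exact ((norm_le_pi_norm (picard (μ k) e Q n x - y k x) a).trans
    (hQ.norm_picard_sub_le (hμ k hk) he (hy k hk) n x)).trans_lt hn

lemma sol_continuousOn (hQ : PotBound K Q) (hμc : ∀ a, Continuous fun k => μ k a)
    (hμ : ∀ k ∈ D, ∀ a, (μ k a).re ≤ 0) (he : ‖e‖ ≤ 1)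
    (hy : ∀ k ∈ D, IsVolterraSol (μ k) e Q (y k)) (x : ℝ) (a : Fin 3) :
    ContinuousOn (fun k => y k x a) D :=
  (picard_tendstoUniformlyOn hQ hμ he hy x a).continuousOn
    (Eventually.of_forall fun n => picard_continuousOn hQ hμc hμ he n x a).frequently

lemma sol_differentiableOn (hQ : PotBound K Q) (hU : IsOpen U)
    (hμd : ∀ a, Differentiable ℂ fun k => μ k a) (hμ : ∀ k ∈ U, ∀ a, (μ k a).re ≤ 0)
    (he : ‖e‖ ≤ 1) (hy : ∀ k ∈ U, IsVolterraSol (μ k) e Q (y k)) (x : ℝ) (a : Fin 3) :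
    DifferentiableOn ℂ (fun k => y k x a) U :=
  (picard_tendstoUniformlyOn hQ hμ he hy x a).tendstoLocallyUniformlyOn.differentiableOn
    (Eventually.of_forall fun n => picard_differentiableOn hQ hU hμd hμ he n x a) hU

lemma norm_mulVec_sol_le (hQ : PotBound K Q) {m : Fin 3 → ℂ} (hμ : ∀ a, (m a).re ≤ 0)
    (he : ‖e‖ ≤ 1) {z : ℝ → Fin 3 → ℂ} (hz : IsVolterraSol m e Q z) (s : ℝ) (a : Fin 3) :
    ‖(Q s).mulVec (z s) a‖ ≤ (K * (2 * Real.exp (2 * K * Real.pi))) / (1 + s ^ 2) :=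
  (norm_le_pi_norm _ a).trans (hQ.norm_mulVec_le (hQ.norm_sol_le hμ he hz) s)

lemma integral_sol_continuousOn (hQ : PotBound K Q) (hμc : ∀ a, Continuous fun k => μ k a)
    (hμ : ∀ k ∈ D, ∀ a, (μ k a).re ≤ 0) (he : ‖e‖ ≤ 1)
    (hy : ∀ k ∈ D, IsVolterraSol (μ k) e Q (y k)) (a : Fin 3) :
    ContinuousOn (fun k => ∫ s, (Q s).mulVec (y k s) a) D := by
  refine continuousOn_of_dominated
    (bound := fun s => (K * (2 * Real.exp (2 * K * Real.pi))) / (1 + s ^ 2)) (fun k hk => ?_)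
    (fun k hk => ae_of_all _ fun s => norm_mulVec_sol_le hQ (hμ k hk) he (hy k hk) s a)
    (integrable_div_one_add_sq _) (ae_of_all _ fun s => ?_)
  · have h2 := hQ.continuous_mulVec (hy k hk).continuous
    exact Continuous.aestronglyMeasurable (by fun_prop)
  · simp only [mulVec_apply_sum]
    exact continuousOn_finsetSum _ fun b _ =>
      continuousOn_const.mul (sol_continuousOn hQ hμc hμ he hy s b)

lemma integral_sol_differentiableOn (hQ : PotBound K Q) (hU : IsOpen U)
    (hμd : ∀ a, Differentiable ℂ fun k => μ k a) (hμ : ∀ k ∈ U, ∀ a, (μ k a).re ≤ 0)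
    (he : ‖e‖ ≤ 1) (hy : ∀ k ∈ U, IsVolterraSol (μ k) e Q (y k)) (a : Fin 3) :
    DifferentiableOn ℂ (fun k => ∫ s, (Q s).mulVec (y k s) a) U := by
  refine differentiableOn_integral_of_dominated hU
    (b := fun s => (K * (2 * Real.exp (2 * K * Real.pi))) / (1 + s ^ 2)) (fun k hk => ?_)
    (ae_of_all _ fun s => ?_)
    (ae_of_all _ fun s k hk => norm_mulVec_sol_le hQ (hμ k hk) he (hy k hk) s a)
    (integrable_div_one_add_sq _)
  · have h2 := hQ.continuous_mulVec (hy k hk).continuous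
    exact Continuous.aestronglyMeasurable (by fun_prop)
  · simp only [mulVec_apply_sum]
    exact DifferentiableOn.fun_sum fun b _ =>
      (sol_differentiableOn hQ hU hμd hμ he hy s b).const_mul _

end Parameter

end CMKdV
end

noncomputable section
namespace CMKdV

/-! ### Volterra equations as boundary value problems -/

section Boundary

variable {K : ℝ} {Q : ℝ → Matrix (Fin 3) (Fin 3) ℂ} {μ e : Fin 3 → ℂ} {y : ℝ → Fin 3 → ℂ}

/-- The assumption `he` says that the constant vector `e` solves the free equation, so it
contributes nothing to the differential equation of `y`. -/
lemma IsVolterraSol.hasDerivAt (hQ : PotBound K Q) (hμ : ∀ a, (μ a).re ≤ 0)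
    (he : ∀ a, μ a * e a = 0) (hy : IsVolterraSol μ e Q y) (x : ℝ) (a : Fin 3) :
    HasDerivAt (fun x => y x a) (μ a * y x a + (Q x).mulVec (y x) a) x := by
  obtain ⟨C, hC⟩ := hy.bounded
  have h := (hasDerivAt_volterra (hμ a) (hQ.continuous_mulVec hy.continuous)
    (hQ.norm_mulVec_le hC) x).const_add (e a)
  have e1 : (fun x => y x a) = fun x => e a + volterra μ (fun s => (Q s).mulVec (y s)) x a := by
    funext x
    exact congrFun (hy.eq x) a
  rw [e1]
  refine h.congr_deriv ?_
  have h2 := congrFun e1 x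
  rw [h2, mul_add, he a, zero_add]

lemma tendsto_volterra_atBot (hμ : ∀ a, (μ a).re ≤ 0) {g : ℝ → Fin 3 → ℂ} {C : ℝ}
    (hC : ∀ s, ‖g s‖ ≤ C / (1 + s ^ 2)) : Tendsto (volterra μ g) atBot (𝓝 0) := by
  refine squeeze_zero_norm (fun x => norm_volterra_le hμ hC (integrable_div_one_add_sq C).integrableOn) ?_
  have h := (tendsto_nhds_of_tendsto_nhdsWithin Real.tendsto_arctan_atBot).add_const (Real.pi / 2)
  have h2 := h.const_mul C
  simp only [neg_add_cancel, mul_zero] at h2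
  refine h2.congr fun x => ?_
  simp only [div_eq_mul_inv, integral_const_mul, integral_Iic_inv_one_add_sq]

lemma IsVolterraSol.tendsto_atBot (hQ : PotBound K Q) (hμ : ∀ a, (μ a).re ≤ 0)
    (hy : IsVolterraSol μ e Q y) : Tendsto y atBot (𝓝 e) := by
  obtain ⟨C, hC⟩ := hy.bounded
  have h := (tendsto_volterra_atBot hμ (hQ.norm_mulVec_le hC)).const_add e
  rw [add_zero] at h
  exact h.congr fun x => (hy.eq x).symm

/-- Only a component with vanishing exponent converges at the far end by this argument, since its
integrand does not depend on `x`. These limits will be the entries of the scattering matrix. -/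
lemma IsVolterraSol.tendsto_atTop (hQ : PotBound K Q) {a : Fin 3} (hμ : μ a = 0)
    (hy : IsVolterraSol μ e Q y) :
    Tendsto (fun x => y x a) atTop (𝓝 (e a + ∫ s, (Q s).mulVec (y s) a)) := by
  obtain ⟨C, hC⟩ := hy.bounded
  have hc : Continuous fun s => (Q s).mulVec (y s) a := by
    have := hQ.continuous_mulVec hy.continuous
    fun_prop
  have hi : Integrable fun s => (Q s).mulVec (y s) a :=
    (integrable_div_one_add_sq (K * C)).mono' hc.aestronglyMeasurable
      (ae_of_all _ fun s => (norm_le_pi_norm _ a).trans (hQ.norm_mulVec_le hC s))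
  have h := (aecover_Iic (μ := volume) tendsto_id).integral_tendsto_of_countably_generated hi
  refine (h.const_add (e a)).congr fun x => ?_
  have := congrFun (hy.eq x) a
  rw [this]
  simp [volterra, hμ]

/-- Integrate the derivative of `e^{μ (x - s)} w(s)` over `s < x`; decay of `w` removes the boundary
term at `-∞`. This converse to differentiating a Volterra integral identifies the time derivatives
of the Jost columns, and also serves as integration by parts. -/
lemma eq_volterra_of_hasDerivAt (hμ : ∀ a, (μ a).re ≤ 0) {w g : ℝ → Fin 3 → ℂ} (hg : Continuous g)
    {C : ℝ} (hC : ∀ s, ‖g s‖ ≤ C / (1 + s ^ 2))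
    (hw : ∀ x a, HasDerivAt (fun x => w x a) (μ a * w x a + g x a) x)
    (h0 : Tendsto w atBot (𝓝 0)) (x : ℝ) : w x = volterra μ g x := by
  funext a
  have hd : ∀ s : ℝ, HasDerivAt (fun s : ℝ => Complex.exp (μ a * (x - s)) * w s a)
      (Complex.exp (μ a * (x - s)) * g s a) s := by
    intro s
    have h1 : HasDerivAt (fun s : ℝ => Complex.exp (μ a * (x - s)))
        (Complex.exp (μ a * (x - s)) * (-μ a)) s := by
      have := (((hasDerivAt_id s).ofReal_comp.const_sub (x : ℂ)).const_mul (μ a)).cexp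
      simpa using this
    refine (h1.mul (hw s a)).congr_deriv ?_
    ring
  have hlim : Tendsto (fun s : ℝ => Complex.exp (μ a * (x - s)) * w s a) atBot (𝓝 0) := by
    have h0a : Tendsto (fun s => ‖w s‖) atBot (𝓝 0) := by simpa using h0.norm
    refine squeeze_zero_norm' ?_ h0a
    filter_upwards [eventually_le_atBot x] with s hs
    rw [norm_mul]
    exact (mul_le_of_le_one_left (norm_nonneg _) (norm_exp_mul_le (hμ a) hs)).trans
      (norm_le_pi_norm _ a)
  have := integral_Iic_of_hasDerivAt_of_tendsto' (a := x) (fun s _ => hd s)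
    (integrableOn_exp_mul (hμ a) (by fun_prop) (fun s => (norm_le_pi_norm _ a).trans (hC s)) x) hlim
  simp only [sub_self, mul_zero, Complex.exp_zero, one_mul, sub_zero] at this
  exact this.symm

end Boundary

/-! ### Jost columns -/

/-- The potentials are smooth and, with their first three derivatives, bounded by `K / (1 + x²)`. -/
structure Admissible (K : ℝ) (p q : ℝ → ℝ) : Prop where
  nonneg : 0 ≤ K
  smooth_left : ContDiff ℝ (⊤ : ℕ∞) p
  smooth_right : ContDiff ℝ (⊤ : ℕ∞) q
  bound_left : ∀ b ≤ 3, ∀ x, |iteratedDeriv b p x| ≤ K / (1 + x ^ 2)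
  bound_right : ∀ b ≤ 3, ∀ x, |iteratedDeriv b q x| ≤ K / (1 + x ^ 2)

/-- The exponents of the `j`-th Jost column. -/
def rate (α : ℝ) (k : ℂ) (j a : Fin 3) : ℂ := Complex.I * α * k * (lam a - lam j)

/-- The `j`-th standard basis vector. -/
def basisVec (j : Fin 3) : Fin 3 → ℂ := fun a => (1 : Matrix (Fin 3) (Fin 3) ℂ) a j

/-- The potential matrix as a function on the line. -/
def pot (α : ℝ) (p q : ℝ → ℝ) (s : ℝ) : Matrix (Fin 3) (Fin 3) ℂ := potential α (p s) (q s)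

/-- The reflection `x ↦ -f(-x)` of a potential. -/
def reflect (f : ℝ → ℝ) (x : ℝ) : ℝ := -f (-x)

/-- The spectral parameters for which the `j`-th column of `J₁` exists. -/
def Good (α : ℝ) (k : ℂ) (j : Fin 3) : Prop := ∀ a, (rate α k j a).re ≤ 0

lemma norm_basisVec (j : Fin 3) : ‖basisVec j‖ ≤ 1 := by
  refine (pi_norm_le_iff_of_nonneg zero_le_one).2 fun a => ?_
  rw [basisVec, Matrix.one_apply]
  split_ifs <;> simp

lemma rate_self (α : ℝ) (k : ℂ) (j : Fin 3) : rate α k j j = 0 := by simp [rate]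

lemma rate_mul_basisVec (α : ℝ) (k : ℂ) (j a : Fin 3) : rate α k j a * basisVec j a = 0 := by
  by_cases h : a = j
  · rw [h, rate_self, zero_mul]
  · rw [basisVec, Matrix.one_apply_ne h, mul_zero]

lemma rate_neg (α : ℝ) (k : ℂ) (j a : Fin 3) : rate α (-k) j a = -rate α k j a := by
  simp [rate]

lemma differentiable_rate (α : ℝ) (j a : Fin 3) : Differentiable ℂ fun k => rate α k j a := by
  unfold rate
  fun_prop

lemma good_zero {α : ℝ} {k : ℂ} (h : 0 ≤ α * k.im) : Good α k 0 := by
  intro a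
  fin_cases a <;> simp [rate, lam] <;> linarith

lemma good_of_ne_zero {α : ℝ} {k : ℂ} {j : Fin 3} (hj : j ≠ 0) (h : α * k.im ≤ 0) : Good α k j := by
  intro a
  fin_cases j
  · exact absurd rfl hj
  all_goals
    fin_cases a
    all_goals simp [rate, lam]
    all_goals linarith

lemma norm_potential_mulVec_le {α : ℝ} (hα : α ^ 2 = 1) {p q A : ℝ} (hp : |p| ≤ A) (hq : |q| ≤ A)
    (v : Fin 3 → ℂ) : ‖(potential α p q).mulVec v‖ ≤ 2 * A * ‖v‖ := by
  have hα1 : |α| = 1 := by rw [← sq_eq_sq₀ (abs_nonneg _) zero_le_one, sq_abs, hα, one_pow]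
  have h0 : 0 ≤ A := (abs_nonneg _).trans hp
  have hv := fun b => norm_le_pi_norm v b
  have hn : 0 ≤ A * ‖v‖ := by positivity
  refine (pi_norm_le_iff_of_nonneg (by positivity)).2 fun a => ?_
  rw [mulVec_apply_sum, Fin.sum_univ_three]
  have t1 : ∀ b, ‖(p : ℂ) * v b‖ ≤ A * ‖v‖ := fun b => by
    rw [norm_mul, Complex.norm_real, Real.norm_eq_abs]
    exact mul_le_mul hp (hv b) (norm_nonneg _) h0
  have t2 : ∀ b, ‖(q : ℂ) * v b‖ ≤ A * ‖v‖ := fun b => by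
    rw [norm_mul, Complex.norm_real, Real.norm_eq_abs]
    exact mul_le_mul hq (hv b) (norm_nonneg _) h0
  fin_cases a
  · have := norm_add_le ((α : ℂ) * (p * v 1)) (α * (q * v 2))
    rw [norm_mul (α : ℂ), norm_mul (α : ℂ), Complex.norm_real, Real.norm_eq_abs, hα1, one_mul,
      one_mul] at this
    have h1 := t1 1
    have h2 := t2 2
    simp only [potential]
    simp
    rw [mul_assoc, mul_assoc]
    linarith
  · have := t1 0
    simp only [potential]
    simp
    rw [norm_mul, Complex.norm_real, Real.norm_eq_abs] at this
    linarith
  · have := t2 0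
    simp only [potential]
    simp
    rw [norm_mul, Complex.norm_real, Real.norm_eq_abs] at this
    linarith

lemma potBound_of_abs_le {α K : ℝ} (hα : α ^ 2 = 1) (hK : 0 ≤ K) {p q : ℝ → ℝ} (hp : Continuous p)
    (hq : Continuous q) (hpK : ∀ x, |p x| ≤ K / (1 + x ^ 2)) (hqK : ∀ x, |q x| ≤ K / (1 + x ^ 2)) :
    PotBound (2 * K) (pot α p q) := by
  refine ⟨by linarith, ?_, fun s v => ?_⟩
  · refine continuous_matrix fun a b => ?_
    fin_cases a <;> fin_cases b <;> simp only [pot, potential] <;> simp <;> fun_prop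
  · rw [mul_div_assoc]
    exact norm_potential_mulVec_le hα (hpK s) (hqK s) v

namespace Admissible

variable {K : ℝ} {p q : ℝ → ℝ}

lemma abs_left (h : Admissible K p q) (x : ℝ) : |p x| ≤ K / (1 + x ^ 2) := by
  simpa using h.bound_left 0 (by norm_num) x

lemma abs_right (h : Admissible K p q) (x : ℝ) : |q x| ≤ K / (1 + x ^ 2) := by
  simpa using h.bound_right 0 (by norm_num) x

lemma reflect (h : Admissible K p q) : Admissible K (reflect p) (reflect q) := by
  have key : ∀ f : ℝ → ℝ, ∀ b x, |iteratedDeriv b (CMKdV.reflect f) x| = |iteratedDeriv b f (-x)| := by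
    intro f b x
    have : CMKdV.reflect f = -fun x => f (-x) := rfl
    rw [this, iteratedDeriv_neg, iteratedDeriv_comp_neg]
    simp [abs_mul]
  refine ⟨h.nonneg, (h.smooth_left.comp contDiff_neg).neg, (h.smooth_right.comp contDiff_neg).neg,
    fun b hb x => ?_, fun b hb x => ?_⟩
  · rw [key]; simpa using h.bound_left b hb (-x)
  · rw [key]; simpa using h.bound_right b hb (-x)

lemma potBound (h : Admissible K p q) {α : ℝ} (hα : α ^ 2 = 1) : PotBound (2 * K) (pot α p q) :=
  potBound_of_abs_le hα h.nonneg h.smooth_left.continuous h.smooth_right.continuous h.abs_left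
    h.abs_right

end Admissible

lemma isJostLeftColumn_iff {α : ℝ} {p q : ℝ → ℝ} {k : ℂ} {j : Fin 3} {y : ℝ → Fin 3 → ℂ} :
    IsJostLeftColumn α p q k j y ↔ IsVolterraSol (rate α k j) (basisVec j) (pot α p q) y := by
  have key : ∀ (x : ℝ) (a : Fin 3), (∫ s in Iic x, Complex.exp (Complex.I * α * k * (x - s) *
      (lam a - lam j)) * (potential α (p s) (q s)).mulVec (y s) a) =
      volterra (rate α k j) (fun s => (pot α p q s).mulVec (y s)) x a := by
    intro x a
    unfold volterra rate
    congr 1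
    funext s
    congr 2
    ring
  constructor
  · rintro ⟨h1, h2, h3⟩
    refine ⟨h1, h2, fun x => funext fun a => ?_⟩
    rw [h3 x a, key]
    rfl
  · rintro ⟨h1, h2, h3⟩
    refine ⟨h1, h2, fun x a => ?_⟩
    rw [key]
    exact congrFun (h3 x) a

lemma pot_reflect_mulVec (α : ℝ) (p q : ℝ → ℝ) (s : ℝ) (v : Fin 3 → ℂ) :
    (pot α (reflect p) (reflect q) s).mulVec v = -(pot α p q (-s)).mulVec v := by
  have : pot α (reflect p) (reflect q) s = -pot α p q (-s) := by
    ext a b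
    fin_cases a <;> fin_cases b <;> simp [pot, potential, reflect]
  rw [this, Matrix.neg_mulVec]

/-- Under `s ↦ -s` the integral over `(x, ∞)` becomes a Volterra integral. The change `k ↦ -k`
restores the exponents, and the sign in `reflect` absorbs the minus sign before the integral.
Statements about columns of `J₂` thus reduce to columns of `J₁` for reflected potentials. -/
lemma isJostRightColumn_iff {α : ℝ} {p q : ℝ → ℝ} {k : ℂ} {j : Fin 3} {y : ℝ → Fin 3 → ℂ} :
    IsJostRightColumn α p q k j y ↔ IsVolterraSol (rate α (-k) j) (basisVec j)
      (pot α (reflect p) (reflect q)) (fun x => y (-x)) := by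
  have key : ∀ (x : ℝ) (a : Fin 3), (∫ s in Ioi x, Complex.exp (Complex.I * α * k * (x - s) *
      (lam a - lam j)) * (potential α (p s) (q s)).mulVec (y s) a) =
      -volterra (rate α (-k) j)
        (fun s => (pot α (reflect p) (reflect q) s).mulVec (y (-s))) (-x) a := by
    intro x a
    have := integral_comp_neg_Iic (-x) (fun s : ℝ => Complex.exp (Complex.I * α * k * (x - s) *
      (lam a - lam j)) * (potential α (p s) (q s)).mulVec (y s) a)
    rw [neg_neg] at this
    rw [← this]
    unfold volterra rate
    rw [← integral_neg]
    congr 1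
    funext s
    simp only
    rw [pot_reflect_mulVec, Pi.neg_apply, mul_neg, neg_neg]
    congr 2
    push_cast
    ring
  constructor
  · rintro ⟨h1, ⟨C, hC⟩, h3⟩
    refine ⟨h1.comp continuous_neg, ⟨C, fun x => hC _⟩, fun x => funext fun a => ?_⟩
    rw [h3 (-x) a, key, sub_neg_eq_add, neg_neg]
    rfl
  · rintro ⟨h1, ⟨C, hC⟩, h3⟩
    refine ⟨?_, ⟨C, fun x => by simpa using hC (-x)⟩, fun x a => ?_⟩
    · simpa [Function.comp_def] using h1.comp continuous_neg
    · rw [key, sub_neg_eq_add]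
      have := congrFun (h3 (-x)) a
      rw [neg_neg] at this
      exact this

section Columns

variable {K α : ℝ} {p q : ℝ → ℝ} {k : ℂ} {j : Fin 3}

lemma existsUnique_left (h : Admissible K p q) (hα : α ^ 2 = 1) (hk : Good α k j) :
    ∃! y, IsJostLeftColumn α p q k j y := by
  simp only [isJostLeftColumn_iff]
  exact (h.potBound hα).existsUnique_sol hk (norm_basisVec j)

lemma existsUnique_right (h : Admissible K p q) (hα : α ^ 2 = 1) (hk : Good α (-k) j) :
    ∃! y, IsJostRightColumn α p q k j y := by
  obtain ⟨z, hz, hu⟩ := (h.reflect.potBound hα).existsUnique_sol hk (norm_basisVec j)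
  refine ⟨fun x => z (-x), ?_, fun y hy => ?_⟩
  · refine isJostRightColumn_iff.2 ?_
    simpa using hz
  · funext x
    have := congrFun (hu _ (isJostRightColumn_iff.1 hy)) (-x)
    simpa using this

/-- The `j`-th column of `J₁`. -/
def leftCol (α : ℝ) (p q : ℝ → ℝ) (k : ℂ) (j : Fin 3) (x : ℝ) (a : Fin 3) : ℂ :=
  jostLeft α p q x k a j

/-- The `j`-th column of `J₂`. -/
def rightCol (α : ℝ) (p q : ℝ → ℝ) (k : ℂ) (j : Fin 3) (x : ℝ) (a : Fin 3) : ℂ :=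
  jostRight α p q x k a j

lemma isJostLeftColumn_leftCol (h : Admissible K p q) (hα : α ^ 2 = 1) (hk : Good α k j) :
    IsJostLeftColumn α p q k j (leftCol α p q k j) :=
  Classical.epsilon_spec (existsUnique_left h hα hk).exists

lemma isJostRightColumn_rightCol (h : Admissible K p q) (hα : α ^ 2 = 1) (hk : Good α (-k) j) :
    IsJostRightColumn α p q k j (rightCol α p q k j) :=
  Classical.epsilon_spec (existsUnique_right h hα hk).exists

lemma isVolterraSol_leftCol (h : Admissible K p q) (hα : α ^ 2 = 1) (hk : Good α k j) :
    IsVolterraSol (rate α k j) (basisVec j) (pot α p q) (leftCol α p q k j) :=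
  isJostLeftColumn_iff.1 (isJostLeftColumn_leftCol h hα hk)

lemma leftCol_reflect (h : Admissible K p q) (hα : α ^ 2 = 1) (hk : Good α (-k) j) (x : ℝ) :
    rightCol α p q k j x = leftCol α (reflect p) (reflect q) (-k) j (-x) := by
  have h1 := isJostRightColumn_iff.1 (isJostRightColumn_rightCol h hα hk)
  have h2 := isVolterraSol_leftCol h.reflect hα hk
  have := congrFun ((h.reflect.potBound hα).unique_sol hk h1 h2) (-x)
  simpa using this

/-- A bound for the Jost columns. -/
def jostBound (K : ℝ) : ℝ := 2 * Real.exp (2 * (2 * K) * Real.pi)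

lemma jostBound_nonneg (K : ℝ) : 0 ≤ jostBound K := by unfold jostBound; positivity

lemma norm_leftCol_le (h : Admissible K p q) (hα : α ^ 2 = 1) (hk : Good α k j) (x : ℝ) :
    ‖leftCol α p q k j x‖ ≤ jostBound K :=
  (h.potBound hα).norm_sol_le hk (norm_basisVec j) (isVolterraSol_leftCol h hα hk) x

lemma norm_rightCol_le (h : Admissible K p q) (hα : α ^ 2 = 1) (hk : Good α (-k) j) (x : ℝ) :
    ‖rightCol α p q k j x‖ ≤ jostBound K := by
  rw [leftCol_reflect h hα hk]
  exact norm_leftCol_le h.reflect hα hk _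

lemma hasDerivAt_leftCol (h : Admissible K p q) (hα : α ^ 2 = 1) (hk : Good α k j) (x : ℝ)
    (a : Fin 3) : HasDerivAt (fun x => leftCol α p q k j x a)
      (rate α k j a * leftCol α p q k j x a + (pot α p q x).mulVec (leftCol α p q k j x) a) x :=
  (isVolterraSol_leftCol h hα hk).hasDerivAt (h.potBound hα) hk (rate_mul_basisVec α k j) x a

lemma hasDerivAt_rightCol (h : Admissible K p q) (hα : α ^ 2 = 1) (hk : Good α (-k) j) (x : ℝ)
    (a : Fin 3) : HasDerivAt (fun x => rightCol α p q k j x a)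
      (rate α k j a * rightCol α p q k j x a + (pot α p q x).mulVec (rightCol α p q k j x) a) x := by
  simp only [leftCol_reflect h hα hk]
  have := (hasDerivAt_leftCol h.reflect hα hk (-x) a).scomp x (hasDerivAt_neg x)
  refine this.congr_deriv ?_
  rw [pot_reflect_mulVec, rate_neg, neg_neg]
  simp

lemma tendsto_leftCol_atBot (h : Admissible K p q) (hα : α ^ 2 = 1) (hk : Good α k j) (a : Fin 3) :
    Tendsto (fun x => leftCol α p q k j x a) atBot (𝓝 (basisVec j a)) :=
  (tendsto_pi_nhds.1 ((isVolterraSol_leftCol h hα hk).tendsto_atBot (h.potBound hα) hk)) a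

lemma tendsto_rightCol_atTop (h : Admissible K p q) (hα : α ^ 2 = 1) (hk : Good α (-k) j)
    (a : Fin 3) : Tendsto (fun x => rightCol α p q k j x a) atTop (𝓝 (basisVec j a)) := by
  simp only [leftCol_reflect h hα hk]
  exact (tendsto_leftCol_atBot h.reflect hα hk a).comp tendsto_neg_atTop_atBot

/-- The limits `δ_ij + ∫ (Q J₁)_ij` of the Jost columns at `+∞`. -/
def leftLimit (α : ℝ) (p q : ℝ → ℝ) (k : ℂ) (i j : Fin 3) : ℂ :=
  basisVec j i + ∫ s, (pot α p q s).mulVec (leftCol α p q k j s) i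

lemma tendsto_leftCol_atTop (h : Admissible K p q) (hα : α ^ 2 = 1) (hk : Good α k j) {i : Fin 3}
    (hij : rate α k j i = 0) :
    Tendsto (fun x => leftCol α p q k j x i) atTop (𝓝 (leftLimit α p q k i j)) :=
  (isVolterraSol_leftCol h hα hk).tendsto_atTop (h.potBound hα) hij

/-- Existence is all that is needed here; the value for the first column is found in
`blockDet_conj`. -/
lemma exists_tendsto_rightCol_atBot (h : Admissible K p q) (hα : α ^ 2 = 1) (hk : Good α (-k) j) :
    ∃ r, Tendsto (fun x => rightCol α p q k j x j) atBot (𝓝 r) := by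
  have := (tendsto_leftCol_atTop h.reflect hα hk (rate_self α _ j)).comp tendsto_neg_atBot_atTop
  simp only [leftCol_reflect h hα hk]
  exact ⟨_, this⟩

end Columns

end CMKdV
end

noncomputable section
namespace CMKdV

/-! ### Conserved quantities of the spatial equation -/

/-- The sesquilinear form `w† diag(-α, 1, 1) z`. -/
def pairing (α : ℝ) (w z : Fin 3 → ℂ) : ℂ :=
  -α * (starRingEnd ℂ (w 0) * z 0) + starRingEnd ℂ (w 1) * z 1 + starRingEnd ℂ (w 2) * z 2

/-- The determinant of the matrix with columns `u, v, w`. -/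
def det3 (u v w : Fin 3 → ℂ) : ℂ :=
  u 0 * (v 1 * w 2 - v 2 * w 1) - v 0 * (u 1 * w 2 - u 2 * w 1) + w 0 * (u 1 * v 2 - u 2 * v 1)

/-- `y` solves the spatial equation of the `j`-th Jost columns. -/
def IsSpatialSol (α : ℝ) (p q : ℝ → ℝ) (k : ℂ) (j : Fin 3) (y : ℝ → Fin 3 → ℂ) : Prop :=
  ∀ x a, HasDerivAt (fun x => y x a) (rate α k j a * y x a + (pot α p q x).mulVec (y x) a) x

lemma potential_mulVec_zero (α p q : ℝ) (v : Fin 3 → ℂ) :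
    (potential α p q).mulVec v 0 = α * (p * v 1 + q * v 2) := by
  simp [potential, Matrix.mulVec, dotProduct, Fin.sum_univ_three]
  ring

lemma potential_mulVec_one (α p q : ℝ) (v : Fin 3 → ℂ) :
    (potential α p q).mulVec v 1 = p * v 0 := by
  simp [potential, Matrix.mulVec, dotProduct, Fin.sum_univ_three]

lemma potential_mulVec_two (α p q : ℝ) (v : Fin 3 → ℂ) :
    (potential α p q).mulVec v 2 = q * v 0 := by
  simp [potential, Matrix.mulVec, dotProduct, Fin.sum_univ_three]

section General

variable {α : ℝ} {p q : ℝ → ℝ} {k k' : ℂ} {i j : Fin 3} {w z : ℝ → Fin 3 → ℂ}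

lemma hasDerivAt_conj {f : ℝ → ℂ} {f' : ℂ} {x : ℝ} (h : HasDerivAt f f' x) :
    HasDerivAt (fun x => starRingEnd ℂ (f x)) (starRingEnd ℂ f') x :=
  h.star

/-- With `G = diag(-α, 1, 1)` and `α² = 1` one has `Q† G + G Q = 0`, so the potential drops out and
only the diagonal exponents contribute. -/
lemma hasDerivAt_pairing (hα : α ^ 2 = 1) (hw : IsSpatialSol α p q k' i w)
    (hz : IsSpatialSol α p q k j z) (x : ℝ) :
    HasDerivAt (fun x => pairing α (w x) (z x))
      (-α * ((starRingEnd ℂ (rate α k' i 0) + rate α k j 0) * (starRingEnd ℂ (w x 0) * z x 0)) +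
        (starRingEnd ℂ (rate α k' i 1) + rate α k j 1) * (starRingEnd ℂ (w x 1) * z x 1) +
        (starRingEnd ℂ (rate α k' i 2) + rate α k j 2) * (starRingEnd ℂ (w x 2) * z x 2)) x := by
  have h := ((((hasDerivAt_conj (hw x 0)).mul (hz x 0)).const_mul (-α : ℂ)).add
    ((hasDerivAt_conj (hw x 1)).mul (hz x 1))).add ((hasDerivAt_conj (hw x 2)).mul (hz x 2))
  refine h.congr_deriv ?_
  have hα' : (α : ℂ) ^ 2 = 1 := by exact_mod_cast hα
  simp only [pot, potential_mulVec_zero, potential_mulVec_one, potential_mulVec_two, map_add,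
    map_mul, Complex.conj_ofReal]
  linear_combination (-(starRingEnd ℂ (w x 1) * p x + starRingEnd ℂ (w x 2) * q x) * z x 0 -
    starRingEnd ℂ (w x 0) * (p x * z x 1 + q x * z x 2)) * hα'

lemma conj_rate (α : ℝ) (k : ℂ) (i a : Fin 3) :
    starRingEnd ℂ (rate α (starRingEnd ℂ k) i a) = -rate α k i a := by
  have : ∀ a, starRingEnd ℂ (lam a) = lam a := by
    intro a
    fin_cases a <;> simp [lam]
  simp only [rate, map_mul, map_sub, this, Complex.conj_I, Complex.conj_ofReal, Complex.conj_conj]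
  ring

/-- Conjugating the spectral parameter makes the three exponents in `hasDerivAt_pairing` coincide:
each equals `-rate α k i j`, which the exponential factor compensates. -/
lemma pairing_mul_exp_const (hα : α ^ 2 = 1) (hw : IsSpatialSol α p q (starRingEnd ℂ k) i w)
    (hz : IsSpatialSol α p q k j z) (x x' : ℝ) :
    Complex.exp (rate α k i j * x) * pairing α (w x) (z x) =
      Complex.exp (rate α k i j * x') * pairing α (w x') (z x') := by
  have hd : ∀ x : ℝ, HasDerivAt (fun x : ℝ => Complex.exp (rate α k i j * x) *
      pairing α (w x) (z x)) 0 x := by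
    intro x
    have h1 : HasDerivAt (fun x : ℝ => Complex.exp (rate α k i j * x))
        (Complex.exp (rate α k i j * x) * rate α k i j) x := by
      simpa using ((hasDerivAt_id x).ofReal_comp.const_mul (rate α k i j)).cexp
    refine (h1.mul (hasDerivAt_pairing hα hw hz x)).congr_deriv ?_
    simp only [conj_rate]
    simp only [pairing, rate]
    ring
  exact is_const_of_deriv_eq_zero (fun x => (hd x).differentiableAt) (fun x => (hd x).deriv) x x'

lemma pairing_const (hα : α ^ 2 = 1) (hw : IsSpatialSol α p q (starRingEnd ℂ k) i w)
    (hz : IsSpatialSol α p q k j z) (hij : rate α k i j = 0) (x x' : ℝ) :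
    pairing α (w x) (z x) = pairing α (w x') (z x') := by
  simpa [hij] using pairing_mul_exp_const hα hw hz x x'

lemma pairing_eq_of_tendsto (hα : α ^ 2 = 1) (hw : IsSpatialSol α p q (starRingEnd ℂ k) i w)
    (hz : IsSpatialSol α p q k j z) (hij : rate α k i j = 0) {l : Filter ℝ} [l.NeBot] {c : ℂ}
    (hc : Tendsto (fun x => pairing α (w x) (z x)) l (𝓝 c)) (x : ℝ) :
    pairing α (w x) (z x) = c := by
  refine tendsto_nhds_unique (Tendsto.congr (fun x' => ?_) tendsto_const_nhds) hc
  exact pairing_const hα hw hz hij x x'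

/-- The product of the pairing with the exponential is constant. At an end where the exponential
stays bounded and the pairing tends to zero, that constant must be zero. -/
lemma pairing_eq_zero (hα : α ^ 2 = 1) (hw : IsSpatialSol α p q (starRingEnd ℂ k) i w)
    (hz : IsSpatialSol α p q k j z) {l : Filter ℝ} [l.NeBot]
    (hl : ∀ᶠ x : ℝ in l, (rate α k i j * x).re ≤ 0)
    (hc : Tendsto (fun x => pairing α (w x) (z x)) l (𝓝 0)) (x : ℝ) :
    pairing α (w x) (z x) = 0 := by
  have h0 : Tendsto (fun x : ℝ => Complex.exp (rate α k i j * x) * pairing α (w x) (z x)) l (𝓝 0) := by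
    refine squeeze_zero_norm' ?_ (by simpa using hc.norm)
    filter_upwards [hl] with x hx
    rw [norm_mul, Complex.norm_exp]
    exact mul_le_of_le_one_left (norm_nonneg _) (Real.exp_le_one_iff.2 hx)
  have := tendsto_nhds_unique (Tendsto.congr (fun x' => pairing_mul_exp_const hα hw hz x x')
    tendsto_const_nhds) h0
  simpa using this

/-- This is the Abel–Liouville formula: `Q` has zero trace, and the trace of `Λ` cancels against the
normalisations of the three columns. -/
lemma det3_eq_of_tendsto {u v w : ℝ → Fin 3 → ℂ} (hu : IsSpatialSol α p q k 0 u)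
    (hv : IsSpatialSol α p q k 1 v) (hw : IsSpatialSol α p q k 2 w) {l : Filter ℝ} [l.NeBot] {c : ℂ}
    (hc : Tendsto (fun x => det3 (u x) (v x) (w x)) l (𝓝 c)) (x : ℝ) :
    det3 (u x) (v x) (w x) = c := by
  have hd : ∀ x : ℝ, HasDerivAt (fun x : ℝ => det3 (u x) (v x) (w x)) 0 x := by
    intro x
    have h := (((hu x 0).mul (((hv x 1).mul (hw x 2)).sub ((hv x 2).mul (hw x 1)))).sub
      ((hv x 0).mul (((hu x 1).mul (hw x 2)).sub ((hu x 2).mul (hw x 1))))).add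
      ((hw x 0).mul (((hu x 1).mul (hv x 2)).sub ((hu x 2).mul (hv x 1))))
    refine h.congr_deriv ?_
    simp only [pot, potential_mulVec_zero, potential_mulVec_one, potential_mulVec_two, rate,
      Pi.sub_apply, Pi.mul_apply]
    simp [lam]
    ring
  refine tendsto_nhds_unique (Tendsto.congr (fun x' => ?_) tendsto_const_nhds) hc
  exact is_const_of_deriv_eq_zero (fun x => (hd x).differentiableAt) (fun x => (hd x).deriv) x x'

end General

lemma tendsto_mul_zero_of_bounded {l : Filter ℝ} {f g : ℝ → ℂ} {C : ℝ} (hf : Tendsto f l (𝓝 0))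
    (hg : ∀ x, ‖g x‖ ≤ C) : Tendsto (fun x => f x * g x) l (𝓝 0) :=
  hf.zero_mul_isBoundedUnder_le ⟨C, eventually_map.2 (Eventually.of_forall hg)⟩

/-! ### Pairings and Wronskians of the Jost columns -/

section Table

variable {K α : ℝ} {p q : ℝ → ℝ} {k : ℂ} {i j : Fin 3}

lemma rate_eq_zero_of_ne (hi : i ≠ 0) (hj : j ≠ 0) : rate α k i j = 0 := by
  fin_cases i <;> fin_cases j <;> simp_all [rate, lam]

lemma good_neg_of_ne_zero (hj : j ≠ 0) (hk : 0 ≤ α * k.im) : Good α (-k) j :=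
  good_of_ne_zero hj (by simpa using hk)

lemma good_conj_of_ne_zero (hj : j ≠ 0) (hk : 0 ≤ α * k.im) : Good α (starRingEnd ℂ k) j :=
  good_of_ne_zero hj (by simpa using hk)

lemma good_neg_conj_zero (hk : 0 ≤ α * k.im) : Good α (-starRingEnd ℂ k) 0 :=
  good_zero (by simpa using hk)

lemma isSpatialSol_leftCol (h : Admissible K p q) (hα : α ^ 2 = 1) (hk : Good α k j) :
    IsSpatialSol α p q k j (leftCol α p q k j) := hasDerivAt_leftCol h hα hk

lemma isSpatialSol_rightCol (h : Admissible K p q) (hα : α ^ 2 = 1) (hk : Good α (-k) j) :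
    IsSpatialSol α p q k j (rightCol α p q k j) := hasDerivAt_rightCol h hα hk

lemma norm_leftCol_apply_le (h : Admissible K p q) (hα : α ^ 2 = 1) (hk : Good α k j) (x : ℝ)
    (a : Fin 3) : ‖leftCol α p q k j x a‖ ≤ jostBound K :=
  (norm_le_pi_norm _ a).trans (norm_leftCol_le h hα hk x)

lemma norm_rightCol_apply_le (h : Admissible K p q) (hα : α ^ 2 = 1) (hk : Good α (-k) j) (x : ℝ)
    (a : Fin 3) : ‖rightCol α p q k j x a‖ ≤ jostBound K :=
  (norm_le_pi_norm _ a).trans (norm_rightCol_le h hα hk x)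

lemma tendsto_conj {l : Filter ℝ} {f : ℝ → ℂ} {c : ℂ} (h : Tendsto f l (𝓝 c)) :
    Tendsto (fun x => starRingEnd ℂ (f x)) l (𝓝 (starRingEnd ℂ c)) :=
  (Complex.continuous_conj.tendsto c).comp h

lemma tendsto_pairing {l : Filter ℝ} {w z : ℝ → Fin 3 → ℂ} {A B : Fin 3 → ℂ}
    (hw : ∀ a, Tendsto (fun x => w x a) l (𝓝 (A a)))
    (hz : ∀ a, Tendsto (fun x => z x a) l (𝓝 (B a))) :
    Tendsto (fun x => pairing α (w x) (z x)) l (𝓝 (pairing α A B)) :=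
  ((((tendsto_conj (hw 0)).mul (hz 0)).const_mul _).add ((tendsto_conj (hw 1)).mul (hz 1))).add
    ((tendsto_conj (hw 2)).mul (hz 2))

lemma tendsto_det3 {l : Filter ℝ} {u v w : ℝ → Fin 3 → ℂ} {A B C : Fin 3 → ℂ}
    (hu : ∀ a, Tendsto (fun x => u x a) l (𝓝 (A a)))
    (hv : ∀ a, Tendsto (fun x => v x a) l (𝓝 (B a)))
    (hw : ∀ a, Tendsto (fun x => w x a) l (𝓝 (C a))) :
    Tendsto (fun x => det3 (u x) (v x) (w x)) l (𝓝 (det3 A B C)) :=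
  (((hu 0).mul (((hv 1).mul (hw 2)).sub ((hv 2).mul (hw 1)))).sub
    ((hv 0).mul (((hu 1).mul (hw 2)).sub ((hu 2).mul (hw 1))))).add
    ((hw 0).mul (((hu 1).mul (hv 2)).sub ((hu 2).mul (hv 1))))

/-- Evaluate at `+∞`: the column of `J₂` tends to the first basis vector, so only the first
components survive, the others being bounded for the column of `J₁`. -/
lemma pairing_right_left_zero (h : Admissible K p q) (hα : α ^ 2 = 1) (hk : 0 ≤ α * k.im) (x : ℝ) :
    pairing α (rightCol α p q (starRingEnd ℂ k) 0 x) (leftCol α p q k 0 x) =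
      -α * leftLimit α p q k 0 0 := by
  have hg := good_neg_conj_zero hk
  have hR := tendsto_rightCol_atTop h hα hg
  refine pairing_eq_of_tendsto hα (isSpatialSol_rightCol h hα hg)
    (isSpatialSol_leftCol h hα (good_zero hk)) (rate_self _ _ _) (l := atTop) ?_ x
  have h0 := ((tendsto_conj (hR 0)).mul
    (tendsto_leftCol_atTop h hα (good_zero hk) (rate_self α k 0))).const_mul (-α : ℂ)
  have h1 : ∀ a ≠ 0, Tendsto (fun x => starRingEnd ℂ (rightCol α p q (starRingEnd ℂ k) 0 x a) *
      leftCol α p q k 0 x a) atTop (𝓝 0) := fun a ha => by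
    refine tendsto_mul_zero_of_bounded ?_ (fun x => norm_leftCol_apply_le h hα (good_zero hk) x a)
    have := tendsto_conj (hR a)
    rwa [basisVec, Matrix.one_apply_ne ha, map_zero] at this
  have := (h0.add (h1 1 (by decide))).add (h1 2 (by decide))
  unfold pairing
  simpa [basisVec] using this

lemma pairing_basisVec (α : ℝ) (i j : Fin 3) :
    pairing α (basisVec i) (basisVec j) = if i = j then (if i = 0 then (-α : ℂ) else 1) else 0 := by
  fin_cases i <;> fin_cases j <;> simp [pairing, basisVec, Matrix.one_apply]

lemma pairing_right_right (h : Admissible K p q) (hα : α ^ 2 = 1) (hk : 0 ≤ α * k.im) (hj : j ≠ 0)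
    (x : ℝ) :
    pairing α (rightCol α p q (starRingEnd ℂ k) 0 x) (rightCol α p q k j x) = 0 := by
  have hg := good_neg_conj_zero hk
  have hg' := good_neg_of_ne_zero hj hk
  refine pairing_eq_zero hα (isSpatialSol_rightCol h hα hg) (isSpatialSol_rightCol h hα hg')
    (l := atTop) ?_ ?_ x
  · filter_upwards [eventually_ge_atTop 0] with x hx
    rw [Complex.re_mul_ofReal]
    exact mul_nonpos_of_nonpos_of_nonneg (good_zero hk j) hx
  · have := tendsto_pairing (α := α) (tendsto_rightCol_atTop h hα hg) (tendsto_rightCol_atTop h hα hg')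
    rwa [pairing_basisVec, if_neg (Ne.symm hj)] at this

lemma pairing_left_left (h : Admissible K p q) (hα : α ^ 2 = 1) (hk : 0 ≤ α * k.im) (hi : i ≠ 0)
    (x : ℝ) :
    pairing α (leftCol α p q (starRingEnd ℂ k) i x) (leftCol α p q k 0 x) = 0 := by
  have hg := good_conj_of_ne_zero hi hk
  have hg' := good_zero hk
  refine pairing_eq_zero hα (isSpatialSol_leftCol h hα hg) (isSpatialSol_leftCol h hα hg')
    (l := atBot) ?_ ?_ x
  · filter_upwards [eventually_le_atBot 0] with x hx
    rw [Complex.re_mul_ofReal]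
    have := good_neg_of_ne_zero hi hk 0
    rw [rate_neg, Complex.neg_re] at this
    exact mul_nonpos_of_nonneg_of_nonpos (by linarith) hx
  · have := tendsto_pairing (α := α) (tendsto_leftCol_atBot h hα hg) (tendsto_leftCol_atBot h hα hg')
    rwa [pairing_basisVec, if_neg hi] at this

/-- At `+∞` the column of `J₂` picks out one component of the column of `J₁`. Its exponent vanishes
because both indices lie in the lower block, so that component has a limit. -/
lemma pairing_left_right (h : Admissible K p q) (hα : α ^ 2 = 1) (hk : 0 ≤ α * k.im) (hi : i ≠ 0)
    (hj : j ≠ 0) (x : ℝ) :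
    pairing α (leftCol α p q (starRingEnd ℂ k) i x) (rightCol α p q k j x) =
      starRingEnd ℂ (leftLimit α p q (starRingEnd ℂ k) j i) := by
  have hg := good_conj_of_ne_zero hi hk
  have hg' := good_neg_of_ne_zero hj hk
  refine pairing_eq_of_tendsto hα (isSpatialSol_leftCol h hα hg) (isSpatialSol_rightCol h hα hg')
    (rate_eq_zero_of_ne hi hj) (l := atTop) ?_ x
  have hR := tendsto_rightCol_atTop h hα hg'
  have hL := tendsto_conj (tendsto_leftCol_atTop h hα hg (rate_eq_zero_of_ne (α := α)
    (k := starRingEnd ℂ k) hi hj))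
  have hb : ∀ a ≠ j, Tendsto (fun x => starRingEnd ℂ (leftCol α p q (starRingEnd ℂ k) i x a) *
      rightCol α p q k j x a) atTop (𝓝 0) := fun a ha => by
    simp only [mul_comm (starRingEnd ℂ _)]
    refine tendsto_mul_zero_of_bounded (C := jostBound K) ?_ (fun x => ?_)
    · have := hR a
      rwa [basisVec, Matrix.one_apply_ne ha] at this
    · rw [RCLike.norm_conj]
      exact norm_leftCol_apply_le h hα hg x a
  have hjj := hL.mul (hR j)
  rw [basisVec, Matrix.one_apply_eq, mul_one] at hjj
  unfold pairing
  fin_cases j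
  · exact absurd rfl hj
  · simpa using (((hb 0 (by decide)).const_mul (-α : ℂ)).add hjj).add (hb 2 (by decide))
  · simpa using (((hb 0 (by decide)).const_mul (-α : ℂ)).add (hb 1 (by decide))).add hjj

/-- At `+∞` the last two columns become basis vectors, and the determinant reduces to the top entry
of the first. This exhibits `s₁₁` as a Wronskian: its zeros are the points of linear dependence, and
it is the determinant of `M` before division. -/
lemma det3_left_right_right (h : Admissible K p q) (hα : α ^ 2 = 1) (hk : 0 ≤ α * k.im) (x : ℝ) :
    det3 (leftCol α p q k 0 x) (rightCol α p q k 1 x) (rightCol α p q k 2 x) =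
      leftLimit α p q k 0 0 := by
  have h1 := good_neg_of_ne_zero (α := α) (k := k) (show (1 : Fin 3) ≠ 0 by decide) hk
  have h2 := good_neg_of_ne_zero (α := α) (k := k) (show (2 : Fin 3) ≠ 0 by decide) hk
  refine det3_eq_of_tendsto (isSpatialSol_leftCol h hα (good_zero hk))
    (isSpatialSol_rightCol h hα h1) (isSpatialSol_rightCol h hα h2) (l := atTop) ?_ x
  have hR1 := tendsto_rightCol_atTop h hα h1
  have hR2 := tendsto_rightCol_atTop h hα h2
  have hL := tendsto_leftCol_atTop h hα (good_zero hk) (rate_self α k 0)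
  have c0 := ((hR1 1).mul (hR2 2)).sub ((hR1 2).mul (hR2 1))
  have c1 := ((hR1 2).mul (hR2 0)).sub ((hR1 0).mul (hR2 2))
  have c2 := ((hR1 0).mul (hR2 1)).sub ((hR1 1).mul (hR2 0))
  simp [basisVec] at c0 c1 c2
  have := ((hL.mul c0).add (tendsto_mul_zero_of_bounded c1
    (fun x => norm_leftCol_apply_le h hα (good_zero hk) x 1))).add (tendsto_mul_zero_of_bounded c2
    (fun x => norm_leftCol_apply_le h hα (good_zero hk) x 2))
  simp only [mul_one, add_zero] at this
  refine this.congr fun x => ?_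
  unfold det3
  ring

/-- The determinant of the lower right block of the limits of `J₁` at `+∞`. -/
def blockDet (α : ℝ) (p q : ℝ → ℝ) (k : ℂ) : ℂ :=
  leftLimit α p q k 1 1 * leftLimit α p q k 2 2 - leftLimit α p q k 1 2 * leftLimit α p q k 2 1

/-- Two conserved quantities meet in the limit `r` at `-∞` of the top entry of the first column of
`J₂` at `conj k`. The Wronskian of this column with the last two of `J₁` equals `blockDet` at `+∞`
and `r` at `-∞`. Its pairing with the first column of `J₁` at `k` equals `-α s₁₁(k)` at `+∞` and `-α
conj r` at `-∞`. -/
lemma blockDet_conj (h : Admissible K p q) (hα : α ^ 2 = 1) (hk : 0 ≤ α * k.im) :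
    starRingEnd ℂ (blockDet α p q (starRingEnd ℂ k)) = leftLimit α p q k 0 0 := by
  set kb := starRingEnd ℂ k with hkb
  have g0 := good_neg_conj_zero hk
  have g1 := good_conj_of_ne_zero (α := α) (k := k) (show (1 : Fin 3) ≠ 0 by decide) hk
  have g2 := good_conj_of_ne_zero (α := α) (k := k) (show (2 : Fin 3) ≠ 0 by decide) hk
  have hR := tendsto_rightCol_atTop h hα g0
  obtain ⟨r, hr⟩ := exists_tendsto_rightCol_atBot h hα g0
  have hdet := fun (l : Filter ℝ) (hl : l.NeBot) (c : ℂ) => det3_eq_of_tendsto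
    (isSpatialSol_rightCol h hα g0) (isSpatialSol_leftCol h hα g1) (isSpatialSol_leftCol h hα g2)
    (l := l) (c := c)
  have hD : ∀ x, det3 (rightCol α p q kb 0 x) (leftCol α p q kb 1 x) (leftCol α p q kb 2 x) =
      blockDet α p q kb := by
    refine hdet atTop inferInstance _ ?_
    have L11 := tendsto_leftCol_atTop h hα g1 (i := 1) (rate_eq_zero_of_ne (by decide) (by decide))
    have L21 := tendsto_leftCol_atTop h hα g1 (i := 2) (rate_eq_zero_of_ne (by decide) (by decide))
    have L12 := tendsto_leftCol_atTop h hα g2 (i := 1) (rate_eq_zero_of_ne (by decide) (by decide))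
    have L22 := tendsto_leftCol_atTop h hα g2 (i := 2) (rate_eq_zero_of_ne (by decide) (by decide))
    have R1 := hR 1
    have R2 := hR 2
    have R0 := hR 0
    simp [basisVec] at R0 R1 R2
    have c0 := R0.mul ((L11.mul L22).sub (L21.mul L12))
    have c1 := tendsto_mul_zero_of_bounded (by simpa using (R2.mul L12).sub (R1.mul L22))
      (fun x => norm_leftCol_apply_le h hα g1 x 0)
    have c2 := tendsto_mul_zero_of_bounded (by simpa using (R1.mul L21).sub (R2.mul L11))
      (fun x => norm_leftCol_apply_le h hα g2 x 0)
    have := (c0.add c1).add c2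
    simp only [one_mul, add_zero] at this
    unfold blockDet
    rw [mul_comm (leftLimit α p q kb 1 2)]
    refine this.congr fun x => ?_
    unfold det3
    ring
  have L1 := tendsto_leftCol_atBot h hα g1
  have L2 := tendsto_leftCol_atBot h hα g2
  have b0 := fun x a => norm_rightCol_apply_le h hα g0 x a
  have hD' : ∀ x, det3 (rightCol α p q kb 0 x) (leftCol α p q kb 1 x) (leftCol α p q kb 2 x) = r := by
    refine hdet atBot inferInstance _ ?_
    have c0 := ((L1 1).mul (L2 2)).sub ((L1 2).mul (L2 1))
    have c1 := ((L1 2).mul (L2 0)).sub ((L1 0).mul (L2 2))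
    have c2 := ((L1 0).mul (L2 1)).sub ((L1 1).mul (L2 0))
    simp [basisVec] at c0 c1 c2
    have := ((hr.mul c0).add (tendsto_mul_zero_of_bounded c1 (fun x => b0 x 1))).add
      (tendsto_mul_zero_of_bounded c2 (fun x => b0 x 2))
    simp only [mul_one, add_zero] at this
    refine this.congr fun x => ?_
    unfold det3
    ring
  have hrD : r = blockDet α p q kb := (hD' 0).symm.trans (hD 0)
  have hL0 := tendsto_leftCol_atBot h hα (good_zero hk)
  have hp : pairing α (rightCol α p q kb 0 0) (leftCol α p q k 0 0) = -α * starRingEnd ℂ r := by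
    refine pairing_eq_of_tendsto hα (isSpatialSol_rightCol h hα g0)
      (isSpatialSol_leftCol h hα (good_zero hk)) (rate_self _ _ _) (l := atBot) ?_ 0
    have c0 := ((tendsto_conj hr).mul (hL0 0)).const_mul (-α : ℂ)
    have h1 : ∀ a ≠ 0, Tendsto (fun x => starRingEnd ℂ (rightCol α p q kb 0 x a) *
        leftCol α p q k 0 x a) atBot (𝓝 0) := fun a ha => by
      simp only [mul_comm (starRingEnd ℂ _)]
      refine tendsto_mul_zero_of_bounded (C := jostBound K) ?_ (fun x => ?_)
      · have := hL0 a
        rwa [basisVec, Matrix.one_apply_ne ha] at this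
      · rw [RCLike.norm_conj]
        exact b0 x a
    have := (c0.add (h1 1 (by decide))).add (h1 2 (by decide))
    unfold pairing
    simpa [basisVec, hkb] using this
  rw [pairing_right_left_zero h hα hk] at hp
  have hα0 : (-α : ℂ) ≠ 0 := by
    intro h0
    have : α = 0 := by simpa using h0
    simp [this] at hα
  rw [← hrD]
  exact (mul_left_cancel₀ hα0 hp).symm

/-- For `α = 1` the form `-|y₀|² + |y₁|² + |y₂|²` of the first Jost column is nonincreasing in `x`
and starts at `-1`. Hence `|y₀| ≥ 1` everywhere, which excludes a zero limit at `+∞`. The argument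
includes real `k`. -/
lemma leftLimit_ne_zero_of_defocusing (h : Admissible K p q) (hk : 0 ≤ k.im) :
    leftLimit 1 p q k 0 0 ≠ 0 := by
  intro h0
  have hα : (1 : ℝ) ^ 2 = 1 := one_pow 2
  have hk1 : 0 ≤ (1 : ℝ) * k.im := by simpa using hk
  have hg := good_zero hk1
  set y := leftCol 1 p q k 0 with hy
  have hd := fun x => hasDerivAt_pairing hα (isSpatialSol_leftCol h hα hg)
    (isSpatialSol_leftCol h hα hg) x
  set g : ℝ → ℝ := fun x => (pairing 1 (y x) (y x)).re with hgdef
  have hgd : ∀ x, HasDerivAt g (-4 * k.im * (Complex.normSq (y x 1) + Complex.normSq (y x 2))) x := by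
    intro x
    have := Complex.reCLM.hasFDerivAt.comp_hasDerivAt x (hd x)
    refine this.congr_deriv ?_
    simp only [rate, lam, map_mul, map_sub, Complex.conj_I, ← Complex.normSq_eq_conj_mul_self]
    simp
    ring
  have hanti : Antitone g := antitone_of_hasDerivAt_nonpos hgd fun x => by
    have := Complex.normSq_nonneg (y x 1)
    have := Complex.normSq_nonneg (y x 2)
    have : 0 ≤ k.im * (Complex.normSq (y x 1) + Complex.normSq (y x 2)) := by positivity
    simp only [Pi.zero_apply]
    linarith
  have hbot : Tendsto g atBot (𝓝 (-1)) := by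
    have h1 := tendsto_leftCol_atBot h hα hg
    have h2 := (Complex.continuous_re.tendsto _).comp (tendsto_pairing (α := 1) h1 h1)
    simp [pairing_basisVec] at h2
    exact h2
  have hle : ∀ x, g x ≤ -1 := fun x => hanti.ge_of_tendsto hbot x
  have htop := tendsto_leftCol_atTop h hα hg (rate_self 1 k 0)
  rw [h0] at htop
  have htop2 : Tendsto (fun x => Complex.normSq (y x 0)) atTop (𝓝 0) := by
    have := (Complex.continuous_normSq.tendsto _).comp htop
    rwa [map_zero] at this
  have h1 : ∀ x, 1 ≤ Complex.normSq (y x 0) := by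
    intro x
    have h2 := hle x
    have h3 : g x = -Complex.normSq (y x 0) + Complex.normSq (y x 1) + Complex.normSq (y x 2) := by
      simp only [hgdef, pairing, ← Complex.normSq_eq_conj_mul_self]
      simp
    have := Complex.normSq_nonneg (y x 1)
    have := Complex.normSq_nonneg (y x 2)
    linarith
  have := ge_of_tendsto' htop2 h1
  linarith

end Table

end CMKdV
end

noncomputable section
namespace CMKdV

/-! ### The scattering matrix -/

lemma ne_zero_of_sq_eq_one {α : ℝ} (hα : α ^ 2 = 1) : α ≠ 0 := by
  rintro rfl
  simp at hα

lemma pairing_conj (α : ℝ) (w z : Fin 3 → ℂ) :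
    starRingEnd ℂ (pairing α w z) = pairing α z w := by
  simp only [pairing, map_add, map_mul, map_neg, Complex.conj_conj, Complex.conj_ofReal]
  ring

lemma pairing_combination (α : ℝ) (w z₀ z₁ z₂ : Fin 3 → ℂ) (c₀ c₁ c₂ : ℂ) {z : Fin 3 → ℂ}
    (hz : ∀ a, z a = z₀ a * c₀ + z₁ a * c₁ + z₂ a * c₂) :
    pairing α w z = pairing α w z₀ * c₀ + pairing α w z₁ * c₁ + pairing α w z₂ * c₂ := by
  simp only [pairing, hz]
  ring

section Real

variable {K α : ℝ} {p q : ℝ → ℝ} {k : ℂ} {i j : Fin 3}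

lemma good_of_im_eq_zero (hk : k.im = 0) (j : Fin 3) : Good α k j := by
  by_cases hj : j = 0
  · rw [hj]; exact good_zero (by simp [hk])
  · exact good_of_ne_zero hj (by simp [hk])

lemma good_neg_of_im_eq_zero (hk : k.im = 0) (j : Fin 3) : Good α (-k) j :=
  good_of_im_eq_zero (by simp [hk]) j

lemma conj_eq_of_im_eq_zero (hk : k.im = 0) : starRingEnd ℂ k = k := Complex.conj_eq_iff_im.2 hk

lemma pairing_right_right_real (h : Admissible K p q) (hα : α ^ 2 = 1) (hk : k.im = 0)
    (i j : Fin 3) (x : ℝ) :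
    pairing α (rightCol α p q k i x) (rightCol α p q k j x) =
      if i = j then (if i = 0 then (-α : ℂ) else 1) else 0 := by
  have gi := good_neg_of_im_eq_zero (α := α) hk i
  have gj := good_neg_of_im_eq_zero (α := α) hk j
  have hw := isSpatialSol_rightCol h hα gi
  have hlim := tendsto_pairing (α := α) (tendsto_rightCol_atTop h hα gi)
    (tendsto_rightCol_atTop h hα gj)
  rw [pairing_basisVec] at hlim
  nth_rewrite 1 [← conj_eq_of_im_eq_zero hk] at hw
  by_cases hij : i = j
  · subst hij
    exact pairing_eq_of_tendsto hα hw (isSpatialSol_rightCol h hα gj) (rate_self _ _ _) hlim x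
  · rw [if_neg hij] at hlim ⊢
    refine pairing_eq_zero hα hw (isSpatialSol_rightCol h hα gj) (l := atTop) ?_ hlim x
    -- For real `k` both `k` and `-k` are admissible, so the real part of the exponent is at most
    -- zero and at least zero.
    refine Eventually.of_forall fun x => le_of_eq ?_
    have h1 := good_of_im_eq_zero (α := α) hk i j
    have h2 := gi j
    rw [rate_neg, Complex.neg_re] at h2
    rw [Complex.re_mul_ofReal, le_antisymm h1 (by linarith), zero_mul]

lemma det_eq_det3 (M : Matrix (Fin 3) (Fin 3) ℂ) :
    M.det = det3 (fun a => M a 0) (fun a => M a 1) (fun a => M a 2) := by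
  rw [Matrix.det_fin_three, det3]
  ring

lemma det_jostRight (h : Admissible K p q) (hα : α ^ 2 = 1) (hk : k.im = 0) (x : ℝ) :
    (jostRight α p q x k).det = 1 := by
  have g := good_neg_of_im_eq_zero (α := α) hk
  have hlim := tendsto_det3 (tendsto_rightCol_atTop h hα (g 0)) (tendsto_rightCol_atTop h hα (g 1))
    (tendsto_rightCol_atTop h hα (g 2))
  have := det3_eq_of_tendsto (isSpatialSol_rightCol h hα (g 0)) (isSpatialSol_rightCol h hα (g 1))
    (isSpatialSol_rightCol h hα (g 2)) hlim x
  rw [det_eq_det3]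
  refine this.trans ?_
  simp [det3, basisVec]

lemma det_jostLeft (h : Admissible K p q) (hα : α ^ 2 = 1) (hk : k.im = 0) (x : ℝ) :
    (jostLeft α p q x k).det = 1 := by
  have g := good_of_im_eq_zero (α := α) hk
  have hlim := tendsto_det3 (tendsto_leftCol_atBot h hα (g 0)) (tendsto_leftCol_atBot h hα (g 1))
    (tendsto_leftCol_atBot h hα (g 2))
  have := det3_eq_of_tendsto (isSpatialSol_leftCol h hα (g 0)) (isSpatialSol_leftCol h hα (g 1))
    (isSpatialSol_leftCol h hα (g 2)) hlim x
  rw [det_eq_det3]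
  refine this.trans ?_
  simp [det3, basisVec]

lemma scattering_of_im_eq_zero (hk : k.im = 0) :
    scattering α p q k = (jostRight α p q 0 k)⁻¹ * jostLeft α p q 0 k := if_pos hk

lemma jostLeft_zero_eq (h : Admissible K p q) (hα : α ^ 2 = 1) (hk : k.im = 0) :
    jostLeft α p q 0 k = jostRight α p q 0 k * scattering α p q k := by
  rw [scattering_of_im_eq_zero hk, ← Matrix.mul_assoc, Matrix.mul_nonsing_inv _ (by
    rw [det_jostRight h hα hk]; exact isUnit_one), Matrix.one_mul]

lemma det_scattering (h : Admissible K p q) (hα : α ^ 2 = 1) (hk : k.im = 0) :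
    (scattering α p q k).det = 1 := by
  have := congrArg Matrix.det (jostLeft_zero_eq h hα hk)
  rw [Matrix.det_mul, det_jostLeft h hα hk, det_jostRight h hα hk, one_mul] at this
  exact this.symm

lemma leftCol_zero_eq (h : Admissible K p q) (hα : α ^ 2 = 1) (hk : k.im = 0) (j a : Fin 3) :
    leftCol α p q k j 0 a = rightCol α p q k 0 0 a * scattering α p q k 0 j +
      rightCol α p q k 1 0 a * scattering α p q k 1 j +
      rightCol α p q k 2 0 a * scattering α p q k 2 j := by
  have := congrFun (congrFun (jostLeft_zero_eq h hα hk) a) j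
  rw [Matrix.mul_apply, Fin.sum_univ_three] at this
  exact this

lemma pairing_right_left_real (h : Admissible K p q) (hα : α ^ 2 = 1) (hk : k.im = 0)
    (i j : Fin 3) :
    pairing α (rightCol α p q k i 0) (leftCol α p q k j 0) =
      (if i = 0 then (-α : ℂ) else 1) * scattering α p q k i j := by
  rw [pairing_combination α _ _ _ _ _ _ _ (leftCol_zero_eq h hα hk j)]
  simp only [pairing_right_right_real h hα hk]
  fin_cases i <;> simp

lemma scattering_of_im_ne_zero (hk : k.im ≠ 0) (i j : Fin 3) :
    scattering α p q k i j = leftLimit α p q k i j := by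
  rw [scattering, if_neg hk]
  rfl

/-- This glues the two branches in the definition of `scattering`. On the real axis the entry is
read off by pairing with a column of `J₂` at `x = 0`, while the same conserved pairing is known from
its limit at `+∞`. -/
lemma scattering_zero_zero (h : Admissible K p q) (hα : α ^ 2 = 1) (hk : 0 ≤ α * k.im) :
    scattering α p q k 0 0 = leftLimit α p q k 0 0 := by
  by_cases h0 : k.im = 0
  · have h1 := pairing_right_left_real h hα h0 0 0
    have h2 := pairing_right_left_zero h hα hk 0
    rw [conj_eq_of_im_eq_zero h0, h1, if_pos rfl] at h2
    exact mul_left_cancel₀ (by simpa using ne_zero_of_sq_eq_one hα) h2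
  · exact scattering_of_im_ne_zero h0 0 0

lemma scattering_block (h : Admissible K p q) (hα : α ^ 2 = 1) (hi : i ≠ 0) (hj : j ≠ 0) :
    scattering α p q k i j = leftLimit α p q k i j := by
  by_cases h0 : k.im = 0
  · have h1 := pairing_right_left_real h hα h0 i j
    have h2 := pairing_left_right h hα (by simp [h0]) hj hi 0 (k := k)
    rw [conj_eq_of_im_eq_zero h0, ← pairing_conj, h1, if_neg hi, one_mul] at h2
    exact (starRingEnd ℂ).injective h2
  · exact scattering_of_im_ne_zero h0 i j

lemma bigDelta_scattering (h : Admissible K p q) (hα : α ^ 2 = 1) :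
    bigDelta (scattering α p q k) = blockDet α p q k := by
  have n1 : (1 : Fin 3) ≠ 0 := by decide
  have n2 : (2 : Fin 3) ≠ 0 := by decide
  simp only [bigDelta, blockDet, scattering_block h hα n1 n1, scattering_block h hα n1 n2,
    scattering_block h hα n2 n1, scattering_block h hα n2 n2]

lemma bigDelta_scattering_conj (h : Admissible K p q) (hα : α ^ 2 = 1) (hk : 0 ≤ α * k.im) :
    bigDelta (scattering α p q (starRingEnd ℂ k)) = starRingEnd ℂ (scattering α p q k 0 0) := by
  rw [scattering_zero_zero h hα hk, ← blockDet_conj h hα hk, Complex.conj_conj,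
    bigDelta_scattering h hα]

end Real

/-! ### Regularity in the spectral parameter -/

section Regularity

variable {K α : ℝ} {p q : ℝ → ℝ} {j : Fin 3}

lemma leftCol_continuousOn (h : Admissible K p q) (hα : α ^ 2 = 1) (j : Fin 3) (x : ℝ) (a : Fin 3) :
    ContinuousOn (fun k => leftCol α p q k j x a) {k | Good α k j} :=
  sol_continuousOn (h.potBound hα) (fun a => (differentiable_rate α j a).continuous)
    (fun _ hk => hk) (norm_basisVec j) (fun _ hk => isVolterraSol_leftCol h hα hk) x a

lemma rightCol_continuousOn (h : Admissible K p q) (hα : α ^ 2 = 1) (j : Fin 3) (x : ℝ)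
    (a : Fin 3) : ContinuousOn (fun k => rightCol α p q k j x a) {k | Good α (-k) j} := by
  refine ((leftCol_continuousOn h.reflect hα j (-x) a).comp (t := {k | Good α k j})
    (f := fun k : ℂ => -k) continuous_neg.continuousOn (fun k hk => hk)).congr fun k hk => ?_
  exact congrFun (leftCol_reflect h hα hk x) a

lemma leftCol_differentiableOn (h : Admissible K p q) (hα : α ^ 2 = 1) {U : Set ℂ} (hU : IsOpen U)
    (hUk : ∀ k ∈ U, Good α k j) (x : ℝ) (a : Fin 3) :
    DifferentiableOn ℂ (fun k => leftCol α p q k j x a) U :=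
  sol_differentiableOn (h.potBound hα) hU (differentiable_rate α j) hUk (norm_basisVec j)
    (fun k hk => isVolterraSol_leftCol h hα (hUk k hk)) x a

lemma rightCol_differentiableOn (h : Admissible K p q) (hα : α ^ 2 = 1) {U : Set ℂ} (hU : IsOpen U)
    (hUk : ∀ k ∈ U, Good α (-k) j) (x : ℝ) (a : Fin 3) :
    DifferentiableOn ℂ (fun k => rightCol α p q k j x a) U := by
  have hneg : IsOpen (-U) := hU.neg
  refine ((leftCol_differentiableOn h.reflect hα (j := j) hneg (fun k hk => by
    simpa using hUk (-k) hk) (-x) a).comp (t := -U) (f := fun k : ℂ => -k)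
    differentiable_neg.differentiableOn (fun k hk => by simpa using hk)).congr fun k hk => ?_
  exact congrFun (leftCol_reflect h hα (hUk k hk) x) a

lemma isOpen_lt_mul_im (β : ℝ) : IsOpen {k : ℂ | 0 < β * k.im} :=
  isOpen_lt continuous_const (by fun_prop)

lemma leftLimit_holomorphicUpTo (h : Admissible K p q) (hα : α ^ 2 = 1) {β : ℝ}
    (hβ : ∀ k : ℂ, 0 ≤ β * k.im → Good α k j) (i : Fin 3) :
    HolomorphicUpTo β (fun k => leftLimit α p q k i j) := by
  refine ⟨continuousOn_const.add (integral_sol_continuousOn (h.potBound hα)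
    (fun a => (differentiable_rate α j a).continuous) (fun k hk => hβ k hk) (norm_basisVec j)
    (fun k hk => isVolterraSol_leftCol h hα (hβ k hk)) i), (differentiableOn_const _).add
    (integral_sol_differentiableOn (h.potBound hα) (isOpen_lt_mul_im β) (differentiable_rate α j)
    (fun k hk => hβ k (le_of_lt hk)) (norm_basisVec j)
    (fun k hk => isVolterraSol_leftCol h hα (hβ k (le_of_lt hk))) i)⟩

lemma HolomorphicUpTo.congr {β : ℝ} {f g : ℂ → ℂ} (hf : HolomorphicUpTo β f)
    (hfg : ∀ k : ℂ, 0 ≤ β * k.im → g k = f k) : HolomorphicUpTo β g :=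
  ⟨hf.1.congr fun k hk => hfg k hk, hf.2.congr fun k hk => hfg k (le_of_lt hk)⟩

lemma holomorphicUpTo_scattering_zero (h : Admissible K p q) (hα : α ^ 2 = 1) :
    HolomorphicUpTo α (fun k => scattering α p q k 0 0) :=
  (leftLimit_holomorphicUpTo h hα (fun _ hk => good_zero hk) 0).congr fun _ hk =>
    scattering_zero_zero h hα hk

lemma holomorphicUpTo_scattering_block (h : Admissible K p q) (hα : α ^ 2 = 1) {i j : Fin 3}
    (hi : i ≠ 0) (hj : j ≠ 0) : HolomorphicUpTo (-α) (fun k => scattering α p q k i j) :=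
  (leftLimit_holomorphicUpTo h hα (fun _ hk => good_of_ne_zero hj (by linarith)) i).congr fun _ _ =>
    scattering_block h hα hi hj

end Regularity

/-! ### Uniqueness for linear differential equations -/

lemma eq_zero_of_norm_deriv_le {E : Type*} [NormedAddCommGroup E] [NormedSpace ℝ E] {y y' : ℝ → E}
    {C : ℝ} {T : ℝ} (hd : ∀ x ∈ Ici (0 : ℝ), HasDerivWithinAt y (y' x) (Ici 0) x)
    (hb : ∀ x ∈ Icc (0 : ℝ) T, ‖y' x‖ ≤ C * ‖y x‖) (h0 : y 0 = 0) : ∀ x ∈ Icc (0 : ℝ) T, y x = 0 :=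
  eq_zero_of_abs_deriv_le_mul_abs_self_of_eq_zero_right
    (fun x hx => ((hd x hx.1).continuousWithinAt).mono Icc_subset_Ici_self)
    (fun x hx => (hd x hx.1).mono (Ici_subset_Ici.2 hx.1)) h0
    (fun x hx => hb x ⟨hx.1, hx.2.le⟩)

lemma eq_zero_of_norm_deriv_le_univ {E : Type*} [NormedAddCommGroup E] [NormedSpace ℝ E]
    {y y' : ℝ → E} {C : ℝ} (hd : ∀ x, HasDerivAt y (y' x) x)
    (hb : ∀ x, ‖y' x‖ ≤ C * ‖y x‖) (h0 : y 0 = 0) (x : ℝ) : y x = 0 := by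
  rcases le_total 0 x with hx | hx
  · exact eq_zero_of_norm_deriv_le (T := x) (fun x _ => (hd x).hasDerivWithinAt)
      (fun x _ => hb x) h0 x ⟨hx, le_rfl⟩
  · have := eq_zero_of_norm_deriv_le (y := fun x => y (-x)) (y' := fun x => -y' (-x)) (T := -x)
      (fun x _ => by
        have := (hd (-x)).scomp x (hasDerivAt_neg x)
        simpa [Function.comp_def] using this.hasDerivWithinAt)
      (fun x _ => by simpa using hb (-x)) (by simpa using h0) (-x) ⟨by linarith, le_rfl⟩
    simpa using this

/-! ### Norming constants -/

section Norming

variable {K α : ℝ} {p q : ℝ → ℝ} {k : ℂ}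

lemma IsSpatialSol.eq_zero (h : Admissible K p q) (hα : α ^ 2 = 1) {j : Fin 3} {y : ℝ → Fin 3 → ℂ}
    (hy : IsSpatialSol α p q k j y) (h0 : y 0 = 0) (x : ℝ) : y x = 0 := by
  refine eq_zero_of_norm_deriv_le_univ (C := ‖rate α k j‖ + 2 * K) (fun x => hasDerivAt_pi.2 (hy x))
    (fun x => ?_) h0 x
  have hK := h.nonneg
  refine (pi_norm_le_iff_of_nonneg (by positivity)).2 fun a => ?_
  refine (norm_add_le _ _).trans ?_
  rw [norm_mul, add_mul]
  have h1 := (h.potBound hα).bound x (y x)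
  have h2 : 2 * K / (1 + x ^ 2) ≤ 2 * K := div_le_self (by positivity) (by nlinarith [sq_nonneg x])
  gcongr
  · exact norm_le_pi_norm _ a
  · exact norm_le_pi_norm _ a
  · exact (norm_le_pi_norm _ a).trans (h1.trans (by gcongr))

lemma IsSpatialSol.combination {i j : Fin 3} (hij : ∀ a, rate α k i a = rate α k j a)
    {y z : ℝ → Fin 3 → ℂ} (hy : IsSpatialSol α p q k i y) (hz : IsSpatialSol α p q k j z) (c d : ℂ) :
    IsSpatialSol α p q k i (fun x a => c * y x a + d * z x a) := by
  intro x a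
  refine (((hy x a).const_mul c).add ((hz x a).const_mul d)).congr_deriv ?_
  change _ = rate α k i a * (c * y x a + d * z x a) + (pot α p q x).mulVec (c • y x + d • z x) a
  rw [Matrix.mulVec_add, Matrix.mulVec_smul, Matrix.mulVec_smul, ← hij]
  simp only [Pi.add_apply, Pi.smul_apply, smul_eq_mul]
  ring

lemma rate_one_eq_two (α : ℝ) (k : ℂ) (a : Fin 3) : rate α k 1 a = rate α k 2 a := by
  simp [rate, lam]

/-- At a zero of the Wronskian the three columns are dependent at `x = 0`. The coefficient of the
column of `J₁` cannot vanish: otherwise a combination of two columns of `J₂` would vanish at `0`,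
hence for all `x`, contradicting their independent limits at `+∞`. -/
lemma exists_left_eq_combination (h : Admissible K p q) (hα : α ^ 2 = 1) (hk : 0 ≤ α * k.im)
    (h0 : leftLimit α p q k 0 0 = 0) :
    ∃ c d : ℂ, ∀ a, leftCol α p q k 0 0 a = c * rightCol α p q k 1 0 a + d * rightCol α p q k 2 0 a := by
  have g1 := good_neg_of_ne_zero (α := α) (k := k) (show (1 : Fin 3) ≠ 0 by decide) hk
  have g2 := good_neg_of_ne_zero (α := α) (k := k) (show (2 : Fin 3) ≠ 0 by decide) hk
  have hdet := det3_left_right_right h hα hk 0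
  rw [h0] at hdet
  set M : Matrix (Fin 3) (Fin 3) ℂ := Matrix.of fun a j =>
    (![leftCol α p q k 0 0, rightCol α p q k 1 0, rightCol α p q k 2 0] j) a with hM
  have hMd : M.det = 0 := by
    rw [det_eq_det3]
    exact hdet
  obtain ⟨v, hv, hMv⟩ := Matrix.exists_mulVec_eq_zero_iff.2 hMd
  have hv' : ∀ a, leftCol α p q k 0 0 a * v 0 + rightCol α p q k 1 0 a * v 1 +
      rightCol α p q k 2 0 a * v 2 = 0 := by
    intro a
    have := congrFun hMv a
    rw [mulVec_apply_sum, Fin.sum_univ_three] at this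
    exact this
  by_cases hv0 : v 0 = 0
  · exfalso
    have hz := IsSpatialSol.combination (rate_one_eq_two α k) (isSpatialSol_rightCol h hα g1)
      (isSpatialSol_rightCol h hα g2) (v 1) (v 2)
    have hzero := hz.eq_zero h hα (by
      funext a
      have := hv' a
      rw [hv0] at this
      simp only [Pi.zero_apply]
      linear_combination this)
    have hlim := fun a => ((tendsto_rightCol_atTop h hα g1 a).const_mul (v 1)).add
      ((tendsto_rightCol_atTop h hα g2 a).const_mul (v 2))
    have hlim0 : ∀ a, v 1 * basisVec 1 a + v 2 * basisVec 2 a = 0 := fun a =>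
      tendsto_nhds_unique (hlim a) (tendsto_const_nhds.congr fun x => (congrFun (hzero x) a).symm)
    have e1 := hlim0 1
    have e2 := hlim0 2
    simp [basisVec] at e1 e2
    apply hv
    funext a
    fin_cases a
    · exact hv0
    · exact e1
    · exact e2
  · refine ⟨-v 1 / v 0, -v 2 / v 0, fun a => ?_⟩
    field_simp
    linear_combination hv' a

lemma exists_isNorming (h : Admissible K p q) (hα : α ^ 2 = 1) : ∃ c d, IsNorming α p q c d := by
  have key : ∀ κ, ∃ cd : ℂ × ℂ, κ ∈ simpleZeros α p q → ∀ a : Fin 3,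
      jostLeft α p q 0 κ a 0 = deriv (fun z => scattering α p q z 0 0) κ *
        (cd.1 * jostRight α p q 0 κ a 1 + cd.2 * jostRight α p q 0 κ a 2) := by
    intro κ
    by_cases hκ : κ ∈ simpleZeros α p q
    · have hk : 0 ≤ α * κ.im := le_of_lt hκ.1.1
      obtain ⟨c, d, hcd⟩ := exists_left_eq_combination h hα hk
        ((scattering_zero_zero h hα hk).symm.trans hκ.1.2)
      refine ⟨(c / deriv (fun z => scattering α p q z 0 0) κ,
        d / deriv (fun z => scattering α p q z 0 0) κ), fun _ a => ?_⟩
      have hne := hκ.2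
      refine (hcd a).trans ?_
      simp only
      field_simp
      rfl
    -- Away from the simple zeros the constants are unconstrained, and zero is an arbitrary choice.
    · exact ⟨0, fun h => absurd h hκ⟩
  choose cd hcd using key
  exact ⟨fun κ => (cd κ).1, fun κ => (cd κ).2, fun κ hκ => hcd κ hκ⟩

end Norming

end CMKdV
end

noncomputable section
namespace CMKdV

/-! ### Differentiation of the Jost columns with respect to time -/

lemma volterra_const_smul (μ : Fin 3 → ℂ) (c : ℂ) (g : ℝ → Fin 3 → ℂ) (x : ℝ) :
    volterra μ (fun s => c • g s) x = c • volterra μ g x := by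
  funext a
  simp only [volterra, Pi.smul_apply, smul_eq_mul, ← integral_const_mul]
  congr 1
  funext s
  ring

lemma potential_sub (α p q p' q' : ℝ) :
    potential α p q - potential α p' q' = potential α (p - p') (q - q') := by
  ext a b
  fin_cases a <;> fin_cases b <;> simp [potential, mul_sub]

lemma potential_smul (α p q c : ℝ) : (c : ℂ) • potential α p q = potential α (c * p) (c * q) := by
  ext a b
  fin_cases a <;> fin_cases b <;> simp [potential] <;> ring

lemma tendsto_potential {ι : Type*} {l : Filter ι} (α : ℝ) {f g : ι → ℝ} {p q : ℝ}
    (hf : Tendsto f l (𝓝 p)) (hg : Tendsto g l (𝓝 q)) (v : Fin 3 → ℂ) :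
    Tendsto (fun t => (potential α (f t) (g t)).mulVec v) l (𝓝 ((potential α p q).mulVec v)) := by
  have hf' := (Complex.continuous_ofReal.tendsto _).comp hf
  have hg' := (Complex.continuous_ofReal.tendsto _).comp hg
  simp only [Function.comp_def] at hf' hg'
  refine tendsto_pi_nhds.2 fun a => ?_
  fin_cases a
  · have := ((hf'.mul_const (v 1)).add (hg'.mul_const (v 2))).const_mul (α : ℂ)
    change Tendsto (fun t => (potential α (f t) (g t)).mulVec v 0) l
      (𝓝 ((potential α p q).mulVec v 0))
    simpa only [potential_mulVec_zero] using this
  · change Tendsto (fun t => (potential α (f t) (g t)).mulVec v 1) l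
      (𝓝 ((potential α p q).mulVec v 1))
    simpa only [potential_mulVec_one] using hf'.mul_const (v 0)
  · change Tendsto (fun t => (potential α (f t) (g t)).mulVec v 2) l
      (𝓝 ((potential α p q).mulVec v 2))
    simpa only [potential_mulVec_two] using hg'.mul_const (v 0)

/-- The families `p t`, `q t` of potentials are bounded on `[0, T]`, Lipschitz in `t` at `t₀`, and
differentiable there with derivatives `p'`, `q'`. -/
structure DifferentiableFamily (K T t₀ : ℝ) (p q : ℝ → ℝ → ℝ) (p' q' : ℝ → ℝ) : Prop where
  nonneg : 0 ≤ K
  mem : t₀ ∈ Ico 0 T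
  continuous : ∀ t ∈ Icc 0 T, Continuous (p t) ∧ Continuous (q t)
  bound : ∀ t ∈ Icc 0 T, ∀ x, |p t x| ≤ K / (1 + x ^ 2) ∧ |q t x| ≤ K / (1 + x ^ 2)
  lipschitz : ∀ t ∈ Icc 0 T, ∀ x, |p t x - p t₀ x| ≤ K / (1 + x ^ 2) * |t - t₀| ∧
    |q t x - q t₀ x| ≤ K / (1 + x ^ 2) * |t - t₀|
  hasDeriv : ∀ x, HasDerivWithinAt (fun t => p t x) (p' x) (Ici 0) t₀ ∧
    HasDerivWithinAt (fun t => q t x) (q' x) (Ici 0) t₀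
  continuous_deriv : Continuous p' ∧ Continuous q'
  bound_deriv : ∀ x, |p' x| ≤ K / (1 + x ^ 2) ∧ |q' x| ≤ K / (1 + x ^ 2)

/-- The function `z` solves the equation obtained by formal differentiation in `t`. The error `w`,
difference quotient minus `z`, satisfies the Volterra equation with the potential at time `t` and a
source `src`. By `norm_le_of_volterra` it is controlled by the integral of `‖src‖`, which tends to
zero by dominated convergence. -/
lemma DifferentiableFamily.hasDerivWithinAt_sol {α K T t₀ : ℝ} (hα : α ^ 2 = 1) {p q : ℝ → ℝ → ℝ}
    {p' q' : ℝ → ℝ} (h : DifferentiableFamily K T t₀ p q p' q') {μ e : Fin 3 → ℂ}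
    (hμ : ∀ a, (μ a).re ≤ 0) {y : ℝ → ℝ → Fin 3 → ℂ}
    (hy : ∀ t ∈ Icc 0 T, IsVolterraSol μ e (pot α (p t) (q t)) (y t)) {z : ℝ → Fin 3 → ℂ}
    (hzc : Continuous z) {C : ℝ} (hzC : ∀ x, ‖z x‖ ≤ C)
    (hz : ∀ x, z x = volterra μ (fun s => (pot α p' q' s).mulVec (y t₀ s) +
      (pot α (p t₀) (q t₀) s).mulVec (z s)) x) (x : ℝ) (a : Fin 3) :
    HasDerivWithinAt (fun t => y t x a) (z x a) (Ici 0) t₀ := by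
  have ht₀ : t₀ ∈ Icc 0 T := Ico_subset_Icc_self h.mem
  have hQ : ∀ t ∈ Icc 0 T, PotBound (2 * K) (pot α (p t) (q t)) := fun t ht =>
    potBound_of_abs_le hα h.nonneg (h.continuous t ht).1 (h.continuous t ht).2
      (fun x => (h.bound t ht x).1) (fun x => (h.bound t ht x).2)
  have hQ' : PotBound (2 * K) (pot α p' q') :=
    potBound_of_abs_le hα h.nonneg h.continuous_deriv.1 h.continuous_deriv.2
      (fun x => (h.bound_deriv x).1) (fun x => (h.bound_deriv x).2)
  have hK := h.nonneg
  have hC0 : 0 ≤ C := (norm_nonneg _).trans (hzC 0)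
  choose! D hD using fun t ht => (hy t ht).bounded
  have hD0 : 0 ≤ D t₀ := (norm_nonneg _).trans (hD t₀ ht₀ 0)
  set c : ℝ → ℝ := fun t => (t - t₀)⁻¹ with hc
  -- With `Q_t` the potential matrix, this is `(Q_t - Q_{t₀}) z + ((Q_t - Q_{t₀}) / (t - t₀) - Q')
  -- y_{t₀}`: the variation of the potential plus the error in its difference quotient.
  set src : ℝ → ℝ → Fin 3 → ℂ := fun t s =>
    (potential α (p t s - p t₀ s) (q t s - q t₀ s)).mulVec (z s) +
      (potential α (c t * (p t s - p t₀ s) - p' s) (c t * (q t s - q t₀ s) - q' s)).mulVec (y t₀ s)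
    with hsrc
  set w : ℝ → ℝ → Fin 3 → ℂ := fun t x => (c t : ℂ) • (y t x - y t₀ x) - z x with hw
  -- The punctured neighbourhood is taken within `[0, ∞)`, so at `t₀ = 0` the derivative is
  -- one-sided.
  set l : Filter ℝ := 𝓝[Ici 0 \ {t₀}] t₀ with hl
  have hnear : ∀ᶠ t in l, t ∈ Icc 0 T ∧ t ≠ t₀ ∧ |t - t₀| ≤ 1 := by
    have h1 : ∀ᶠ t in l, t < T :=
      nhdsWithin_le_nhds (Iio_mem_nhds h.mem.2)
    have h2 : ∀ᶠ t in l, |t - t₀| ≤ 1 := by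
      refine nhdsWithin_le_nhds ?_
      filter_upwards [Metric.closedBall_mem_nhds t₀ one_pos] with t ht
      rwa [Metric.mem_closedBall, Real.dist_eq] at ht
    filter_upwards [h1, h2, self_mem_nhdsWithin] with t hT h1 hm
    exact ⟨⟨hm.1, hT.le⟩, hm.2, h1⟩
  have hquot : ∀ t ∈ Icc 0 T, t ≠ t₀ → ∀ x, |c t * (p t x - p t₀ x)| ≤ K / (1 + x ^ 2) ∧
      |c t * (q t x - q t₀ x)| ≤ K / (1 + x ^ 2) := by
    intro t ht hne x
    have hpos : 0 < |t - t₀| := abs_pos.2 (sub_ne_zero.2 hne)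
    have hL := h.lipschitz t ht x
    simp only [hc, abs_mul, abs_inv]
    rw [inv_mul_le_iff₀ hpos, inv_mul_le_iff₀ hpos, mul_comm |t - t₀|]
    exact hL
  have hsrcb : ∀ᶠ t in l, ∀ s, ‖src t s‖ ≤
      (2 * K * C + 4 * K * D t₀) / (1 + s ^ 2) := by
    filter_upwards [hnear] with t ht s
    have hL := h.lipschitz t ht.1 s
    have hq := hquot t ht.1 ht.2.1 s
    have hb := h.bound_deriv s
    have hK1 : 0 ≤ K / (1 + s ^ 2) := by positivity
    have e1 := norm_potential_mulVec_le hα (hL.1.trans (mul_le_of_le_one_right hK1 ht.2.2))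
      (hL.2.trans (mul_le_of_le_one_right hK1 ht.2.2)) (z s)
    have e2 := norm_potential_mulVec_le hα ((abs_sub _ _).trans (add_le_add hq.1 hb.1))
      ((abs_sub _ _).trans (add_le_add hq.2 hb.2)) (y t₀ s)
    refine (norm_add_le _ _).trans ?_
    calc _ ≤ 2 * (K / (1 + s ^ 2)) * C + 2 * (K / (1 + s ^ 2) + K / (1 + s ^ 2)) * D t₀ := by
          refine add_le_add (e1.trans ?_) (e2.trans ?_)
          · gcongr; exact hzC s
          · gcongr; exact hD t₀ ht₀ s
      _ = _ := by ring
  have hcp : ∀ x, Tendsto (fun t => c t * (p t x - p t₀ x)) l (𝓝 (p' x)) ∧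
      Tendsto (fun t => c t * (q t x - q t₀ x)) l (𝓝 (q' x)) := fun x =>
    ⟨(hasDerivWithinAt_iff_tendsto_slope.1 (h.hasDeriv x).1),
      (hasDerivWithinAt_iff_tendsto_slope.1 (h.hasDeriv x).2)⟩
  have hp0 : ∀ x, Tendsto (fun t => p t x - p t₀ x) l (𝓝 0) ∧
      Tendsto (fun t => q t x - q t₀ x) l (𝓝 0) := fun x => by
    have h1 := ((h.hasDeriv x).1.continuousWithinAt.tendsto.mono_left
      (nhdsWithin_mono t₀ (sdiff_subset (t := {t₀})))).sub_const (p t₀ x)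
    have h2 := ((h.hasDeriv x).2.continuousWithinAt.tendsto.mono_left
      (nhdsWithin_mono t₀ (sdiff_subset (t := {t₀})))).sub_const (q t₀ x)
    rw [sub_self] at h1 h2
    exact ⟨h1, h2⟩
  have hsrc0 : ∀ s, Tendsto (fun t => src t s) l (𝓝 0) := by
    intro s
    have e1 := tendsto_potential α (hp0 s).1 (hp0 s).2 (z s)
    have e2 := tendsto_potential α ((hcp s).1.sub_const (p' s)) ((hcp s).2.sub_const (q' s)) (y t₀ s)
    have hz0 : ∀ v, (potential α 0 0).mulVec v = 0 := by
      intro v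
      have : potential α 0 0 = 0 := by
        ext a b
        fin_cases a <;> fin_cases b <;> simp [potential]
      rw [this, Matrix.zero_mulVec]
    have := e1.add e2
    simpa only [sub_self, hz0, add_zero] using this
  have hpotc : ∀ {f g : ℝ → ℝ} {v : ℝ → Fin 3 → ℂ}, Continuous f → Continuous g → Continuous v →
      Continuous fun s => (potential α (f s) (g s)).mulVec (v s) := by
    intro f g v hf hg hv
    refine Continuous.matrix_mulVec (continuous_matrix fun a b => ?_) hv
    fin_cases a <;> fin_cases b <;> simp only [potential] <;> simp <;> fun_prop
  have hsrcc : ∀ t ∈ Icc 0 T, Continuous (src t) := by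
    intro t ht
    have h1 := h.continuous t ht
    have h2 := h.continuous t₀ ht₀
    have h3 := h.continuous_deriv
    refine (hpotc (h1.1.sub h2.1) (h1.2.sub h2.2) hzc).add (hpotc ?_ ?_ (hy t₀ ht₀).continuous)
    · exact (continuous_const.mul (h1.1.sub h2.1)).sub h3.1
    · exact (continuous_const.mul (h1.2.sub h2.2)).sub h3.2
  have hint : Tendsto (fun t => ∫ s, ‖src t s‖) l (𝓝 0) := by
    have := tendsto_integral_filter_of_dominated_convergence (μ := volume) (l := l)
      (F := fun t s => ‖src t s‖) (f := fun _ => 0)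
      (fun s => (2 * K * C + 4 * K * D t₀) / (1 + s ^ 2))
      (by filter_upwards [hnear] with t ht using (hsrcc t ht.1).norm.aestronglyMeasurable)
      (by filter_upwards [hsrcb] with t ht using ae_of_all _ fun s => by simpa using ht s)
      (integrable_div_one_add_sq _) (ae_of_all _ fun s => by simpa using (hsrc0 s).norm)
    simpa using this
  have hres : ∀ᶠ t in l, ‖w t x‖ ≤ 2 * (∫ s, ‖src t s‖) * weight (2 * K) x := by
    filter_upwards [hnear, hsrcb] with t ht hb
    have hyt := hy t ht.1
    have hy0 := hy t₀ ht₀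
    have hwb : ∀ x, ‖w t x‖ ≤ |c t| * (D t + D t₀) + C := by
      intro x
      refine (norm_sub_le _ _).trans (add_le_add ?_ (hzC x))
      rw [norm_smul, Complex.norm_real, Real.norm_eq_abs]
      gcongr
      exact (norm_sub_le _ _).trans (add_le_add (hD t ht.1 x) (hD t₀ ht₀ x))
    have hwc : Continuous (w t) := by
      have h1 := hyt.continuous
      have h2 := hy0.continuous
      simp only [hw]
      fun_prop
    have hQt := hQ t ht.1
    have hQ0 := hQ t₀ ht₀
    have c1 := hQt.continuous_mulVec hyt.continuous
    have c0 := hQ0.continuous_mulVec hy0.continuous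
    have cz : Continuous fun s => (pot α p' q' s).mulVec (y t₀ s) +
        (pot α (p t₀) (q t₀) s).mulVec (z s) :=
      (hQ'.continuous_mulVec hy0.continuous).add (hQ0.continuous_mulVec hzc)
    have bz : ∀ s, ‖(pot α p' q' s).mulVec (y t₀ s) + (pot α (p t₀) (q t₀) s).mulVec (z s)‖ ≤
        (2 * K * D t₀ + 2 * K * C) / (1 + s ^ 2) := by
      intro s
      refine (norm_add_le _ _).trans ?_
      rw [add_div]
      exact add_le_add (hQ'.norm_mulVec_le (hD t₀ ht₀) s) (hQ0.norm_mulVec_le hzC s)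
    set G1 : ℝ → Fin 3 → ℂ := fun s => (c t : ℂ) •
      ((pot α (p t) (q t) s).mulVec (y t s) - (pot α (p t₀) (q t₀) s).mulVec (y t₀ s)) with hG1
    have cG1 : Continuous G1 := by
      rw [hG1]
      fun_prop
    have bG1 : ∀ s, ‖G1 s‖ ≤ (|c t| * (2 * K * D t + 2 * K * D t₀)) / (1 + s ^ 2) := by
      intro s
      rw [hG1]
      simp only
      rw [norm_smul, Complex.norm_real, Real.norm_eq_abs, mul_div_assoc, add_div]
      gcongr
      exact (norm_sub_le _ _).trans
        (add_le_add (hQt.norm_mulVec_le (hD t ht.1) s) (hQ0.norm_mulVec_le (hD t₀ ht₀) s))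
    have ew : ∀ x, w t x = volterra μ (fun s => G1 s - ((pot α p' q' s).mulVec (y t₀ s) +
        (pot α (p t₀) (q t₀) s).mulVec (z s))) x := by
      intro x
      rw [volterra_sub hμ cG1 bG1 cz bz, ← hz x, hG1, volterra_const_smul,
        volterra_sub hμ c1 (hQt.norm_mulVec_le (hD t ht.1)) c0 (hQ0.norm_mulVec_le (hD t₀ ht₀))]
      simp only [hw]
      rw [hyt.eq x, hy0.eq x, add_sub_add_left_eq_sub]
    refine norm_le_of_volterra hμ hQt ⟨_, hwb⟩ (fun x => ?_) x
    have bG : ∀ s, ‖G1 s - ((pot α p' q' s).mulVec (y t₀ s) +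
        (pot α (p t₀) (q t₀) s).mulVec (z s))‖ ≤
        (|c t| * (2 * K * D t + 2 * K * D t₀) + (2 * K * D t₀ + 2 * K * C)) / (1 + s ^ 2) := by
      intro s
      rw [add_div]
      exact (norm_sub_le _ _).trans (add_le_add (bG1 s) (bz s))
    have cG : Continuous fun s => G1 s - ((pot α p' q' s).mulVec (y t₀ s) +
        (pot α (p t₀) (q t₀) s).mulVec (z s)) := cG1.sub cz
    rw [ew x, ← volterra_sub hμ cG bG (hQt.continuous_mulVec hwc) (hQt.norm_mulVec_le hwb)]
    have esrc : ∀ s, G1 s - ((pot α p' q' s).mulVec (y t₀ s) +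
        (pot α (p t₀) (q t₀) s).mulVec (z s)) - (pot α (p t) (q t) s).mulVec (w t s) = src t s := by
      intro s
      simp only [hG1, hw, hsrc, pot, ← potential_sub, ← potential_smul, Matrix.sub_mulVec,
        Matrix.mulVec_sub, Matrix.mulVec_smul, Matrix.smul_mulVec]
      module
    simp only [esrc]
    have hi : Integrable fun s => ‖src t s‖ :=
      (integrable_div_one_add_sq _).mono' (hsrcc t ht.1).norm.aestronglyMeasurable
        (ae_of_all _ fun s => by simpa using hb s)
    refine (norm_volterra_le hμ (fun s => le_rfl) hi.integrableOn).trans ?_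
    exact setIntegral_le_integral hi (ae_of_all _ fun s => norm_nonneg _)
  have hw0 : Tendsto (fun t => w t x) l (𝓝 0) := by
    refine squeeze_zero_norm' hres ?_
    simpa using (hint.const_mul 2).mul_const (weight (2 * K) x)
  rw [hasDerivWithinAt_iff_tendsto_slope]
  have hwa := (tendsto_pi_nhds.1 hw0 a).add_const (z x a)
  simp only [Pi.zero_apply, zero_add] at hwa
  refine hwa.congr fun t => ?_
  simp [hw, hc, slope_def_module]

end CMKdV
end

noncomputable section
namespace CMKdV

/-! ### The temporal equation -/

/-- The values of `p, q` and of their first two derivatives. -/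
def jet (p q : ℝ → ℝ) (x : ℝ) : Fin 6 → ℝ :=
  ![p x, q x, iteratedDeriv 1 p x, iteratedDeriv 1 q x, iteratedDeriv 2 p x, iteratedDeriv 2 q x]

/-- The matrix `T` of the temporal equation `ψ_t = T ψ`, where `ζ = iαk`. -/
def timeMat (α : ℝ) (ζ : ℂ) (J : Fin 6 → ℝ) : Matrix (Fin 3) (Fin 3) ℂ :=
  !![4 * ζ ^ 3 - 2 * ζ * α * (J 0 * J 0 + J 1 * J 1),
      -4 * ζ ^ 2 * α * J 0 + 2 * ζ * α * J 2 - α * J 4 + 2 * (J 0 * J 0 + J 1 * J 1) * J 0,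
      -4 * ζ ^ 2 * α * J 1 + 2 * ζ * α * J 3 - α * J 5 + 2 * (J 0 * J 0 + J 1 * J 1) * J 1;
    -4 * ζ ^ 2 * J 0 - 2 * ζ * J 2 - J 4 + 2 * α * (J 0 * J 0 + J 1 * J 1) * J 0,
      -4 * ζ ^ 3 + 2 * ζ * α * (J 0 * J 0), 2 * ζ * α * (J 0 * J 1) + α * (J 2 * J 1 - J 0 * J 3);
    -4 * ζ ^ 2 * J 1 - 2 * ζ * J 3 - J 5 + 2 * α * (J 0 * J 0 + J 1 * J 1) * J 1,
      2 * ζ * α * (J 0 * J 1) + α * (J 3 * J 0 - J 1 * J 2), -4 * ζ ^ 3 + 2 * ζ * α * (J 1 * J 1)]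

/-- The right hand side of the first equation of the coupled system. -/
def flow (α : ℝ) (p q : ℝ → ℝ) (x : ℝ) : ℝ :=
  -iteratedDeriv 3 p x + 3 * α * (iteratedDeriv 1 p x * q x ^ 2 + p x * q x * iteratedDeriv 1 q x +
    2 * p x ^ 2 * iteratedDeriv 1 p x)

/-- The right hand side `T y + 4 ζ³ λ_j y` of the temporal equation of the `j`-th Jost columns. -/
def timeRhs (α : ℝ) (k : ℂ) (j : Fin 3) (J : Fin 6 → ℝ) (v : Fin 3 → ℂ) : Fin 3 → ℂ :=
  (timeMat α (Complex.I * α * k) J).mulVec v + (4 * (Complex.I * α * k) ^ 3 * lam j) • v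

lemma hasDerivAt_iteratedDeriv {p : ℝ → ℝ} (hp : ContDiff ℝ (⊤ : ℕ∞) p) (b : ℕ) (x : ℝ) :
    HasDerivAt (iteratedDeriv b p) (iteratedDeriv (b + 1) p x) x := by
  rw [iteratedDeriv_succ]
  exact ((hp.differentiable_iteratedDeriv b (by exact_mod_cast ENat.natCast_lt_top b)) x).hasDerivAt

lemma hasDerivAt_ofReal_iteratedDeriv {p : ℝ → ℝ} (hp : ContDiff ℝ (⊤ : ℕ∞) p) (b : ℕ) (x : ℝ) :
    HasDerivAt (fun x => ((iteratedDeriv b p x : ℝ) : ℂ)) ((iteratedDeriv (b + 1) p x : ℝ) : ℂ) x :=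
  (hasDerivAt_iteratedDeriv hp b x).ofReal_comp

lemma timeRhs_apply (α : ℝ) (k : ℂ) (j : Fin 3) (J : Fin 6 → ℝ) (v : Fin 3 → ℂ) (a : Fin 3) :
    timeRhs α k j J v a = timeMat α (Complex.I * α * k) J a 0 * v 0 +
      timeMat α (Complex.I * α * k) J a 1 * v 1 + timeMat α (Complex.I * α * k) J a 2 * v 2 +
      4 * (Complex.I * α * k) ^ 3 * lam j * v a := by
  simp only [timeRhs, Pi.add_apply, Pi.smul_apply, smul_eq_mul, mulVec_apply_sum,
    Fin.sum_univ_three]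

lemma eq_or_eq_neg_of_sq_eq_one {α : ℝ} (hα : α ^ 2 = 1) : α = 1 ∨ α = -1 :=
  sq_eq_one_iff.1 hα

section ZeroCurvature

variable {K α : ℝ} {p q : ℝ → ℝ} {k : ℂ} {j : Fin 3} {y : ℝ → Fin 3 → ℂ}

/-- The zero curvature condition for the Lax pair, applied to a vector. The expression `T y + 4ζ³λ_j
y` solves the spatial equation linearised at `Q`, with the time derivative of `Q` replaced by the
right-hand side of the coupled system. The cubic terms in `T` are matched to the nonlinearity
exactly here. -/
lemma hasDerivAt_timeRhs (h : Admissible K p q) (hα : α ^ 2 = 1) (hy : IsSpatialSol α p q k j y)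
    (x : ℝ) (a : Fin 3) :
    HasDerivAt (fun x => timeRhs α k j (jet p q x) (y x) a)
      (rate α k j a * timeRhs α k j (jet p q x) (y x) a +
        ((pot α (flow α p q) (flow α q p) x).mulVec (y x) a +
        (pot α p q x).mulVec (timeRhs α k j (jet p q x) (y x)) a)) x := by
  have hp0 := hasDerivAt_ofReal_iteratedDeriv h.smooth_left 0 x
  have hq0 := hasDerivAt_ofReal_iteratedDeriv h.smooth_right 0 x
  have hp1 := hasDerivAt_ofReal_iteratedDeriv h.smooth_left 1 x
  have hq1 := hasDerivAt_ofReal_iteratedDeriv h.smooth_right 1 x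
  have hp2 := hasDerivAt_ofReal_iteratedDeriv h.smooth_left 2 x
  have hq2 := hasDerivAt_ofReal_iteratedDeriv h.smooth_right 2 x
  have hy0 := hy x 0
  have hy1 := hy x 1
  have hy2 := hy x 2
  simp only [iteratedDeriv_zero, Nat.reduceAdd] at hp0 hq0 hp1 hq1 hp2 hq2
  simp only [pot, potential_mulVec_zero, potential_mulVec_one, potential_mulVec_two, rate]
    at hy0 hy1 hy2
  -- The final identities hold modulo `α² = 1`; inserting the two values of `α` turns them into ring
  -- identities.
  have hα' : (α : ℂ) = 1 ∨ (α : ℂ) = -1 := by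
    rcases eq_or_eq_neg_of_sq_eq_one hα with h | h <;> simp [h]
  set ζ : ℂ := Complex.I * α * k with hζ
  have hw := (hp0.mul hp0).add (hq0.mul hq0)
  simp only [timeRhs_apply]
  fin_cases a
  · have h := ((((hw.const_mul (2 * ζ * α)).const_sub (4 * ζ ^ 3)).mul hy0).add
      ((((((hp0.const_mul (-4 * ζ ^ 2 * α)).add (hp1.const_mul (2 * ζ * α))).sub
        (hp2.const_mul (α : ℂ))).add ((hw.const_mul 2).mul hp0)).mul hy1)) |>.add
      ((((((hq0.const_mul (-4 * ζ ^ 2 * α)).add (hq1.const_mul (2 * ζ * α))).sub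
        (hq2.const_mul (α : ℂ))).add ((hw.const_mul 2).mul hq0)).mul hy2))) |>.add
      (hy0.const_mul (4 * ζ ^ 3 * lam j))
    refine h.congr_deriv ?_
    simp [pot, potential_mulVec_zero, rate, ← hζ, timeRhs_apply, timeMat, jet, flow, lam]
    rcases hα' with h | h <;> rw [h] <;> ring
  · have h := ((((((hp0.const_mul (-4 * ζ ^ 2)).sub (hp1.const_mul (2 * ζ))).sub hp2).add
        ((hw.const_mul (2 * α : ℂ)).mul hp0)).mul hy0).add
      (((hp0.mul hp0).const_mul (2 * ζ * α)).const_add (-4 * ζ ^ 3) |>.mul hy1) |>.add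
      ((((hp0.mul hq0).const_mul (2 * ζ * α)).add (((hp1.mul hq0).sub (hp0.mul hq1)).const_mul
        (α : ℂ))).mul hy2)) |>.add (hy1.const_mul (4 * ζ ^ 3 * lam j))
    refine h.congr_deriv ?_
    simp [pot, potential_mulVec_one, rate, ← hζ, timeRhs_apply, timeMat, jet, flow, lam]
    rcases hα' with h | h <;> rw [h] <;> ring
  · have h := ((((((hq0.const_mul (-4 * ζ ^ 2)).sub (hq1.const_mul (2 * ζ))).sub hq2).add
        ((hw.const_mul (2 * α : ℂ)).mul hq0)).mul hy0).add
      ((((hp0.mul hq0).const_mul (2 * ζ * α)).add (((hq1.mul hp0).sub (hq0.mul hp1)).const_mul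
        (α : ℂ))).mul hy1) |>.add
      (((hq0.mul hq0).const_mul (2 * ζ * α)).const_add (-4 * ζ ^ 3) |>.mul hy2)) |>.add
      (hy2.const_mul (4 * ζ ^ 3 * lam j))
    refine h.congr_deriv ?_
    simp [pot, potential_mulVec_two, rate, ← hζ, timeRhs_apply, timeMat, jet, flow, lam]
    rcases hα' with h | h <;> rw [h] <;> ring

end ZeroCurvature

end CMKdV
end

noncomputable section
namespace CMKdV

/-! ### Evolution of the Jost columns -/

lemma continuous_timeMat (α : ℝ) (ζ : ℂ) : Continuous (timeMat α ζ) := by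
  refine continuous_matrix fun a b => ?_
  fin_cases a <;> fin_cases b <;> simp only [timeMat] <;> simp <;> fun_prop

lemma exists_timeMat_bound (α K : ℝ) (ζ : ℂ) :
    ∃ C : ℝ, 0 ≤ C ∧ ∀ J : Fin 6 → ℝ, ‖J‖ ≤ K → ∀ a b, ‖timeMat α ζ J a b‖ ≤ C := by
  have h : ∀ ab : Fin 3 × Fin 3, ∃ C : ℝ, ∀ J ∈ Metric.closedBall (0 : Fin 6 → ℝ) K,
      ‖timeMat α ζ J ab.1 ab.2‖ ≤ C := fun ab =>
    (isCompact_closedBall 0 K).exists_bound_of_continuousOn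
      ((continuous_timeMat α ζ).matrix_elem ab.1 ab.2).continuousOn
  choose C hC using h
  refine ⟨∑ ab, |C ab|, Finset.sum_nonneg fun _ _ => abs_nonneg _, fun J hJ a b => ?_⟩
  refine (hC (a, b) J (by simpa using hJ)).trans ((le_abs_self _).trans ?_)
  exact Finset.single_le_sum (f := fun ab => |C ab|) (fun _ _ => abs_nonneg _)
    (Finset.mem_univ (a, b))

lemma exists_timeRhs_bound (α K : ℝ) (k : ℂ) (j : Fin 3) :
    ∃ C : ℝ, 0 ≤ C ∧ ∀ J : Fin 6 → ℝ, ‖J‖ ≤ K → ∀ v, ‖timeRhs α k j J v‖ ≤ C * ‖v‖ := by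
  obtain ⟨C, hC0, hC⟩ := exists_timeMat_bound α K (Complex.I * α * k)
  set d := ‖4 * (Complex.I * α * k) ^ 3 * lam j‖ with hd
  refine ⟨C + C + C + d, by positivity, fun J hJ v => ?_⟩
  refine (pi_norm_le_iff_of_nonneg (by positivity)).2 fun a => ?_
  have key : ∀ b, ‖timeMat α (Complex.I * α * k) J a b * v b‖ ≤ C * ‖v‖ := fun b => by
    rw [norm_mul]
    exact mul_le_mul (hC J hJ a b) (norm_le_pi_norm v b) (norm_nonneg _) hC0
  have hda : ‖4 * (Complex.I * α * k) ^ 3 * lam j * v a‖ ≤ d * ‖v‖ := by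
    rw [norm_mul]
    gcongr
    exact norm_le_pi_norm v a
  rw [timeRhs_apply]
  refine (norm_add₄_le).trans ?_
  have h0 := key 0
  have h1 := key 1
  have h2 := key 2
  linarith

/-- Where the potential vanishes, `T = -4ζ³Λ`, and the added term `4ζ³λ_j` cancels it on the `j`-th
basis vector. Therefore the candidate for the time derivative decays at the end where the column is
normalised. -/
lemma timeRhs_zero_basisVec (α : ℝ) (k : ℂ) (j : Fin 3) : timeRhs α k j 0 (basisVec j) = 0 := by
  funext a
  rw [timeRhs_apply]
  fin_cases j <;> fin_cases a <;> simp [timeMat, basisVec, lam, Matrix.one_apply]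

lemma tendsto_timeRhs {l : Filter ℝ} {α : ℝ} {k : ℂ} {j : Fin 3} {J : ℝ → Fin 6 → ℝ}
    {y : ℝ → Fin 3 → ℂ} (hJ : Tendsto J l (𝓝 0))
    (hy : ∀ a, Tendsto (fun x => y x a) l (𝓝 (basisVec j a))) :
    Tendsto (fun x => timeRhs α k j (J x) (y x)) l (𝓝 0) := by
  rw [← timeRhs_zero_basisVec α k j]
  refine tendsto_pi_nhds.2 fun a => ?_
  simp only [timeRhs_apply]
  have hT := fun b => (((continuous_timeMat α (Complex.I * α * k)).matrix_elem a b).tendsto 0).comp hJ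
  exact ((((hT 0).mul (hy 0)).add ((hT 1).mul (hy 1))).add ((hT 2).mul (hy 2))).add
    ((hy a).const_mul _)

namespace Admissible

variable {K : ℝ} {p q : ℝ → ℝ}

lemma norm_jet_le_div (h : Admissible K p q) (x : ℝ) : ‖jet p q x‖ ≤ K / (1 + x ^ 2) := by
  have hK := h.nonneg
  refine (pi_norm_le_iff_of_nonneg (by positivity)).2 fun i => ?_
  rw [Real.norm_eq_abs]
  fin_cases i
  · exact h.abs_left x
  · exact h.abs_right x
  · exact h.bound_left 1 (by norm_num) x
  · exact h.bound_right 1 (by norm_num) x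
  · exact h.bound_left 2 (by norm_num) x
  · exact h.bound_right 2 (by norm_num) x

lemma div_le (h : Admissible K p q) (x : ℝ) : K / (1 + x ^ 2) ≤ K :=
  div_le_self h.nonneg (by nlinarith [sq_nonneg x])

lemma norm_jet_le (h : Admissible K p q) (x : ℝ) : ‖jet p q x‖ ≤ K :=
  (h.norm_jet_le_div x).trans (h.div_le x)

lemma tendsto_jet (h : Admissible K p q) {l : Filter ℝ} (hl : l ≤ cocompact ℝ) :
    Tendsto (jet p q) l (𝓝 0) := by
  refine squeeze_zero_norm h.norm_jet_le_div ?_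
  have h1 : Tendsto (fun x : ℝ => 1 + x ^ 2) l atTop := by
    refine tendsto_atTop_add_const_left _ _ ?_
    have := (tendsto_pow_atTop (α := ℝ) two_ne_zero).comp (tendsto_norm_cocompact_atTop (E := ℝ))
    refine (this.mono_left hl).congr fun x => ?_
    simp
  exact tendsto_const_nhds.div_atTop h1

/-- In each cubic term one factor keeps the decay `K / (1 + x²)` and two are bounded by `K`. The
coefficient 12 is `3 (1 + 1 + 2)`. -/
lemma abs_flow_le (h : Admissible K p q) {α : ℝ} (hα : α ^ 2 = 1) (x : ℝ) :
    |flow α p q x| ≤ (K + 12 * K ^ 3) / (1 + x ^ 2) := by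
  have hα1 : |α| = 1 := by rw [← sq_eq_sq₀ (abs_nonneg _) zero_le_one, sq_abs, hα, one_pow]
  have hK := h.nonneg
  set B := K / (1 + x ^ 2) with hB
  have hBK : B ≤ K := h.div_le x
  have hB0 : 0 ≤ B := by positivity
  have p0 : |p x| ≤ K := (h.abs_left x).trans hBK
  have q0 : |q x| ≤ K := (h.abs_right x).trans hBK
  have p1 := h.bound_left 1 (by norm_num) x
  have q1 := h.bound_right 1 (by norm_num) x
  have p3 := h.bound_left 3 (by norm_num) x
  have prod : ∀ a b c : ℝ, |a| ≤ K → |b| ≤ K → |c| ≤ B → |a * b * c| ≤ K * K * B := by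
    intro a b c ha hb hc
    rw [abs_mul, abs_mul]
    gcongr
  have e : flow α p q x = -iteratedDeriv 3 p x + 3 * α * (q x * q x * iteratedDeriv 1 p x +
      p x * q x * iteratedDeriv 1 q x + 2 * (p x * p x * iteratedDeriv 1 p x)) := by
    unfold flow
    ring
  rw [e]
  have t1 := prod _ _ _ q0 q0 p1
  have t2 := prod _ _ _ p0 q0 q1
  have t3 := prod _ _ _ p0 p0 p1
  calc _ ≤ |iteratedDeriv 3 p x| + 3 * (|q x * q x * iteratedDeriv 1 p x| +
        |p x * q x * iteratedDeriv 1 q x| + 2 * |p x * p x * iteratedDeriv 1 p x|) := by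
        refine (abs_add_le _ _).trans ?_
        rw [abs_neg, abs_mul, abs_mul, hα1, mul_one, abs_of_pos (by norm_num : (0 : ℝ) < 3)]
        gcongr
        refine (abs_add_le _ _).trans (add_le_add (abs_add_le _ _) ?_)
        rw [abs_mul, abs_of_pos (by norm_num : (0 : ℝ) < 2)]
    _ ≤ B + 3 * (K * K * B + K * K * B + 2 * (K * K * B)) := by gcongr
    _ = _ := by rw [hB]; ring

lemma continuous_flow (h : Admissible K p q) (α : ℝ) : Continuous (flow α p q) := by
  have hp := h.smooth_left.continuous
  have hq := h.smooth_right.continuous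
  have hc : ∀ {f : ℝ → ℝ}, ContDiff ℝ (⊤ : ℕ∞) f → ∀ b, Continuous (iteratedDeriv b f) := fun hf b =>
    continuous_iff_continuousAt.2 fun x => (hasDerivAt_iteratedDeriv hf b x).continuousAt
  have h3 := hc h.smooth_left 3
  have h1 := hc h.smooth_left 1
  have k1 := hc h.smooth_right 1
  unfold flow
  fun_prop

lemma swap (h : Admissible K p q) : Admissible K q p :=
  ⟨h.nonneg, h.smooth_right, h.smooth_left, h.bound_right, h.bound_left⟩

end Admissible

lemma DifferentiableFamily.reflect {K T t₀ : ℝ} {p q : ℝ → ℝ → ℝ} {p' q' : ℝ → ℝ}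
    (h : DifferentiableFamily K T t₀ p q p' q') :
    DifferentiableFamily K T t₀ (fun t => reflect (p t)) (fun t => reflect (q t))
      (reflect p') (reflect q') where
  nonneg := h.nonneg
  mem := h.mem
  continuous t ht := ⟨((h.continuous t ht).1.comp continuous_neg).neg,
    ((h.continuous t ht).2.comp continuous_neg).neg⟩
  bound t ht x := by simpa [CMKdV.reflect] using h.bound t ht (-x)
  lipschitz t ht x := by
    have := h.lipschitz t ht (-x)
    rw [← abs_neg (p t _ - _), ← abs_neg (q t _ - _)] at this
    simpa [CMKdV.reflect, neg_add_eq_sub] using this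
  hasDeriv x := ⟨(h.hasDeriv (-x)).1.neg, (h.hasDeriv (-x)).2.neg⟩
  continuous_deriv := ⟨(h.continuous_deriv.1.comp continuous_neg).neg,
    (h.continuous_deriv.2.comp continuous_neg).neg⟩
  bound_deriv x := by simpa [CMKdV.reflect] using h.bound_deriv (-x)

namespace IsSchwartzSolution

variable {α : ℝ} {u₀ v₀ : SchwartzMap ℝ ℝ} {u v : ℝ → ℝ → ℝ}

lemma exists_admissible (hsol : IsSchwartzSolution α u₀ v₀ u v) (T : ℝ) :
    ∃ K, 0 ≤ K ∧ ∀ t ∈ Icc 0 T, Admissible K (fun y => u y t) (fun y => v y t) := by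
  choose Cu hCu using hsol.decay_u T
  choose Cv hCv using hsol.decay_v T
  -- The powers 0 and 2 of `|x|` together bound `(1 + x²)` times a derivative, and orders up to 3
  -- are the ones in `Admissible`. One sum dominates all of these constants.
  set K : ℝ := ∑ b ∈ Finset.range 4, (|Cu 0 b| + |Cu 2 b| + |Cv 0 b| + |Cv 2 b|) with hK
  have hK0 : 0 ≤ K := Finset.sum_nonneg fun b _ => by positivity
  have hle : ∀ b ≤ 3, |Cu 0 b| + |Cu 2 b| + |Cv 0 b| + |Cv 2 b| ≤ K := fun b hb =>
    Finset.single_le_sum (f := fun b => |Cu 0 b| + |Cu 2 b| + |Cv 0 b| + |Cv 2 b|)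
      (fun b _ => by positivity) (Finset.mem_range.2 (by omega))
  refine ⟨K, hK0, fun t ht => ⟨hK0, hsol.smooth_u t ht.1, hsol.smooth_v t ht.1,
    fun b hb x => ?_, fun b hb x => ?_⟩⟩
  · rw [le_div_iff₀ (by positivity)]
    have h0 := hCu 0 b t ht x
    have h2 := hCu 2 b t ht x
    rw [sq_abs] at h2
    have := hle b hb
    have := le_abs_self (Cu 0 b)
    have := le_abs_self (Cu 2 b)
    have := abs_nonneg (Cv 0 b)
    have := abs_nonneg (Cv 2 b)
    simp only [pow_zero, one_mul] at h0
    linarith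
  · rw [le_div_iff₀ (by positivity)]
    have h0 := hCv 0 b t ht x
    have h2 := hCv 2 b t ht x
    rw [sq_abs] at h2
    have := hle b hb
    have := le_abs_self (Cv 0 b)
    have := le_abs_self (Cv 2 b)
    have := abs_nonneg (Cu 0 b)
    have := abs_nonneg (Cu 2 b)
    simp only [pow_zero, one_mul] at h0
    linarith

lemma hasDerivWithinAt_u (hsol : IsSchwartzSolution α u₀ v₀ u v) {t : ℝ} (ht : 0 ≤ t) (x : ℝ) :
    HasDerivWithinAt (fun τ => u x τ) (flow α (fun y => u y t) (fun y => v y t) x) (Ici 0) t := by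
  obtain ⟨ut, h1, h2⟩ := hsol.eq_u x t ht
  refine h1.congr_deriv ?_
  simp only [flow, iteratedDeriv_one]
  linear_combination h2

lemma hasDerivWithinAt_v (hsol : IsSchwartzSolution α u₀ v₀ u v) {t : ℝ} (ht : 0 ≤ t) (x : ℝ) :
    HasDerivWithinAt (fun τ => v x τ) (flow α (fun y => v y t) (fun y => u y t) x) (Ici 0) t := by
  obtain ⟨vt, h1, h2⟩ := hsol.eq_v x t ht
  refine h1.congr_deriv ?_
  simp only [flow, iteratedDeriv_one]
  linear_combination h2

lemma exists_family (hsol : IsSchwartzSolution α u₀ v₀ u v) (hα : α ^ 2 = 1) {t₀ : ℝ}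
    (ht₀ : 0 ≤ t₀) : ∃ K, (∀ t ∈ Icc 0 (t₀ + 1), Admissible K (fun y => u y t) (fun y => v y t)) ∧
      DifferentiableFamily (K + 12 * K ^ 3) (t₀ + 1) t₀ (fun t x => u x t) (fun t x => v x t)
        (flow α (fun y => u y t₀) (fun y => v y t₀)) (flow α (fun y => v y t₀) (fun y => u y t₀)) := by
  obtain ⟨K, hK, hadm⟩ := hsol.exists_admissible (t₀ + 1)
  have hKK : ∀ x : ℝ, K / (1 + x ^ 2) ≤ (K + 12 * K ^ 3) / (1 + x ^ 2) := fun x => by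
    gcongr
    have : 0 ≤ K ^ 3 := by positivity
    linarith
  have ht : t₀ ∈ Icc 0 (t₀ + 1) := ⟨ht₀, by linarith⟩
  refine ⟨K, hadm, ⟨by positivity, ⟨ht₀, by linarith⟩, fun t ht => ?_, fun t ht x => ?_,
    fun t ht' x => ?_, fun x => ⟨hsol.hasDerivWithinAt_u ht₀ x, hsol.hasDerivWithinAt_v ht₀ x⟩,
    ⟨(hadm t₀ ht).continuous_flow α, (hadm t₀ ht).swap.continuous_flow α⟩,
    fun x => ⟨(hadm t₀ ht).abs_flow_le hα x, (hadm t₀ ht).swap.abs_flow_le hα x⟩⟩⟩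
  · exact ⟨(hadm t ht).smooth_left.continuous, (hadm t ht).smooth_right.continuous⟩
  · exact ⟨((hadm t ht).abs_left x).trans (hKK x), ((hadm t ht).abs_right x).trans (hKK x)⟩
  -- The Lipschitz bound in `t` is the mean value inequality: the equation turns the time derivative
  -- into `flow`, which is bounded uniformly in time by `abs_flow_le`.
  · exact ⟨Convex.norm_image_sub_le_of_norm_hasDerivWithin_le (f := fun τ => u x τ)
      (s := Icc 0 (t₀ + 1))
      (fun τ hτ => (hsol.hasDerivWithinAt_u hτ.1 x).mono Icc_subset_Ici_self)
      (fun τ hτ => (hadm τ hτ).abs_flow_le hα x) (convex_Icc _ _) ht ht',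
      Convex.norm_image_sub_le_of_norm_hasDerivWithin_le (f := fun τ => v x τ)
      (s := Icc 0 (t₀ + 1))
      (fun τ hτ => (hsol.hasDerivWithinAt_v hτ.1 x).mono Icc_subset_Ici_self)
      (fun τ hτ => (hadm τ hτ).swap.abs_flow_le hα x) (convex_Icc _ _) ht ht'⟩

end IsSchwartzSolution

section Evolution

variable {α : ℝ} {u₀ v₀ : SchwartzMap ℝ ℝ} {u v : ℝ → ℝ → ℝ} {k : ℂ} {j : Fin 3}

lemma continuous_of_hasDerivAt {z z' : ℝ → Fin 3 → ℂ}
    (h : ∀ x a, HasDerivAt (fun x => z x a) (z' x a) x) : Continuous z :=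
  continuous_pi fun a => continuous_iff_continuousAt.2 fun x => (h x a).continuousAt

/-- By the zero curvature identity and decay at `-∞`, the candidate derivative solves the linearised
Volterra equation, and `DifferentiableFamily.hasDerivWithinAt_sol` shows that the column is
differentiable with this derivative. -/
lemma hasDerivWithinAt_leftCol (hsol : IsSchwartzSolution α u₀ v₀ u v) (hα : α ^ 2 = 1)
    (hk : Good α k j) {t : ℝ} (ht : 0 ≤ t) (x : ℝ) (a : Fin 3) :
    HasDerivWithinAt (fun τ => leftCol α (fun y => u y τ) (fun y => v y τ) k j x a)
      (timeRhs α k j (jet (fun y => u y t) (fun y => v y t) x)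
        (leftCol α (fun y => u y t) (fun y => v y t) k j x) a) (Ici 0) t := by
  obtain ⟨K, hadm, hfam⟩ := hsol.exists_family hα ht
  have h := hadm t ⟨ht, by linarith⟩
  set y := leftCol α (fun y => u y t) (fun y => v y t) k j with hy
  have hys := isSpatialSol_leftCol h hα hk
  have hd := hasDerivAt_timeRhs h hα hys
  obtain ⟨C, hC0, hC⟩ := exists_timeRhs_bound α K k j
  have hyb := norm_leftCol_le h hα hk
  have hzb : ∀ x, ‖timeRhs α k j (jet (fun y => u y t) (fun y => v y t) x) (y x)‖ ≤
      C * jostBound K := fun x =>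
    (hC _ (h.norm_jet_le x) _).trans (by gcongr; exact hyb x)
  have hzc := continuous_of_hasDerivAt hd
  have hQ := h.potBound hα
  have hQ' : PotBound (2 * (K + 12 * K ^ 3)) (pot α (flow α (fun y => u y t) (fun y => v y t))
      (flow α (fun y => v y t) (fun y => u y t))) :=
    potBound_of_abs_le hα hfam.nonneg hfam.continuous_deriv.1 hfam.continuous_deriv.2
      (fun x => (hfam.bound_deriv x).1) (fun x => (hfam.bound_deriv x).2)
  have hyc : Continuous y := continuous_of_hasDerivAt hys
  refine hfam.hasDerivWithinAt_sol hα hk (fun τ hτ => isVolterraSol_leftCol (hadm τ hτ) hα hk)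
    hzc hzb (fun x => ?_) x a
  refine eq_volterra_of_hasDerivAt hk (C := 2 * (K + 12 * K ^ 3) * jostBound K +
    2 * K * (C * jostBound K)) ?_ (fun s => ?_) hd ?_ x
  · exact (hQ'.continuous_mulVec hyc).add (hQ.continuous_mulVec hzc)
  · rw [add_div]
    exact (norm_add_le _ _).trans (add_le_add (hQ'.norm_mulVec_le hyb s) (hQ.norm_mulVec_le hzb s))
  · exact tendsto_timeRhs (h.tendsto_jet atBot_le_cocompact) (tendsto_leftCol_atBot h hα hk)

lemma hasDerivWithinAt_rightCol (hsol : IsSchwartzSolution α u₀ v₀ u v) (hα : α ^ 2 = 1)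
    (hk : Good α (-k) j) {t : ℝ} (ht : 0 ≤ t) (x : ℝ) (a : Fin 3) :
    HasDerivWithinAt (fun τ => rightCol α (fun y => u y τ) (fun y => v y τ) k j x a)
      (timeRhs α k j (jet (fun y => u y t) (fun y => v y t) x)
        (rightCol α (fun y => u y t) (fun y => v y t) k j x) a) (Ici 0) t := by
  obtain ⟨K, hadm, hfam⟩ := hsol.exists_family hα ht
  have h := hadm t ⟨ht, by linarith⟩
  set y := rightCol α (fun y => u y t) (fun y => v y t) k j with hy
  have hys := isSpatialSol_rightCol h hα hk
  have hd := hasDerivAt_timeRhs h hα hys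
  obtain ⟨C, hC0, hC⟩ := exists_timeRhs_bound α K k j
  have hyb := norm_rightCol_le h hα hk
  set z := fun x => timeRhs α k j (jet (fun y => u y t) (fun y => v y t) x) (y x) with hz
  have hzb : ∀ x, ‖z x‖ ≤ C * jostBound K := fun x =>
    (hC _ (h.norm_jet_le x) _).trans (by gcongr; exact hyb x)
  have hzc : Continuous z := continuous_of_hasDerivAt hd
  have hQ := h.reflect.potBound hα
  have hfr := hfam.reflect
  have hQ' : PotBound (2 * (K + 12 * K ^ 3)) (pot α (reflect (flow α (fun y => u y t)
      (fun y => v y t))) (reflect (flow α (fun y => v y t) (fun y => u y t)))) :=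
    potBound_of_abs_le hα hfr.nonneg hfr.continuous_deriv.1 hfr.continuous_deriv.2
      (fun x => (hfr.bound_deriv x).1) (fun x => (hfr.bound_deriv x).2)
  have hyc : Continuous y := continuous_of_hasDerivAt hys
  -- After reflection the candidate solves the linearised equation for the reflected potentials at
  -- `-k`. It decays at `-∞` because `z` decays at `+∞`.
  have hd' : ∀ x a, HasDerivAt (fun x => z (-x) a) (rate α (-k) j a * z (-x) a +
      ((pot α (reflect (flow α (fun y => u y t) (fun y => v y t)))
        (reflect (flow α (fun y => v y t) (fun y => u y t))) x).mulVec (y (-x)) +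
      (pot α (reflect (fun y => u y t)) (reflect (fun y => v y t)) x).mulVec (z (-x))) a) x := by
    intro x a
    have := (hd (-x) a).scomp x (hasDerivAt_neg x)
    refine this.congr_deriv ?_
    rw [Pi.add_apply, pot_reflect_mulVec, pot_reflect_mulVec, rate_neg]
    simp only [Pi.neg_apply, hz, neg_smul, one_smul]
    ring
  have key := hfr.hasDerivWithinAt_sol hα hk (z := fun x => z (-x))
    (fun τ hτ => isJostRightColumn_iff.1 (isJostRightColumn_rightCol (hadm τ hτ) hα hk))
    (hzc.comp continuous_neg) (fun x => hzb (-x)) (fun x => ?_) (-x) a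
  · simpa using key
  refine eq_volterra_of_hasDerivAt hk (C := 2 * (K + 12 * K ^ 3) * jostBound K +
    2 * K * (C * jostBound K)) ?_ (fun s => ?_) hd' ?_ x
  · exact (hQ'.continuous_mulVec (hyc.comp continuous_neg)).add
      (hQ.continuous_mulVec (hzc.comp continuous_neg))
  · rw [add_div]
    exact (norm_add_le _ _).trans (add_le_add
      (hQ'.norm_mulVec_le (y := fun s => y (-s)) (fun s => hyb (-s)) s)
      (hQ.norm_mulVec_le (y := fun s => z (-s)) (fun s => hzb (-s)) s))
  · exact (tendsto_timeRhs (h.tendsto_jet atTop_le_cocompact)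
      (tendsto_rightCol_atTop h hα hk)).comp tendsto_neg_atBot_atTop

end Evolution

end CMKdV
end

noncomputable section
namespace CMKdV

/-! ### Time invariance of the scattering data -/

section Invariance

variable {α : ℝ} {u₀ v₀ : SchwartzMap ℝ ℝ} {u v : ℝ → ℝ → ℝ} {k : ℂ} {i j : Fin 3}

lemma eq_of_hasDerivWithinAt_zero {f : ℝ → ℂ}
    (h : ∀ t ∈ Ici (0 : ℝ), HasDerivWithinAt f 0 (Ici 0) t) {t : ℝ} (ht : 0 ≤ t) : f t = f 0 := by
  have := eq_zero_of_norm_deriv_le (y := fun t => f t - f 0) (y' := fun _ => 0) (C := 0) (T := t)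
    (fun x hx => (h x hx).sub_const _) (by simp) (by simp) t ⟨ht, le_rfl⟩
  exact sub_eq_zero.1 this

/-- The matrix `T` has the same skew-symmetry as `Q` with respect to `diag(-α, 1, 1)`, because
conjugating `ζ` at `conj k` gives `-ζ` at `k`. The normalising terms `4ζ³λ` cancel when `lam i = lam
j`. Thus `s₁₁` and the lower block are preserved in time, without any analysis of the flow at
infinity. -/
lemma pairing_time_const {w z : ℝ → Fin 3 → ℂ} {J : ℝ → Fin 6 → ℝ} (hij : lam i = lam j)
    (hw : ∀ t ∈ Ici (0 : ℝ), ∀ a, HasDerivWithinAt (fun t => w t a)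
      (timeRhs α (starRingEnd ℂ k) i (J t) (w t) a) (Ici 0) t)
    (hz : ∀ t ∈ Ici (0 : ℝ), ∀ a, HasDerivWithinAt (fun t => z t a)
      (timeRhs α k j (J t) (z t) a) (Ici 0) t) (hα : α ^ 2 = 1) {t : ℝ} (ht : 0 ≤ t) :
    pairing α (w t) (z t) = pairing α (w 0) (z 0) := by
  refine eq_of_hasDerivWithinAt_zero (f := fun t => pairing α (w t) (z t)) (fun t ht => ?_) ht
  have hc : ∀ a, HasDerivWithinAt (fun t => starRingEnd ℂ (w t a))
      (starRingEnd ℂ (timeRhs α (starRingEnd ℂ k) i (J t) (w t) a)) (Ici 0) t := fun a =>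
    (hw t ht a).star
  have h := ((((hc 0).mul (hz t ht 0)).const_mul (-α : ℂ)).add ((hc 1).mul (hz t ht 1))).add
    ((hc 2).mul (hz t ht 2))
  refine h.congr_deriv ?_
  have hl : ∀ a, starRingEnd ℂ (lam a) = lam a := by
    intro a
    fin_cases a <;> simp [lam]
  have hα' : (α : ℂ) = 1 ∨ (α : ℂ) = -1 := by
    rcases eq_or_eq_neg_of_sq_eq_one hα with h | h <;> simp [h]
  have hζ : starRingEnd ℂ (Complex.I * α * starRingEnd ℂ k) = -(Complex.I * α * k) := by
    simp
  simp only [timeRhs_apply, timeMat, hij]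
  simp only [map_add, map_mul, map_pow, hl, hζ]
  simp [-map_mul]
  generalize Complex.I * α * starRingEnd ℂ k = η at *
  generalize Complex.I * α * k = ζ at *
  simp only [map_add, map_sub, map_mul, map_pow, Complex.conj_ofReal, hζ, map_ofNat]
  rcases hα' with h | h <;> rw [h] <;> ring

lemma IsSchwartzSolution.at_zero (hsol : IsSchwartzSolution α u₀ v₀ u v) :
    (fun y => u y 0) = ⇑u₀ ∧ (fun y => v y 0) = ⇑v₀ :=
  ⟨funext hsol.init_u, funext hsol.init_v⟩

lemma IsSchwartzSolution.exists_admissible_at (hsol : IsSchwartzSolution α u₀ v₀ u v) {t : ℝ}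
    (ht : 0 ≤ t) : ∃ K, Admissible K (fun y => u y t) (fun y => v y t) := by
  obtain ⟨K, -, h⟩ := hsol.exists_admissible t
  exact ⟨K, h t ⟨ht, le_rfl⟩⟩

lemma IsSchwartzSolution.exists_admissible_init (hsol : IsSchwartzSolution α u₀ v₀ u v) :
    ∃ K, Admissible K u₀ v₀ := by
  obtain ⟨K, h⟩ := hsol.exists_admissible_at le_rfl
  rw [hsol.at_zero.1, hsol.at_zero.2] at h
  exact ⟨K, h⟩

lemma scattering_zero_time (hsol : IsSchwartzSolution α u₀ v₀ u v) (hα : α ^ 2 = 1)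
    (hk : 0 ≤ α * k.im) {t : ℝ} (ht : 0 ≤ t) :
    scattering α (fun y => u y t) (fun y => v y t) k 0 0 = scattering α u₀ v₀ k 0 0 := by
  obtain ⟨K, h⟩ := hsol.exists_admissible_at ht
  obtain ⟨K₀, h₀⟩ := hsol.exists_admissible_init
  have hp := pairing_time_const (i := 0) (j := 0) (k := k) rfl
    (fun t ht a => hasDerivWithinAt_rightCol hsol hα (good_neg_conj_zero hk) ht 0 a)
    (fun t ht a => hasDerivWithinAt_leftCol hsol hα (good_zero hk) ht 0 a) hα ht
  simp only [hsol.at_zero.1, hsol.at_zero.2] at hp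
  rw [pairing_right_left_zero h hα hk, pairing_right_left_zero h₀ hα hk] at hp
  rw [scattering_zero_zero h hα hk, scattering_zero_zero h₀ hα hk]
  exact mul_left_cancel₀ (by simpa using ne_zero_of_sq_eq_one hα) hp

lemma lam_eq_of_ne_zero (hi : i ≠ 0) (hj : j ≠ 0) : lam i = lam j := by
  fin_cases i <;> fin_cases j <;> simp_all [lam]

lemma scattering_block_time (hsol : IsSchwartzSolution α u₀ v₀ u v) (hα : α ^ 2 = 1)
    (hk : α * k.im ≤ 0) {t : ℝ} (ht : 0 ≤ t) (hi : i ≠ 0) (hj : j ≠ 0) :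
    scattering α (fun y => u y t) (fun y => v y t) k i j = scattering α u₀ v₀ k i j := by
  obtain ⟨K, h⟩ := hsol.exists_admissible_at ht
  obtain ⟨K₀, h₀⟩ := hsol.exists_admissible_init
  have hk' : 0 ≤ α * (starRingEnd ℂ k).im := by simpa using hk
  have hp := pairing_time_const (i := j) (j := i) (k := starRingEnd ℂ k) (lam_eq_of_ne_zero hj hi)
    (fun t ht a => hasDerivWithinAt_leftCol hsol hα (good_conj_of_ne_zero hj hk') ht 0 a)
    (fun t ht a => hasDerivWithinAt_rightCol hsol hα (good_neg_of_ne_zero hi hk') ht 0 a) hα ht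
  simp only [hsol.at_zero.1, hsol.at_zero.2] at hp
  rw [pairing_left_right h hα hk' hj hi, pairing_left_right h₀ hα hk' hj hi, Complex.conj_conj] at hp
  rw [scattering_block h hα hi hj, scattering_block h₀ hα hi hj]
  exact (starRingEnd ℂ).injective hp

end Invariance

/-! ### Joint solutions of the spatial and temporal equations -/

/-- `d` solves the temporal equation `d_t = T d` for `t ≥ 0` and the spatial equation
`d_x = (iαkΛ + Q) d` at `t = 0`. -/
structure IsLaxSol (α : ℝ) (u v : ℝ → ℝ → ℝ) (k : ℂ) (d : ℝ → ℝ → Fin 3 → ℂ) : Prop where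
  space : ∀ x a, HasDerivAt (fun x => d x 0 a) (Complex.I * α * k * lam a * d x 0 a +
    (pot α (fun y => u y 0) (fun y => v y 0) x).mulVec (d x 0) a) x
  time : ∀ x t, 0 ≤ t → ∀ a, HasDerivWithinAt (fun t => d x t a)
    ((timeMat α (Complex.I * α * k) (jet (fun y => u y t) (fun y => v y t) x)).mulVec (d x t) a)
    (Ici 0) t

section Lax

variable {α : ℝ} {u₀ v₀ : SchwartzMap ℝ ℝ} {u v : ℝ → ℝ → ℝ} {k : ℂ} {j : Fin 3}
  {d d' : ℝ → ℝ → Fin 3 → ℂ}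

lemma IsLaxSol.add (h : IsLaxSol α u v k d) (h' : IsLaxSol α u v k d') :
    IsLaxSol α u v k (fun x t => d x t + d' x t) := by
  refine ⟨fun x a => ((h.space x a).add (h'.space x a)).congr_deriv ?_,
    fun x t ht a => ((h.time x t ht a).add (h'.time x t ht a)).congr_deriv ?_⟩
  · rw [Matrix.mulVec_add]
    simp only [Pi.add_apply]
    ring
  · rw [Matrix.mulVec_add]
    rfl

lemma IsLaxSol.smul (h : IsLaxSol α u v k d) (c : ℂ) : IsLaxSol α u v k (fun x t => c • d x t) := by
  refine ⟨fun x a => ((h.space x a).const_mul c).congr_deriv ?_,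
    fun x t ht a => ((h.time x t ht a).const_mul c).congr_deriv ?_⟩
  · rw [Matrix.mulVec_smul]
    simp only [Pi.smul_apply, smul_eq_mul]
    ring
  · rw [Matrix.mulVec_smul]
    rfl

/-- A Gronwall estimate in `x` at `t = 0` is followed by one in `t` at fixed `x`. Hence the spatial
equation is required only at the initial time. -/
lemma IsLaxSol.eq_zero (hsol : IsSchwartzSolution α u₀ v₀ u v) (hα : α ^ 2 = 1)
    (h : IsLaxSol α u v k d) (h0 : d 0 0 = 0) {x t : ℝ} (ht : 0 ≤ t) : d x t = 0 := by
  obtain ⟨K, hK, hadm⟩ := hsol.exists_admissible t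
  have hA := hadm 0 ⟨le_rfl, ht⟩
  have hx : d x 0 = 0 := by
    refine eq_zero_of_norm_deriv_le_univ (y := fun x => d x 0)
      (C := ‖fun a => Complex.I * α * k * lam a‖ + 2 * K) (fun x => hasDerivAt_pi.2 (h.space x))
      (fun x => ?_) h0 x
    refine (pi_norm_le_iff_of_nonneg (by positivity)).2 fun a => ?_
    refine (norm_add_le _ _).trans ?_
    rw [norm_mul, add_mul]
    have h1 := (hA.potBound hα).bound x (d x 0)
    have h2 : 2 * K / (1 + x ^ 2) ≤ 2 * K :=
      div_le_self (by positivity) (by nlinarith [sq_nonneg x])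
    gcongr
    · exact norm_le_pi_norm (fun a => Complex.I * α * k * lam a) a
    · exact norm_le_pi_norm _ a
    · exact (norm_le_pi_norm _ a).trans (h1.trans (by gcongr))
  obtain ⟨C, hC0, hC⟩ := exists_timeMat_bound α K (Complex.I * α * k)
  refine eq_zero_of_norm_deriv_le (y := fun t => d x t) (C := C + C + C) (T := t)
    (fun s hs => hasDerivWithinAt_pi.2 (h.time x s hs)) (fun s hs => ?_) hx t ⟨ht, le_rfl⟩
  refine (pi_norm_le_iff_of_nonneg (by positivity)).2 fun a => ?_
  have key : ∀ b, ‖timeMat α (Complex.I * α * k) (jet (fun y => u y s) (fun y => v y s) x) a b *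
      d x s b‖ ≤ C * ‖d x s‖ := fun b => by
    rw [norm_mul]
    exact mul_le_mul (hC _ ((hadm s hs).norm_jet_le x) a b) (norm_le_pi_norm _ b) (norm_nonneg _) hC0
  rw [mulVec_apply_sum, Fin.sum_univ_three]
  refine norm_add₃_le.trans ?_
  have e0 := key 0
  have e1 := key 1
  have e2 := key 2
  linarith

/-- The factor `e^{θλ_j}` undoes the normalisation of the columns: `θ_x = ζ`, and `θ_t = 4k²ζ =
-4ζ³` because `α² = 1`. -/
lemma isLaxSol_of_column (hα : α ^ 2 = 1) {c : ℝ → ℝ → Fin 3 → ℂ}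
    (hs : IsSpatialSol α (fun y => u y 0) (fun y => v y 0) k j (c 0))
    (ht : ∀ x t, 0 ≤ t → ∀ a, HasDerivWithinAt (fun t => c t x a)
      (timeRhs α k j (jet (fun y => u y t) (fun y => v y t) x) (c t x) a) (Ici 0) t) :
    IsLaxSol α u v k (fun x t => Complex.exp (theta α x t k * lam j) • c t x) := by
  constructor
  · intro x a
    have h1 : HasDerivAt (fun x : ℝ => Complex.exp (theta α x 0 k * lam j))
        (Complex.exp (theta α x 0 k * lam j) * (Complex.I * α * k * lam j)) x := by
      have := ((((hasDerivAt_id x).ofReal_comp.add_const (4 * k ^ 2 * ((0 : ℝ) : ℂ))).const_mul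
        (Complex.I * α * k)).mul_const (lam j)).cexp
      simpa [theta] using this
    refine (h1.mul (hs x a)).congr_deriv ?_
    rw [Matrix.mulVec_smul]
    simp only [Pi.smul_apply, smul_eq_mul, rate]
    ring
  · intro x t h0 a
    have h1 : HasDerivWithinAt (fun t : ℝ => Complex.exp (theta α x t k * lam j))
        (Complex.exp (theta α x t k * lam j) * (Complex.I * α * k * (4 * k ^ 2) * lam j))
        (Ici 0) t := by
      have := (((((hasDerivAt_id t).ofReal_comp.const_mul (4 * k ^ 2)).const_add (x : ℂ)).const_mul
        (Complex.I * α * k)).mul_const (lam j)).cexp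
      simpa [theta] using this.hasDerivWithinAt
    refine (h1.mul (ht x t h0 a)).congr_deriv ?_
    rw [Matrix.mulVec_smul]
    simp only [timeRhs, Pi.add_apply, Pi.smul_apply, smul_eq_mul]
    have hα' : (α : ℂ) ^ 2 = 1 := by exact_mod_cast hα
    have hcube : (Complex.I * α * k) ^ 3 = -(Complex.I * α * k * k ^ 2) := by
      have : (Complex.I * α * k) ^ 3 = Complex.I ^ 2 * (α : ℂ) ^ 2 * (Complex.I * α * k * k ^ 2) := by
        ring
      rw [this, Complex.I_sq, hα']
      ring
    rw [hcube]
    ring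

lemma isLaxSol_leftCol (hsol : IsSchwartzSolution α u₀ v₀ u v) (hα : α ^ 2 = 1)
    (hk : Good α k j) : IsLaxSol α u v k (fun x t => Complex.exp (theta α x t k * lam j) •
      leftCol α (fun y => u y t) (fun y => v y t) k j x) := by
  obtain ⟨K, h⟩ := hsol.exists_admissible_at le_rfl
  exact isLaxSol_of_column hα (c := fun t => leftCol α (fun y => u y t) (fun y => v y t) k j)
    (isSpatialSol_leftCol h hα hk) (fun x t ht a => hasDerivWithinAt_leftCol hsol hα hk ht x a)

lemma isLaxSol_rightCol (hsol : IsSchwartzSolution α u₀ v₀ u v) (hα : α ^ 2 = 1)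
    (hk : Good α (-k) j) : IsLaxSol α u v k (fun x t => Complex.exp (theta α x t k * lam j) •
      rightCol α (fun y => u y t) (fun y => v y t) k j x) := by
  obtain ⟨K, h⟩ := hsol.exists_admissible_at le_rfl
  exact isLaxSol_of_column hα (c := fun t => rightCol α (fun y => u y t) (fun y => v y t) k j)
    (isSpatialSol_rightCol h hα hk) (fun x t ht a => hasDerivWithinAt_rightCol hsol hα hk ht x a)

lemma theta_zero (α : ℝ) (k : ℂ) : theta α 0 0 k = 0 := by simp [theta]

/-- The difference between a normalised column of `J₁` and the combination of normalised columns of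
`J₂` with coefficients from `S` solves the Lax pair. It vanishes at `(0, 0)` by the definition of
`S`, hence everywhere; moving the exponentials across produces the conjugation by `e^{θΛ}`. -/
lemma jostLeft_eq (hsol : IsSchwartzSolution α u₀ v₀ u v) (hα : α ^ 2 = 1) {x t : ℝ} (ht : 0 ≤ t)
    (hk : k.im = 0) :
    jostLeft α (fun y => u y t) (fun y => v y t) x k =
      jostRight α (fun y => u y t) (fun y => v y t) x k *
        expAd (theta α x t k) (scattering α u₀ v₀ k) := by
  obtain ⟨K₀, h₀⟩ := hsol.exists_admissible_init
  ext a j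
  set S := scattering α u₀ v₀ k with hS
  have hR := fun i => isLaxSol_rightCol hsol hα (good_neg_of_im_eq_zero (α := α) hk i)
  have hL := isLaxSol_leftCol hsol hα (good_of_im_eq_zero (α := α) hk j)
  have hd := ((hL.add ((hR 0).smul (-S 0 j))).add ((hR 1).smul (-S 1 j))).add ((hR 2).smul (-S 2 j))
  have h0 := hd.eq_zero hsol hα (by
    funext a
    have := leftCol_zero_eq h₀ hα hk j a
    simp only [hsol.at_zero.1, hsol.at_zero.2, theta_zero, zero_mul, Complex.exp_zero, one_smul,
      Pi.add_apply, Pi.smul_apply, smul_eq_mul, Pi.zero_apply]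
    linear_combination this) (x := x) ht
  have ha := congrFun h0 a
  simp only [Pi.add_apply, Pi.smul_apply, smul_eq_mul, Pi.zero_apply] at ha
  set θ := theta α x t k
  have hee : Complex.exp (-(θ * lam j)) * Complex.exp (θ * lam j) = 1 := by
    rw [← Complex.exp_add]
    simp
  rw [Matrix.mul_apply, Fin.sum_univ_three]
  simp only [expAd, Matrix.mul_diagonal, Matrix.diagonal_mul]
  change leftCol α _ _ k j x a = rightCol α _ _ k 0 x a * _ + rightCol α _ _ k 1 x a * _ +
    rightCol α _ _ k 2 x a * _
  linear_combination Complex.exp (-(θ * lam j)) * ha -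
    leftCol α (fun y => u y t) (fun y => v y t) k j x a * hee

/-- The same propagation argument, off the real axis, using only columns that exist there. The
factor `e^{2θ}` is the ratio of the normalisations for `λ = 1` and `λ = -1`. -/
lemma leftCol_eq_norming (hsol : IsSchwartzSolution α u₀ v₀ u v) (hα : α ^ 2 = 1)
    {x t : ℝ} (ht : 0 ≤ t) (hk : 0 ≤ α * k.im) {c d : ℂ}
    (h0 : ∀ a, leftCol α u₀ v₀ k 0 0 a = c * rightCol α u₀ v₀ k 1 0 a +
      d * rightCol α u₀ v₀ k 2 0 a) (a : Fin 3) :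
    leftCol α (fun y => u y t) (fun y => v y t) k 0 x a = Complex.exp (2 * theta α x t k) *
      (c * rightCol α (fun y => u y t) (fun y => v y t) k 1 x a +
        d * rightCol α (fun y => u y t) (fun y => v y t) k 2 x a) := by
  have hR := fun (i : Fin 3) (hi : i ≠ 0) =>
    isLaxSol_rightCol hsol hα (good_neg_of_ne_zero (α := α) hi hk)
  have hL := isLaxSol_leftCol hsol hα (good_zero (α := α) hk)
  have hd := (hL.add ((hR 1 (by decide)).smul (-c))).add ((hR 2 (by decide)).smul (-d))
  have h1 := hd.eq_zero hsol hα (by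
    funext a
    simp only [hsol.at_zero.1, hsol.at_zero.2, theta_zero, zero_mul, Complex.exp_zero, one_smul,
      Pi.add_apply, Pi.smul_apply, smul_eq_mul, Pi.zero_apply]
    linear_combination h0 a) (x := x) ht
  have ha := congrFun h1 a
  simp only [Pi.add_apply, Pi.smul_apply, smul_eq_mul, Pi.zero_apply] at ha
  set θ := theta α x t k
  have l0 : lam 0 = -1 := rfl
  have l1 : lam 1 = 1 := rfl
  have l2 : lam 2 = 1 := rfl
  rw [l0, l1, l2, mul_one, mul_neg, mul_one] at ha
  have hee : Complex.exp θ * Complex.exp (-θ) = 1 := by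
    rw [← Complex.exp_add]
    simp
  have he2 : Complex.exp (2 * θ) = Complex.exp θ * Complex.exp θ := by
    rw [← Complex.exp_add]
    ring_nf
  rw [he2]
  linear_combination Complex.exp θ * ha -
    leftCol α (fun y => u y t) (fun y => v y t) k 0 x a * hee

end Lax

end CMKdV
end

noncomputable section
namespace CMKdV

/-! ### Asymptotics for large spectral parameters -/

lemma norm_integral_exp_le {m : ℂ} (hm : m.re ≤ 0) {f : ℝ → ℂ} {C : ℝ}
    (hC : ∀ s, ‖f s‖ ≤ C / (1 + s ^ 2)) (x : ℝ) :
    ‖∫ s in Iic x, Complex.exp (m * (x - s)) * f s‖ ≤ C * Real.pi := by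
  have hb : ∀ s : ℝ, 0 ≤ C / (1 + s ^ 2) := fun s => (norm_nonneg _).trans (hC s)
  calc _ ≤ ∫ s in Iic x, C / (1 + s ^ 2) := by
        refine norm_integral_le_of_norm_le (integrable_div_one_add_sq C).integrableOn ?_
        filter_upwards [ae_restrict_mem measurableSet_Iic] with s hs
        rw [norm_mul]
        exact (mul_le_of_le_one_left (norm_nonneg _) (norm_exp_mul_le hm hs)).trans (hC s)
    _ ≤ ∫ s, C / (1 + s ^ 2) :=
        setIntegral_le_integral (integrable_div_one_add_sq C) (ae_of_all _ hb)
    _ = C * Real.pi := by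
        simp only [div_eq_mul_inv, integral_const_mul, integral_univ_inv_one_add_sq]

/-- Integration by parts, obtained by noting that `f` solves `f' = m f + (f' - m f)` and decays, so
it is the Volterra integral of `f' - m f`. -/
lemma mul_integral_exp_eq {m : ℂ} (hm : m.re ≤ 0) {f f' : ℝ → ℂ} {C C' : ℝ}
    (hd : ∀ x, HasDerivAt f (f' x) x) (hf' : Continuous f') (hC : ∀ s, ‖f s‖ ≤ C / (1 + s ^ 2))
    (hC' : ∀ s, ‖f' s‖ ≤ C' / (1 + s ^ 2)) (x : ℝ) :
    m * ∫ s in Iic x, Complex.exp (m * (x - s)) * f s =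
      (∫ s in Iic x, Complex.exp (m * (x - s)) * f' s) - f x := by
  have hfc : Continuous f := continuous_iff_continuousAt.2 fun x => (hd x).continuousAt
  have h := eq_volterra_of_hasDerivAt (μ := fun _ => m) (fun _ => hm)
    (w := fun s _ => f s) (g := fun s _ => f' s - m * f s) (C := C' + ‖m‖ * C) (by fun_prop)
    (fun s => ?_) (fun s a => (hd s).congr_deriv (by ring)) ?_ x
  · have h0 := congrFun h 0
    simp only [volterra] at h0
    have i1 := integrableOn_exp_mul hm hfc hC x
    have i2 := integrableOn_exp_mul hm hf' hC' x
    have e : (fun s : ℝ => Complex.exp (m * (x - s)) * (f' s - m * f s)) = fun s : ℝ =>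
        Complex.exp (m * (x - s)) * f' s - m * (Complex.exp (m * (x - s)) * f s) := by
      funext s
      ring
    rw [e, integral_sub i2 (i1.const_mul m), integral_const_mul] at h0
    linear_combination h0
  · refine (pi_norm_le_iff_of_nonneg ((norm_nonneg _).trans
      ((norm_add_le (f' s) (m * f s)).trans ?_))).2 fun a => (norm_sub_le _ _).trans ?_
    all_goals
      rw [norm_mul, add_div, mul_div_assoc]
      gcongr
      · exact hC' s
      · exact hC s
  · refine tendsto_pi_nhds.2 fun a => squeeze_zero_norm hC ?_
    refine tendsto_const_nhds.div_atTop (tendsto_atTop_add_const_left _ _ ?_)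
    refine (tendsto_pow_atTop (α := ℝ) two_ne_zero).comp tendsto_neg_atBot_atTop |>.congr fun x => ?_
    simp

section Large

variable {K α : ℝ} {p q : ℝ → ℝ} {k : ℂ} {j : Fin 3}

/-- The potential in the row `a ≠ 0`. -/
def potComp (p q : ℝ → ℝ) (a : Fin 3) : ℝ → ℝ := if a = 1 then p else q

lemma pot_mulVec_of_ne_zero {a : Fin 3} (ha : a ≠ 0) (s : ℝ) (v : Fin 3 → ℂ) :
    (pot α p q s).mulVec v a = potComp p q a s * v 0 := by
  fin_cases a
  · exact absurd rfl ha
  · exact potential_mulVec_one α (p s) (q s) v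
  · exact potential_mulVec_two α (p s) (q s) v

lemma leftCol_apply_eq (h : Admissible K p q) (hα : α ^ 2 = 1) (hk : Good α k j) (x : ℝ)
    (a : Fin 3) : leftCol α p q k j x a - basisVec j a =
      ∫ s in Iic x, Complex.exp (rate α k j a * (x - s)) *
        (pot α p q s).mulVec (leftCol α p q k j s) a := by
  have := congrFun ((isVolterraSol_leftCol h hα hk).eq x) a
  rw [this]
  simp [volterra]

lemma norm_pot_mulVec_leftCol_le (h : Admissible K p q) (hα : α ^ 2 = 1) (hk : Good α k j)
    (s : ℝ) (a : Fin 3) : ‖(pot α p q s).mulVec (leftCol α p q k j s) a‖ ≤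
      2 * K * jostBound K / (1 + s ^ 2) :=
  (norm_le_pi_norm _ a).trans ((h.potBound hα).norm_mulVec_le (norm_leftCol_le h hα hk) s)

lemma norm_I_mul (hα : α ^ 2 = 1) (k : ℂ) : ‖Complex.I * α * k‖ = ‖k‖ := by
  have hα1 : |α| = 1 := by rw [← sq_eq_sq₀ (abs_nonneg _) zero_le_one, sq_abs, hα, one_pow]
  simp [hα1]

lemma norm_rate_zero (hα : α ^ 2 = 1) (hj : j ≠ 0) (k : ℂ) : ‖rate α k j 0‖ = 2 * ‖k‖ := by
  have : rate α k j 0 = -2 * (Complex.I * α * k) := by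
    fin_cases j
    · exact absurd rfl hj
    all_goals
      simp [rate, lam]
      ring
  rw [this, norm_mul, norm_I_mul hα]
  simp

lemma rate_zero_left : rate α k 0 j = -rate α k j 0 := by
  simp only [rate]
  ring

lemma norm_ofReal_mul_le {A B : ℝ} {r : ℝ} {z : ℂ} (hr : |r| ≤ A) (hz : ‖z‖ ≤ B) :
    ‖(r : ℂ) * z‖ ≤ A * B := by
  rw [norm_mul, Complex.norm_real, Real.norm_eq_abs]
  exact mul_le_mul hr hz (norm_nonneg _) ((abs_nonneg _).trans hr)

lemma Admissible.potComp_bound (h : Admissible K p q) (a : Fin 3) {b : ℕ} (hb : b ≤ 3) (x : ℝ) :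
    |iteratedDeriv b (potComp p q a) x| ≤ K / (1 + x ^ 2) := by
  unfold potComp
  split_ifs
  · exact h.bound_left b hb x
  · exact h.bound_right b hb x

lemma Admissible.potComp_smooth (h : Admissible K p q) (a : Fin 3) :
    ContDiff ℝ (⊤ : ℕ∞) (potComp p q a) := by
  unfold potComp
  split_ifs
  · exact h.smooth_left
  · exact h.smooth_right

/-- A constant for the first order asymptotics of the Jost columns. -/
def asymptoticBound (K : ℝ) : ℝ :=
  (2 * K * jostBound K + 2 * K * K * jostBound K) * Real.pi + 2 * K * jostBound K

lemma asymptoticBound_nonneg (hK : 0 ≤ K) : 0 ≤ asymptoticBound K := by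
  have := jostBound_nonneg K
  have := Real.pi_pos
  unfold asymptoticBound
  positivity

/-- The integrand is a potential times the top entry of the column. That entry has zero exponent, so
its derivative does not grow with `k`, and one integration by parts gains the factor `1 / k`. -/
lemma norm_leftCol_zero_off_le (h : Admissible K p q) (hα : α ^ 2 = 1) (hk : 0 ≤ α * k.im)
    {a : Fin 3} (ha : a ≠ 0) (x : ℝ) :
    2 * ‖k‖ * ‖leftCol α p q k 0 x a‖ ≤ asymptoticBound K := by
  have hg := good_zero (α := α) hk
  have hK := h.nonneg
  have hB := jostBound_nonneg K
  set B := jostBound K with hBdef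
  set y := leftCol α p q k 0 with hy
  have hyb : ∀ x a, ‖y x a‖ ≤ B := fun x a => norm_leftCol_apply_le h hα hg x a
  have hyd := isSpatialSol_leftCol h hα hg
  set m := rate α k 0 a with hm
  have hy0 : ∀ x, HasDerivAt (fun x => y x 0) ((pot α p q x).mulVec (y x) 0) x := fun x => by
    simpa [rate_self] using hyd x 0
  have hw := hasDerivAt_ofReal_iteratedDeriv (h.potComp_smooth a) 0
  simp only [iteratedDeriv_zero, zero_add] at hw
  have hwb : ∀ s, |potComp p q a s| ≤ K / (1 + s ^ 2) := fun s => by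
    simpa using h.potComp_bound a (b := 0) (by norm_num) s
  have hd := fun x => (hw x).mul (hy0 x)
  have hyc : Continuous y := continuous_of_hasDerivAt hyd
  have hwc : Continuous (iteratedDeriv 1 (potComp p q a)) :=
    continuous_iff_continuousAt.2 fun x =>
      (hasDerivAt_iteratedDeriv (h.potComp_smooth a) 1 x).continuousAt
  have hw0c : Continuous (potComp p q a) := (h.potComp_smooth a).continuous
  have hQc := (h.potBound hα).continuous_mulVec hyc
  have hQb := fun s => norm_pot_mulVec_leftCol_le h hα hg s 0
  have hC : ∀ s, ‖(potComp p q a s : ℂ) * y s 0‖ ≤ 2 * K * B / (1 + s ^ 2) := fun s => by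
    rw [← pot_mulVec_of_ne_zero (α := α) ha]
    exact norm_pot_mulVec_leftCol_le h hα hg s a
  have hC' : ∀ s, ‖((iteratedDeriv 1 (potComp p q a) s : ℝ) : ℂ) * y s 0 +
      (potComp p q a s : ℂ) * (pot α p q s).mulVec (y s) 0‖ ≤
      (2 * K * B + 2 * K * K * B) / (1 + s ^ 2) := fun s => by
    have e1 := norm_ofReal_mul_le (h.potComp_bound a (b := 1) (by norm_num) s) (hyb s 0)
    have hle : 2 * K * B / (1 + s ^ 2) ≤ 2 * K * B :=
      div_le_self (by positivity) (by nlinarith [sq_nonneg s])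
    have e2 := norm_ofReal_mul_le (hwb s) ((hQb s).trans hle)
    refine (norm_add_le _ _).trans ((add_le_add e1 e2).trans ?_)
    have : K / (1 + s ^ 2) * B + K / (1 + s ^ 2) * (2 * K * B) =
      (K * B + 2 * K * K * B) / (1 + s ^ 2) := by ring
    rw [this]
    gcongr
    nlinarith [mul_nonneg hK hB]
  have key := mul_integral_exp_eq (hg a) hd (by fun_prop) hC hC' x
  have hi := norm_integral_exp_le (hg a) hC' x
  have heq := leftCol_apply_eq h hα hg x a
  simp only [pot_mulVec_of_ne_zero ha] at heq
  have hbv : basisVec 0 a = 0 := Matrix.one_apply_ne ha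
  rw [hbv, sub_zero] at heq
  change m * (∫ s in Iic x, Complex.exp (m * (x - s)) * ((potComp p q a s : ℂ) * y s 0)) = _ at key
  rw [← heq] at key
  have hnorm : ‖m‖ = 2 * ‖k‖ := by rw [hm, rate_zero_left, norm_neg, norm_rate_zero hα ha]
  rw [← hnorm, ← norm_mul, key]
  refine (norm_sub_le _ _).trans (add_le_add hi ((hC x).trans ?_))
  exact div_le_self (by positivity) (by nlinarith [sq_nonneg x])

/-- The deviation from 1 is an integral of the potentials against the off-diagonal entries, which
are already `O(1 / k)`. The factor `‖k‖` is absorbed under the integral sign. -/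
lemma norm_leftCol_zero_diag_le (h : Admissible K p q) (hα : α ^ 2 = 1) (hk : 0 ≤ α * k.im)
    (x : ℝ) : ‖k‖ * ‖leftCol α p q k 0 x 0 - 1‖ ≤ K * asymptoticBound K * Real.pi := by
  have hg := good_zero (α := α) hk
  have hK := h.nonneg
  have hA := asymptoticBound_nonneg hK
  have hα1 : |α| = 1 := by rw [← sq_eq_sq₀ (abs_nonneg _) zero_le_one, sq_abs, hα, one_pow]
  set y := leftCol α p q k 0 with hy
  have heq := leftCol_apply_eq h hα hg x 0
  have hbv : basisVec 0 0 = 1 := Matrix.one_apply_eq 0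
  rw [hbv] at heq
  have hb : ∀ s, ‖(‖k‖ : ℂ) * (pot α p q s).mulVec (y s) 0‖ ≤ K * asymptoticBound K / (1 + s ^ 2) := by
    intro s
    rw [pot, potential_mulVec_zero, mul_left_comm, norm_mul, Complex.norm_real, Real.norm_eq_abs, hα1,
      one_mul, mul_add]
    have h1 := norm_leftCol_zero_off_le h hα hk (show (1 : Fin 3) ≠ 0 by decide) s
    have h2 := norm_leftCol_zero_off_le h hα hk (show (2 : Fin 3) ≠ 0 by decide) s
    have e1 := norm_ofReal_mul_le (z := (‖k‖ : ℂ) * y s 1) (B := asymptoticBound K / 2) (h.abs_left s)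
      (by rw [norm_mul, Complex.norm_real, norm_norm]; linarith)
    have e2 := norm_ofReal_mul_le (z := (‖k‖ : ℂ) * y s 2) (B := asymptoticBound K / 2) (h.abs_right s)
      (by rw [norm_mul, Complex.norm_real, norm_norm]; linarith)
    rw [mul_left_comm, mul_left_comm (‖k‖ : ℂ)]
    refine (norm_add_le _ _).trans ((add_le_add e1 e2).trans (le_of_eq ?_))
    ring
  have := norm_integral_exp_le (hg 0) hb x
  simp only [mul_left_comm _ (‖k‖ : ℂ), integral_const_mul] at this
  rw [← heq, norm_mul, Complex.norm_real, norm_norm] at this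
  exact this


lemma hasDerivAt_combination {w₁ w₂ w₁' w₂' : ℝ → ℝ} (h : Admissible K p q) (hα : α ^ 2 = 1)
    (hj : j ≠ 0) (hk : Good α k j) {x : ℝ} (h₁ : HasDerivAt (fun x => (w₁ x : ℂ)) (w₁' x : ℂ) x)
    (h₂ : HasDerivAt (fun x => (w₂ x : ℂ)) (w₂' x : ℂ) x) :
    HasDerivAt
      (fun x => (α : ℂ) * (w₁ x * leftCol α p q k j x 1 + w₂ x * leftCol α p q k j x 2))
      (α * (w₁' x * leftCol α p q k j x 1 + w₂' x * leftCol α p q k j x 2) +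
        α * (w₁ x * p x + w₂ x * q x) * leftCol α p q k j x 0) x := by
  have hyd := isSpatialSol_leftCol h hα hk
  have d1 : HasDerivAt (fun x => leftCol α p q k j x 1) (p x * leftCol α p q k j x 0) x := by
    simpa [rate_eq_zero_of_ne hj (show (1 : Fin 3) ≠ 0 by decide), pot, potential_mulVec_one]
      using hyd x 1
  have d2 : HasDerivAt (fun x => leftCol α p q k j x 2) (q x * leftCol α p q k j x 0) x := by
    simpa [rate_eq_zero_of_ne hj (show (2 : Fin 3) ≠ 0 by decide), pot, potential_mulVec_two]
      using hyd x 2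
  exact (((h₁.mul d1).add (h₂.mul d2)).const_mul (α : ℂ)).congr_deriv (by ring)

lemma norm_combination_le {w₁ w₂ : ℝ → ℝ} {A : ℝ} (h : Admissible K p q) (hα : α ^ 2 = 1)
    (hk : Good α k j) {s : ℝ} (h₁ : |w₁ s| ≤ A / (1 + s ^ 2)) (h₂ : |w₂ s| ≤ A / (1 + s ^ 2)) :
    ‖(α : ℂ) * (w₁ s * leftCol α p q k j s 1 + w₂ s * leftCol α p q k j s 2)‖ ≤
      2 * A * jostBound K / (1 + s ^ 2) := by
  have hα1 : |α| = 1 := by rw [← sq_eq_sq₀ (abs_nonneg _) zero_le_one, sq_abs, hα, one_pow]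
  rw [norm_mul, Complex.norm_real, Real.norm_eq_abs, hα1, one_mul]
  refine (norm_add_le _ _).trans ((add_le_add
    (norm_ofReal_mul_le h₁ (norm_leftCol_apply_le h hα hk s 1))
    (norm_ofReal_mul_le h₂ (norm_leftCol_apply_le h hα hk s 2))).trans (le_of_eq ?_))
  ring

lemma norm_quadratic_mul_le {w₁ w₂ : ℝ → ℝ} {A B : ℝ} (h : Admissible K p q) (hα : α ^ 2 = 1)
    {s : ℝ} (h₁ : |w₁ s| ≤ A / (1 + s ^ 2)) (h₂ : |w₂ s| ≤ A / (1 + s ^ 2)) {z : ℂ}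
    (hz : ‖z‖ ≤ B) : ‖(α : ℂ) * (w₁ s * p s + w₂ s * q s) * z‖ ≤ 2 * A * K * B / (1 + s ^ 2) := by
  have hα1 : |α| = 1 := by rw [← sq_eq_sq₀ (abs_nonneg _) zero_le_one, sq_abs, hα, one_pow]
  have hK := h.nonneg
  have hs : 1 ≤ 1 + s ^ 2 := by nlinarith [sq_nonneg s]
  have hp := (h.abs_left s).trans (div_le_self hK hs)
  have hq := (h.abs_right s).trans (div_le_self hK hs)
  have e : ‖(w₁ s * p s + w₂ s * q s : ℂ)‖ ≤ A / (1 + s ^ 2) * K + A / (1 + s ^ 2) * K :=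
    (norm_add_le _ _).trans (add_le_add (norm_ofReal_mul_le h₁ (by simpa using hp))
      (norm_ofReal_mul_le h₂ (by simpa using hq)))
  rw [norm_mul, norm_mul, Complex.norm_real, Real.norm_eq_abs, hα1, one_mul]
  refine (mul_le_mul e hz (norm_nonneg _) ((norm_nonneg _).trans e)).trans (le_of_eq ?_)
  ring

/-- The lower block entries have zero exponent, so integrating by parts only differentiates the
potentials or produces the top entry. The case `b = 0` gives the leading term, and `b = 1` shows
that the next integral is again `O(1 / k)`. -/
lemma exists_norm_rate_mul_integral_le (hα : α ^ 2 = 1) (h : Admissible K p q) {b : ℕ}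
    (hb : b + 1 ≤ 3) : ∃ C, 0 ≤ C ∧ ∀ (k : ℂ) (j : Fin 3), j ≠ 0 → Good α k j → ∀ x : ℝ,
      rate α k j 0 * (∫ s in Iic x, Complex.exp (rate α k j 0 * (x - s)) *
        (α * ((iteratedDeriv b p s : ℝ) * leftCol α p q k j s 1 +
          (iteratedDeriv b q s : ℝ) * leftCol α p q k j s 2))) =
        (∫ s in Iic x, Complex.exp (rate α k j 0 * (x - s)) *
          (α * ((iteratedDeriv (b + 1) p s : ℝ) * leftCol α p q k j s 1 +
            (iteratedDeriv (b + 1) q s : ℝ) * leftCol α p q k j s 2) +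
          α * ((iteratedDeriv b p s : ℝ) * p s + (iteratedDeriv b q s : ℝ) * q s) *
            leftCol α p q k j s 0)) -
        α * ((iteratedDeriv b p x : ℝ) * leftCol α p q k j x 1 +
          (iteratedDeriv b q x : ℝ) * leftCol α p q k j x 2) ∧
      ‖rate α k j 0 * (∫ s in Iic x, Complex.exp (rate α k j 0 * (x - s)) *
        (α * ((iteratedDeriv b p s : ℝ) * leftCol α p q k j s 1 +
          (iteratedDeriv b q s : ℝ) * leftCol α p q k j s 2)))‖ ≤ C := by
  have hK := h.nonneg
  have hB := jostBound_nonneg K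
  have hpi := Real.pi_pos
  refine ⟨(2 * K * jostBound K + 2 * K * K * jostBound K) * Real.pi + 2 * K * jostBound K,
    by positivity, fun k j hj hk x => ?_⟩
  have cp := fun b => (continuous_iff_continuousAt.2 fun x =>
      (hasDerivAt_iteratedDeriv h.smooth_left b x).continuousAt)
  have cq := fun b => (continuous_iff_continuousAt.2 fun x =>
      (hasDerivAt_iteratedDeriv h.smooth_right b x).continuousAt)
  have hyc : Continuous (leftCol α p q k j) := continuous_of_hasDerivAt (isSpatialSol_leftCol h hα hk)
  have cp0 := h.smooth_left.continuous
  have cq0 := h.smooth_right.continuous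
  have c1 := cp (b + 1)
  have c2 := cq (b + 1)
  have c3 := cp b
  have c4 := cq b
  have hb' : b ≤ 3 := by lia
  have hC := fun s => norm_combination_le (w₁ := iteratedDeriv b p) (w₂ := iteratedDeriv b q) h hα hk
    (h.bound_left b hb' s) (h.bound_right b hb' s)
  have hC' : ∀ s : ℝ, ‖(α : ℂ) * ((iteratedDeriv (b + 1) p s : ℝ) * leftCol α p q k j s 1 +
            (iteratedDeriv (b + 1) q s : ℝ) * leftCol α p q k j s 2) +
          α * ((iteratedDeriv b p s : ℝ) * p s + (iteratedDeriv b q s : ℝ) * q s) *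
            leftCol α p q k j s 0‖ ≤
        (2 * K * jostBound K + 2 * K * K * jostBound K) / (1 + s ^ 2) := fun s => by
    rw [add_div]
    exact (norm_add_le _ _).trans (add_le_add
      (norm_combination_le h hα hk (h.bound_left _ hb s) (h.bound_right _ hb s))
      (norm_quadratic_mul_le h hα (h.bound_left b hb' s) (h.bound_right b hb' s)
        (norm_leftCol_apply_le h hα hk s 0)))
  have key := mul_integral_exp_eq (hk 0) (fun x => hasDerivAt_combination h hα hj hk
    (hasDerivAt_ofReal_iteratedDeriv h.smooth_left b x)
    (hasDerivAt_ofReal_iteratedDeriv h.smooth_right b x)) (by fun_prop) hC hC' x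
  refine ⟨key, ?_⟩
  rw [key]
  refine (norm_sub_le _ _).trans (add_le_add (norm_integral_exp_le (hk 0) hC' x) ((hC x).trans ?_))
  exact div_le_self (by positivity) (by nlinarith [sq_nonneg x])

lemma leftCol_ne_zero_eq (h : Admissible K p q) (hα : α ^ 2 = 1) (hj : j ≠ 0) (hk : Good α k j)
    (x : ℝ) : leftCol α p q k j x 0 = ∫ s in Iic x, Complex.exp (rate α k j 0 * (x - s)) *
        (α * ((iteratedDeriv 0 p s : ℝ) * leftCol α p q k j s 1 +
          (iteratedDeriv 0 q s : ℝ) * leftCol α p q k j s 2)) := by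
  have := leftCol_apply_eq h hα hk x 0
  have hbv : basisVec j 0 = 0 := Matrix.one_apply_ne hj.symm
  rw [hbv, sub_zero] at this
  simpa only [pot, potential_mulVec_zero, iteratedDeriv_zero] using this

/-- The off-diagonal entry of the last two left columns is `O(1 / k)`. -/
lemma exists_norm_leftCol_ne_off_le (h : Admissible K p q) (hα : α ^ 2 = 1) :
    ∃ C, 0 ≤ C ∧ ∀ (k : ℂ) (j : Fin 3), j ≠ 0 → Good α k j → ∀ x : ℝ,
      ‖k‖ * ‖leftCol α p q k j x 0‖ ≤ C := by
  obtain ⟨C, hC, H⟩ := exists_norm_rate_mul_integral_le hα h (b := 0) (by norm_num)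
  refine ⟨C, hC, fun k j hj hk x => ?_⟩
  have := (H k j hj hk x).2
  rw [← leftCol_ne_zero_eq h hα hj hk, norm_mul, norm_rate_zero hα hj] at this
  nlinarith [mul_nonneg (norm_nonneg k) (norm_nonneg (leftCol α p q k j x 0))]

lemma exists_norm_leftCol_ne_diag_le (h : Admissible K p q) (hα : α ^ 2 = 1) :
    ∃ C, 0 ≤ C ∧ ∀ (k : ℂ) (j a : Fin 3), j ≠ 0 → a ≠ 0 → Good α k j → ∀ x : ℝ,
      ‖k‖ * ‖leftCol α p q k j x a - basisVec j a‖ ≤ C := by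
  obtain ⟨C, hC, H⟩ := exists_norm_leftCol_ne_off_le h hα
  have hK := h.nonneg
  have hpi := Real.pi_pos
  refine ⟨K * C * Real.pi, by positivity, fun k j a hj ha hk x => ?_⟩
  have hb : ∀ s, ‖(‖k‖ : ℂ) * (pot α p q s).mulVec (leftCol α p q k j s) a‖ ≤
      K * C / (1 + s ^ 2) := by
    intro s
    rw [pot_mulVec_of_ne_zero ha, mul_left_comm]
    refine (norm_ofReal_mul_le (B := C) (by simpa using h.potComp_bound a (b := 0) (by norm_num) s) ?_).trans
      (le_of_eq (by ring))
    rw [norm_mul, Complex.norm_real, norm_norm]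
    exact H k j hj hk s
  have := norm_integral_exp_le (hk a) hb x
  simp only [mul_left_comm _ (‖k‖ : ℂ), integral_const_mul] at this
  rw [← leftCol_apply_eq h hα hk, norm_mul, Complex.norm_real, norm_norm] at this
  exact this

lemma integrableOn_combination (h : Admissible K p q) (hα : α ^ 2 = 1) (hk : Good α k j)
    {w₁ w₂ : ℝ → ℝ} (c₁ : Continuous w₁) (c₂ : Continuous w₂)
    (h₁ : ∀ s, |w₁ s| ≤ K / (1 + s ^ 2)) (h₂ : ∀ s, |w₂ s| ≤ K / (1 + s ^ 2)) (x : ℝ) :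
    IntegrableOn (fun s : ℝ => Complex.exp (rate α k j 0 * (x - s)) *
        (α * (w₁ s * leftCol α p q k j s 1 + w₂ s * leftCol α p q k j s 2))) (Iic x) := by
  have hyc : Continuous (leftCol α p q k j) := continuous_of_hasDerivAt (isSpatialSol_leftCol h hα hk)
  exact integrableOn_exp_mul (hk 0) (by fun_prop)
    (fun s => norm_combination_le h hα hk (h₁ s) (h₂ s)) x

lemma eq_one_or_two (hj : j ≠ 0) : j = 1 ∨ j = 2 := by
  revert j
  decide

lemma potComp_eq (hj : j ≠ 0) (x : ℝ) :
    (potComp p q j x : ℂ) = p x * basisVec j 1 + q x * basisVec j 2 := by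
  obtain rfl | rfl := eq_one_or_two hj <;> simp [potComp, basisVec]

/-- The leading term of the off-diagonal entry of the last two left columns. -/
lemma exists_norm_leftCol_ne_off_sub_le (h : Admissible K p q) (hα : α ^ 2 = 1) :
    ∃ C, 0 ≤ C ∧ ∀ (k : ℂ) (j : Fin 3), j ≠ 0 → Good α k j → ∀ x : ℝ,
      ‖k‖ * ‖2 * Complex.I * (k * leftCol α p q k j x 0) - potComp p q j x‖ ≤ C := by
  obtain ⟨C₀, hC₀, H₀⟩ := exists_norm_leftCol_ne_off_le h hα
  obtain ⟨Cd, hCd, Hd⟩ := exists_norm_leftCol_ne_diag_le h hα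
  obtain ⟨C₁, hC₁, H₁⟩ := exists_norm_rate_mul_integral_le hα h (b := 0) (by norm_num)
  obtain ⟨C₂, hC₂, H₂⟩ := exists_norm_rate_mul_integral_le hα h (b := 1) (by norm_num)
  have hK := h.nonneg
  have hpi := Real.pi_pos
  refine ⟨C₂ + 2 * K * K * C₀ * Real.pi + (K * Cd + K * Cd), by positivity, fun k j hj hk x => ?_⟩
  set y := leftCol α p q k j with hy
  have hyc : Continuous y := continuous_of_hasDerivAt (isSpatialSol_leftCol h hα hk)
  have hα1 : |α| = 1 := by rw [← sq_eq_sq₀ (abs_nonneg _) zero_le_one, sq_abs, hα, one_pow]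
  have cp0 := h.smooth_left.continuous
  have cq0 := h.smooth_right.continuous
  have cp : Continuous (iteratedDeriv 1 p) := (continuous_iff_continuousAt.2 fun x =>
      (hasDerivAt_iteratedDeriv h.smooth_left 1 x).continuousAt)
  have cq : Continuous (iteratedDeriv 1 q) := (continuous_iff_continuousAt.2 fun x =>
      (hasDerivAt_iteratedDeriv h.smooth_right 1 x).continuousAt)
  have key := (H₁ k j hj hk x).1
  rw [← leftCol_ne_zero_eq h hα hj hk] at key
  simp only [iteratedDeriv_zero, zero_add, mul_add (Complex.exp _)] at key
  have hb1 : ∀ s, ‖(α : ℂ) * (p s * p s + q s * q s) * y s 0‖ ≤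
      2 * K * K * jostBound K / (1 + s ^ 2) := fun s =>
    norm_quadratic_mul_le h hα (h.abs_left s) (h.abs_right s) (norm_leftCol_apply_le h hα hk s 0)
  have hb2 : ∀ s, ‖(‖k‖ : ℂ) * ((α : ℂ) * (p s * p s + q s * q s) * y s 0)‖ ≤
      2 * K * K * C₀ / (1 + s ^ 2) := fun s => by
    rw [mul_left_comm]
    refine norm_quadratic_mul_le h hα (h.abs_left s) (h.abs_right s) ?_
    rw [norm_mul, Complex.norm_real, norm_norm]
    exact H₀ k j hj hk s
  rw [integral_add (integrableOn_combination h hα hk cp cq (h.bound_left 1 (by norm_num))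
    (h.bound_right 1 (by norm_num)) x) (integrableOn_exp_mul (hk 0) (by fun_prop) hb1 x)] at key
  have e2 := norm_integral_exp_le (hk 0) hb2 x
  simp only [mul_left_comm _ (‖k‖ : ℂ), integral_const_mul] at e2
  rw [norm_mul, Complex.norm_real, norm_norm] at e2
  have e1 := (H₂ k j hj hk x).2
  rw [norm_mul, norm_rate_zero hα hj] at e1
  set I₁ := ∫ s in Iic x, Complex.exp (rate α k j 0 * (x - s)) *
          (α * ((iteratedDeriv 1 p s : ℝ) * y s 1 + (iteratedDeriv 1 q s : ℝ) * y s 2))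
  set I₂ := ∫ s in Iic x, Complex.exp (rate α k j 0 * (x - s)) *
          (α * (p s * p s + q s * q s) * y s 0)
  have hrate : rate α k j 0 = -2 * (Complex.I * α * k) := by
    fin_cases j
    · exact absurd rfl hj
    all_goals
      simp [rate, lam]
      ring
  have hαc : (α : ℂ) * α = 1 := by exact_mod_cast (by rw [← sq, hα] : α * α = 1)
  -- Multiplying the integration by parts formula by `-α` leaves three remainders, each `O(1 / k)`:
  -- `I₁` by a second integration by parts, `I₂` because the top entry is `O(1 / k)`, and the
  -- bracket by the estimate for the lower block.
  have hfin : 2 * Complex.I * (k * y x 0) - potComp p q j x =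
      -(α * I₁) - α * I₂ + (p x * (y x 1 - basisVec j 1) + q x * (y x 2 - basisVec j 2)) := by
    rw [potComp_eq hj]
    rw [hrate] at key
    linear_combination (-(α : ℂ)) * key + (-2 * Complex.I * k * y x 0 + (p x * y x 1 + q x * y x 2)) * hαc
  have n1 : ∀ a : Fin 3, a ≠ 0 → ∀ r : ℝ, |r| ≤ K / (1 + x ^ 2) →
      ‖k‖ * ‖(r : ℂ) * (y x a - basisVec j a)‖ ≤ K * Cd := fun a ha r hr => by
    have hr' := hr.trans (div_le_self hK (by nlinarith [sq_nonneg x]))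
    rw [norm_mul, Complex.norm_real, Real.norm_eq_abs, mul_left_comm]
    exact mul_le_mul hr' (Hd k j a hj ha hk x) (by positivity) hK
  have hm : ∀ z : ℂ, ‖(α : ℂ) * z‖ = ‖z‖ := fun z => by
    rw [norm_mul, Complex.norm_real, Real.norm_eq_abs, hα1, one_mul]
  have f1 : ‖k‖ * ‖(α : ℂ) * I₁‖ ≤ C₂ := by
    rw [hm]
    nlinarith [mul_nonneg (norm_nonneg k) (norm_nonneg I₁)]
  have f2 : ‖k‖ * ‖(α : ℂ) * I₂‖ ≤ 2 * K * K * C₀ * Real.pi := by rwa [hm]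
  rw [hfin]
  refine (mul_le_mul_of_nonneg_left ((norm_add_le _ _).trans (add_le_add ((norm_sub_le _ _).trans
    (add_le_add (norm_neg _).le le_rfl)) (norm_add_le _ _))) (norm_nonneg k)).trans ?_
  rw [mul_add, mul_add, mul_add]
  exact add_le_add (add_le_add f1 f2) (add_le_add (n1 1 (by decide) _ (h.abs_left x))
    (n1 2 (by decide) _ (h.abs_right x)))

end Large

end CMKdV
end

noncomputable section
namespace CMKdV

/-! ### Limits of the Jost columns and of the sectional matrix at infinity -/

/-- The filter of `k → ∞` within `D`. -/
def inftyWithin (D : Set ℂ) : Filter ℂ := Bornology.cobounded ℂ ⊓ 𝓟 D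

lemma tendsto_inftyWithin {D : Set ℂ} {f : ℂ → ℂ} {c : ℂ} {C : ℝ}
    (h : ∀ k ∈ D, ‖k‖ * ‖f k - c‖ ≤ C) : Tendsto f (inftyWithin D) (𝓝 c) := by
  rw [tendsto_iff_norm_sub_tendsto_zero]
  have hn : Tendsto (fun k : ℂ => ‖k‖) (inftyWithin D) atTop :=
    tendsto_norm_cobounded_atTop.mono_left inf_le_left
  refine squeeze_zero' (Eventually.of_forall fun k => norm_nonneg _) ?_
    (tendsto_const_nhds.div_atTop hn : Tendsto (fun k : ℂ => C / ‖k‖) (inftyWithin D) (𝓝 0))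
  filter_upwards [hn.eventually_gt_atTop 0, mem_inf_of_right (mem_principal_self D)] with k hk hD
  rw [le_div_iff₀ hk, mul_comm]
  exact h k hD

lemma atInfty_eq {α : ℝ} (hα : α ^ 2 = 1) :
    atInfty = inftyWithin (Dplus α) ⊔ inftyWithin (Dminus α) := by
  have : {k : ℂ | k.im ≠ 0} = Dplus α ∪ Dminus α := by
    ext k
    simp only [mem_ofPred_eq, Dplus, Dminus, mem_union]
    rw [← mul_ne_zero_iff_left (b := k.im) (ne_zero_of_sq_eq_one hα), ne_iff_lt_or_gt, or_comm]
  rw [atInfty, inftyWithin, inftyWithin, this, ← sup_principal, inf_sup_left]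

section Columns

variable {K α : ℝ} {p q : ℝ → ℝ} {i j : Fin 3}

lemma tendsto_leftCol_zero (h : Admissible K p q) (hα : α ^ 2 = 1) (x : ℝ) (a : Fin 3) :
    Tendsto (fun k => leftCol α p q k 0 x a) (inftyWithin (Dplus α)) (𝓝 (basisVec 0 a)) := by
  by_cases ha : a = 0
  · subst ha
    refine tendsto_inftyWithin (fun k hk => ?_) (C := K * asymptoticBound K * Real.pi)
    simpa [basisVec] using norm_leftCol_zero_diag_le h hα (le_of_lt hk) x
  · refine tendsto_inftyWithin (fun k hk => ?_) (C := asymptoticBound K)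
    have := norm_leftCol_zero_off_le h hα (le_of_lt hk) ha x
    simp only [basisVec, Matrix.one_apply_ne ha, sub_zero]
    nlinarith [mul_nonneg (norm_nonneg k) (norm_nonneg (leftCol α p q k 0 x a))]

lemma tendsto_leftCol_of_ne_zero (h : Admissible K p q) (hα : α ^ 2 = 1) (hj : j ≠ 0) (x : ℝ)
    (a : Fin 3) :
    Tendsto (fun k => leftCol α p q k j x a) (inftyWithin (Dminus α)) (𝓝 (basisVec j a)) := by
  by_cases ha : a = 0
  · subst ha
    obtain ⟨C, -, H⟩ := exists_norm_leftCol_ne_off_le h hα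
    refine tendsto_inftyWithin (fun k hk => ?_) (C := C)
    simpa [basisVec, Matrix.one_apply_ne hj.symm] using H k j hj (good_of_ne_zero hj (le_of_lt hk)) x
  · obtain ⟨C, -, H⟩ := exists_norm_leftCol_ne_diag_le h hα
    exact tendsto_inftyWithin (fun k hk => H k j a hj ha (good_of_ne_zero hj (le_of_lt hk)) x)

lemma tendsto_mul_leftCol (h : Admissible K p q) (hα : α ^ 2 = 1) (hj : j ≠ 0) (x : ℝ) :
    Tendsto (fun k => 2 * Complex.I * (k * leftCol α p q k j x 0)) (inftyWithin (Dminus α))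
      (𝓝 (potComp p q j x)) := by
  obtain ⟨C, -, H⟩ := exists_norm_leftCol_ne_off_sub_le h hα
  exact tendsto_inftyWithin (fun k hk => H k j hj (good_of_ne_zero hj (le_of_lt hk)) x)

lemma tendsto_neg_inftyWithin (α : ℝ) :
    Tendsto (fun k : ℂ => -k) (inftyWithin (Dplus α)) (inftyWithin (Dminus α)) ∧
      Tendsto (fun k : ℂ => -k) (inftyWithin (Dminus α)) (inftyWithin (Dplus α)) := by
  refine ⟨tendsto_inf.2 ⟨?_, ?_⟩, tendsto_inf.2 ⟨?_, ?_⟩⟩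
  · exact tendsto_neg_cobounded.mono_left inf_le_left
  · refine (tendsto_principal.2 ?_)
    filter_upwards [mem_inf_of_right (mem_principal_self (Dplus α))] with k hk
    simpa [Dplus, Dminus] using hk
  · exact tendsto_neg_cobounded.mono_left inf_le_left
  · refine (tendsto_principal.2 ?_)
    filter_upwards [mem_inf_of_right (mem_principal_self (Dminus α))] with k hk
    simpa [Dplus, Dminus] using hk

lemma tendsto_rightCol_zero (h : Admissible K p q) (hα : α ^ 2 = 1) (x : ℝ) (a : Fin 3) :
    Tendsto (fun k => rightCol α p q k 0 x a) (inftyWithin (Dminus α)) (𝓝 (basisVec 0 a)) := by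
  refine ((tendsto_leftCol_zero h.reflect hα (-x) a).comp (tendsto_neg_inftyWithin α).2).congr' ?_
  filter_upwards [mem_inf_of_right (mem_principal_self (Dminus α))] with k hk
  rw [leftCol_reflect h hα (good_zero (by simpa [Dminus] using le_of_lt hk)), Function.comp]

lemma tendsto_rightCol_of_ne_zero (h : Admissible K p q) (hα : α ^ 2 = 1) (hj : j ≠ 0) (x : ℝ)
    (a : Fin 3) :
    Tendsto (fun k => rightCol α p q k j x a) (inftyWithin (Dplus α)) (𝓝 (basisVec j a)) := by
  refine ((tendsto_leftCol_of_ne_zero h.reflect hα hj (-x) a).comp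
    (tendsto_neg_inftyWithin α).1).congr' ?_
  filter_upwards [mem_inf_of_right (mem_principal_self (Dplus α))] with k hk
  rw [leftCol_reflect h hα (good_neg_of_ne_zero hj (le_of_lt hk)), Function.comp]

lemma tendsto_mul_rightCol (h : Admissible K p q) (hα : α ^ 2 = 1) (hj : j ≠ 0) (x : ℝ) :
    Tendsto (fun k => 2 * Complex.I * (k * rightCol α p q k j x 0)) (inftyWithin (Dplus α))
      (𝓝 (potComp p q j x)) := by
  -- The sign in `reflect` compensates the sign of `k ↦ -k` in the factor `k`.
  have e : ((potComp p q j x : ℝ) : ℂ) = -((potComp (reflect p) (reflect q) j (-x) : ℝ) : ℂ) := by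
    unfold potComp
    split_ifs <;> simp [reflect]
  rw [e]
  refine ((tendsto_mul_leftCol h.reflect hα hj (-x)).comp
    (tendsto_neg_inftyWithin α).1).neg.congr' ?_
  filter_upwards [mem_inf_of_right (mem_principal_self (Dplus α))] with k hk
  rw [leftCol_reflect h hα (good_neg_of_ne_zero hj (le_of_lt hk)), Function.comp]
  ring

/-- The estimate for the diagonal entry is uniform in `x`, so it survives the limit `x → +∞` that
defines `s₁₁`. -/
lemma tendsto_scattering_zero (h : Admissible K p q) (hα : α ^ 2 = 1) :
    Tendsto (fun k => scattering α p q k 0 0) (inftyWithin (Dplus α)) (𝓝 1) := by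
  refine tendsto_inftyWithin (fun k hk => ?_) (C := K * asymptoticBound K * Real.pi)
  have hk' : 0 ≤ α * k.im := le_of_lt hk
  rw [scattering_zero_zero h hα hk']
  refine le_of_tendsto (((tendsto_leftCol_atTop h hα (good_zero hk')
    (rate_self α k 0)).sub_const 1).norm.const_mul ‖k‖) (Eventually.of_forall fun x => ?_)
  exact norm_leftCol_zero_diag_le h hα hk' x

lemma tendsto_scattering_block (h : Admissible K p q) (hα : α ^ 2 = 1) (hi : i ≠ 0) (hj : j ≠ 0) :
    Tendsto (fun k => scattering α p q k i j) (inftyWithin (Dminus α)) (𝓝 (basisVec j i)) := by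
  obtain ⟨C, -, H⟩ := exists_norm_leftCol_ne_diag_le h hα
  refine tendsto_inftyWithin (fun k hk => ?_) (C := C)
  have hg := good_of_ne_zero hj (le_of_lt hk)
  rw [scattering_block h hα hi hj]
  refine le_of_tendsto (((tendsto_leftCol_atTop h hα hg
    (rate_eq_zero_of_ne hj hi)).sub_const _).norm.const_mul ‖k‖) (Eventually.of_forall fun x => ?_)
  exact H k j i hj hi hg x

lemma tendsto_bigDelta (h : Admissible K p q) (hα : α ^ 2 = 1) :
    Tendsto (fun k => bigDelta (scattering α p q k)) (inftyWithin (Dminus α)) (𝓝 1) := by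
  have h11 := tendsto_scattering_block h hα (i := 1) (j := 1) (by decide) (by decide)
  have h12 := tendsto_scattering_block h hα (i := 1) (j := 2) (by decide) (by decide)
  have h21 := tendsto_scattering_block h hα (i := 2) (j := 1) (by decide) (by decide)
  have h22 := tendsto_scattering_block h hα (i := 2) (j := 2) (by decide) (by decide)
  simpa [bigDelta, basisVec, Matrix.one_apply] using (h11.mul h22).sub (h12.mul h21)

end Columns

section Sectional

variable {α : ℝ} {u₀ v₀ : SchwartzMap ℝ ℝ} {u v : ℝ → ℝ → ℝ} {t : ℝ}

lemma rhM_of_mem_Dplus {p₀ q₀ : ℝ → ℝ} {x : ℝ} {k : ℂ} (hk : k ∈ Dplus α) (a b : Fin 3) :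
    rhM α p₀ q₀ u v x t k a b =
      ![leftCol α (fun y => u y t) (fun y => v y t) k 0 x a / scattering α p₀ q₀ k 0 0,
        rightCol α (fun y => u y t) (fun y => v y t) k 1 x a,
        rightCol α (fun y => u y t) (fun y => v y t) k 2 x a] b := by
  simp [rhM, sectional, hk, leftCol, rightCol, jostLeft, jostRight]

lemma not_mem_Dplus {k : ℂ} (hk : k ∈ Dminus α) : k ∉ Dplus α :=
  fun h => lt_asymm (show 0 < α * k.im from h) hk

lemma rhM_of_mem_Dminus {p₀ q₀ : ℝ → ℝ} {x : ℝ} {k : ℂ} (hk : k ∈ Dminus α) (a b : Fin 3) :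
    rhM α p₀ q₀ u v x t k a b =
      ![rightCol α (fun y => u y t) (fun y => v y t) k 0 x a,
        (scattering α p₀ q₀ k 2 2 * leftCol α (fun y => u y t) (fun y => v y t) k 1 x a -
          scattering α p₀ q₀ k 2 1 * leftCol α (fun y => u y t) (fun y => v y t) k 2 x a) /
            bigDelta (scattering α p₀ q₀ k),
        (-scattering α p₀ q₀ k 1 2 * leftCol α (fun y => u y t) (fun y => v y t) k 1 x a +
          scattering α p₀ q₀ k 1 1 * leftCol α (fun y => u y t) (fun y => v y t) k 2 x a) /
            bigDelta (scattering α p₀ q₀ k)] b := by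
  simp [rhM, sectional, not_mem_Dplus hk, leftCol, rightCol, jostLeft, jostRight]

lemma eventually_mem_inftyWithin (D : Set ℂ) : ∀ᶠ k in inftyWithin D, k ∈ D :=
  mem_inf_of_right (mem_principal_self D)

lemma tendsto_matrix {l : Filter ℂ} {N : ℂ → Matrix (Fin 3) (Fin 3) ℂ}
    {B : Matrix (Fin 3) (Fin 3) ℂ} :
    Tendsto N l (𝓝 B) ↔ ∀ a b, Tendsto (fun k => N k a b) l (𝓝 (B a b)) :=
  tendsto_pi_nhds.trans (forall_congr' fun _ => tendsto_pi_nhds)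

lemma rhM_normalization (hsol : IsSchwartzSolution α u₀ v₀ u v) (hα : α ^ 2 = 1) (ht : 0 ≤ t)
    (x : ℝ) : Tendsto (rhM α u₀ v₀ u v x t) atInfty (𝓝 1) := by
  obtain ⟨K, h⟩ := hsol.exists_admissible_at ht
  obtain ⟨K₀, h₀⟩ := hsol.exists_admissible_init
  rw [atInfty_eq hα, tendsto_sup]
  refine ⟨tendsto_matrix.2 fun a b => ?_, tendsto_matrix.2 fun a b => ?_⟩
  · refine Tendsto.congr' (f₁ := fun k => ![_, _, _] b) ((eventually_mem_inftyWithin _).mono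
      fun k hk => (rhM_of_mem_Dplus hk a b).symm) ?_
    fin_cases b
    · have := (tendsto_leftCol_zero h hα x a).div (tendsto_scattering_zero h₀ hα) one_ne_zero
      rw [div_one] at this
      exact this
    · exact tendsto_rightCol_of_ne_zero h hα (by decide) x a
    · exact tendsto_rightCol_of_ne_zero h hα (by decide) x a
  · refine Tendsto.congr' (f₁ := fun k => ![_, _, _] b) ((eventually_mem_inftyWithin _).mono
      fun k hk => (rhM_of_mem_Dminus hk a b).symm) ?_
    have h11 := tendsto_scattering_block h₀ hα (i := 1) (j := 1) (by decide) (by decide)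
    have h12 := tendsto_scattering_block h₀ hα (i := 1) (j := 2) (by decide) (by decide)
    have h21 := tendsto_scattering_block h₀ hα (i := 2) (j := 1) (by decide) (by decide)
    have h22 := tendsto_scattering_block h₀ hα (i := 2) (j := 2) (by decide) (by decide)
    have l1 := tendsto_leftCol_of_ne_zero h hα (j := 1) (by decide) x a
    have l2 := tendsto_leftCol_of_ne_zero h hα (j := 2) (by decide) x a
    have hd := tendsto_bigDelta h₀ hα
    fin_cases b
    · exact tendsto_rightCol_zero h hα x a
    · have := ((h22.mul l1).sub (h21.mul l2)).div hd one_ne_zero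
      simp only [basisVec, Matrix.one_apply_eq, Matrix.one_apply_ne (show (2 : Fin 3) ≠ 1 by decide),
        one_mul, zero_mul, sub_zero, div_one] at this
      exact this
    · have := ((h12.neg.mul l1).add (h11.mul l2)).div hd one_ne_zero
      simp only [basisVec, Matrix.one_apply_eq, Matrix.one_apply_ne (show (1 : Fin 3) ≠ 2 by decide),
        one_mul, neg_zero, zero_mul, zero_add, div_one] at this
      exact this

/-- On `D₋` the coefficients formed from the lower block and `Δ` tend to those of the identity,
while `k` times the top entries of the columns stays convergent; the mixing of columns therefore
does not affect the limit. -/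
lemma rhM_recovery (hsol : IsSchwartzSolution α u₀ v₀ u v) (hα : α ^ 2 = 1) (ht : 0 ≤ t)
    (x : ℝ) {b : Fin 3} (hb : b ≠ 0) :
    Tendsto (fun k : ℂ => 2 * Complex.I * (k * rhM α u₀ v₀ u v x t k 0 b)) atInfty
      (𝓝 (potComp (fun y => u y t) (fun y => v y t) b x)) := by
  obtain ⟨K, h⟩ := hsol.exists_admissible_at ht
  obtain ⟨K₀, h₀⟩ := hsol.exists_admissible_init
  rw [atInfty_eq hα, tendsto_sup]
  constructor
  · refine (tendsto_mul_rightCol h hα hb x).congr' ((eventually_mem_inftyWithin _).mono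
      fun k hk => ?_)
    simp only [rhM_of_mem_Dplus hk]
    obtain rfl | rfl := eq_one_or_two hb <;> simp
  · have h11 := tendsto_scattering_block h₀ hα (i := 1) (j := 1) (by decide) (by decide)
    have h12 := tendsto_scattering_block h₀ hα (i := 1) (j := 2) (by decide) (by decide)
    have h21 := tendsto_scattering_block h₀ hα (i := 2) (j := 1) (by decide) (by decide)
    have h22 := tendsto_scattering_block h₀ hα (i := 2) (j := 2) (by decide) (by decide)
    have l1 := tendsto_mul_leftCol h hα (j := 1) (by decide) x
    have l2 := tendsto_mul_leftCol h hα (j := 2) (by decide) x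
    have hd := tendsto_bigDelta h₀ hα
    obtain rfl | rfl := eq_one_or_two hb
    · have := ((h22.mul l1).sub (h21.mul l2)).div hd one_ne_zero
      simp only [basisVec, Matrix.one_apply_eq, Matrix.one_apply_ne (show (2 : Fin 3) ≠ 1 by decide),
        one_mul, zero_mul, sub_zero, div_one] at this
      refine this.congr' ((eventually_mem_inftyWithin _).mono fun k hk => ?_)
      simp only [Pi.div_apply, rhM_of_mem_Dminus hk, Matrix.cons_val_one, Matrix.cons_val_zero]
      ring
    · have := ((h12.neg.mul l1).add (h11.mul l2)).div hd one_ne_zero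
      simp only [basisVec, Matrix.one_apply_eq, Matrix.one_apply_ne (show (1 : Fin 3) ≠ 2 by decide),
        one_mul, neg_zero, zero_mul, zero_add, div_one] at this
      refine this.congr' ((eventually_mem_inftyWithin _).mono fun k hk => ?_)
      simp only [Pi.div_apply, rhM_of_mem_Dminus hk, Matrix.cons_val]
      ring

end Sectional

end CMKdV
end

noncomputable section
namespace CMKdV

/-! ### Painlevé's theorem and a Liouville theorem for sectionally holomorphic functions -/

/-- A continuous function which is holomorphic off the real line is entire. -/
lemma differentiable_of_differentiableAt_off_real {g : ℂ → ℂ} (hc : Continuous g)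
    (hd : ∀ k : ℂ, k.im ≠ 0 → DifferentiableAt ℂ g k) : Differentiable ℂ g := by
  -- Morera's theorem: a rectangle is cut along the real axis, and Cauchy's theorem is applied to
  -- both pieces, whose edges on the axis need continuity only.
  have hcons : Complex.IsConservativeOn g univ := by
    intro z w _
    rw [← add_eq_zero_iff_eq_neg, Complex.wedgeIntegral_add_wedgeIntegral_eq]
    -- With one horizontal side at height zero, the open rectangle does not meet the real axis.
    have hoff : ∀ a b : ℝ, ∀ s : Set ℝ, (a = 0 ∨ b = 0) →
        DifferentiableOn ℂ g (s ×ℂ Ioo (min a b) (max a b)) := by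
      intro a b s hab k hk
      refine (hd k ?_).differentiableWithinAt
      have := hk.2
      simp only [mem_preimage, mem_Ioo, lt_max_iff, min_lt_iff] at this
      grind
    have h1 := Complex.integral_boundary_rect_eq_zero_of_continuousOn_of_differentiableOn g z
      (w.re : ℂ) hc.continuousOn (hoff _ _ _ (Or.inr (by simp)))
    have h2 := Complex.integral_boundary_rect_eq_zero_of_continuousOn_of_differentiableOn g
      (z.re : ℂ) w hc.continuousOn (hoff _ _ _ (Or.inl (by simp)))
    simp only [Complex.ofReal_re, Complex.ofReal_im] at h1 h2
    have i : ∀ r a b : ℝ, IntervalIntegrable (fun y : ℝ => g (r + y * Complex.I)) volume a b :=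
      fun r a b => (hc.comp (by fun_prop)).intervalIntegrable a b
    rw [← intervalIntegral.integral_add_adjacent_intervals (i w.re z.im 0) (i w.re 0 w.im),
      ← intervalIntegral.integral_add_adjacent_intervals (i z.re z.im 0) (i z.re 0 w.im),
      smul_add, smul_add]
    linear_combination h1 + h2
  rw [← differentiableOn_univ]
  exact (Complex.isConservativeOn_and_continuousOn_iff_isDifferentiableOn isOpen_univ).1
    ⟨hcons, hc.continuousOn⟩

/-- A function which is holomorphic off the real line and off isolated points, has limits
everywhere and tends to `c` at infinity is constant. -/
lemma eq_of_sectionally_differentiable {A : Set ℂ} (hA : Dense A) {f : ℂ → ℂ} {c : ℂ}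
    (hoff : ∀ k : ℂ, k.im ≠ 0 → ∀ᶠ z in 𝓝[≠] k, z ∈ A) (hAr : ∀ k ∈ A, k.im ≠ 0)
    (hd : ∀ k ∈ A, DifferentiableAt ℂ f k) (hlim : ∀ k, ∃ y, Tendsto f (𝓝[A] k) (𝓝 y))
    (hinf : Tendsto f atInfty (𝓝 c)) {k : ℂ} (hk : k ∈ A) : f k = c := by
  -- Limits along the dense set `A` at every point make the extension continuous on the whole plane,
  -- across the real axis and the exceptional points alike.
  set g := extendFrom A f with hg
  have hgc : Continuous g := continuous_extendFrom hA hlim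
  have hgf : ∀ k ∈ A, g k = f k := extendFrom_extends fun k hk =>
    (hd k hk).continuousAt.continuousWithinAt
  have hgd : Differentiable ℂ g := by
    refine differentiable_of_differentiableAt_off_real hgc fun k hk => ?_
    -- Off the real axis the exceptional points are isolated, so continuity makes them removable.
    refine (Complex.analyticAt_of_differentiable_on_punctured_nhds_of_continuousAt ?_
      hgc.continuousAt).differentiableAt
    filter_upwards [hoff k hk] with z hzA
    refine (hd z hzA).congr_of_eventuallyEq ?_
    filter_upwards [eventually_nhdsWithin_iff.1 (hoff z (hAr z hzA))] with y hy
    by_cases hyz : y = z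
    · rw [hyz, hgf z hzA]
    · exact hgf y (hy hyz)
  rw [← hgf k hk]
  refine hgd.apply_eq_of_tendsto_cocompact k ?_
  rw [← Metric.cobounded_eq_cocompact, Metric.nhds_basis_closedBall.tendsto_right_iff]
  intro ε hε
  have h1 := hinf (Metric.closedBall_mem_nhds c hε)
  rw [atInfty, mem_map, mem_inf_principal] at h1
  obtain ⟨r, -, hr⟩ := (Metric.hasBasis_cobounded_compl_closedBall (0 : ℂ)).mem_iff.1 h1
  have hmem := Metric.hasBasis_cobounded_compl_closedBall (0 : ℂ) |>.mem_of_mem (i := r) trivial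
  filter_upwards [hmem] with z hz
  -- The decay hypothesis concerns nonreal points only; other points near infinity inherit the bound
  -- as limits of points of `A`.
  have hne : (𝓝[A] z).NeBot := mem_closure_iff_nhdsWithin_neBot.1 (hA z)
  refine Metric.isClosed_closedBall.mem_of_tendsto ((hgc.tendsto z).mono_left
    (nhdsWithin_le_nhds (s := A))) ?_
  filter_upwards [self_mem_nhdsWithin, nhdsWithin_le_nhds
    (Metric.isClosed_closedBall.isOpen_compl.mem_nhds hz)] with y hyA hy
  rw [hgf y hyA]
  exact hr hy (hAr y hyA)

/-! ### Removal of the poles -/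

/-- The factor which removes the pole of a matrix satisfying `PoleCondition`. -/
def poleFactor (κ : ℂ) (R : Matrix (Fin 3) (Fin 3) ℂ) (k : ℂ) : Matrix (Fin 3) (Fin 3) ℂ :=
  1 - (k - κ)⁻¹ • R

section Pole

variable {N : ℂ → Matrix (Fin 3) (Fin 3) ℂ} {κ : ℂ} {R B : Matrix (Fin 3) (Fin 3) ℂ}

lemma mul_poleFactor_mul (k : ℂ) (hR : R * R = 0) : poleFactor κ R k * R = R := by
  simp [poleFactor, sub_mul, hR]

lemma poleFactor_mul_neg (hR : R * R = 0) (k : ℂ) :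
    poleFactor κ R k * poleFactor κ (-R) k = 1 := by
  simp [poleFactor, sub_mul, mul_add, hR]

/-- Multiplying `N (1 - R / (k - κ))` by `k - κ` gives a function tending to `ρ - ρ = 0`. Riemann's
removable singularity theorem then provides a limit for every entry. -/
lemma PoleCondition.exists_tendsto (h : PoleCondition N κ R)
    (hN : ∀ a b, ∀ᶠ k in 𝓝[≠] κ, DifferentiableAt ℂ (fun z => N z a b) k) :
    ∃ B, Tendsto (fun k => N k * poleFactor κ R k) (𝓝[≠] κ) (𝓝 B) := by
  obtain ⟨ρ, h1, h2⟩ := h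
  set f : ℂ → Matrix (Fin 3) (Fin 3) ℂ := fun k => N k * poleFactor κ R k with hf
  have hfe : ∀ k, f k = N k - (k - κ)⁻¹ • (N k * R) := fun k => by
    simp [hf, poleFactor, mul_sub]
  have h0 : Tendsto (fun k => (k - κ) • f k) (𝓝[≠] κ) (𝓝 0) := by
    rw [← sub_self ρ]
    refine (h1.sub h2).congr' ?_
    filter_upwards [self_mem_nhdsWithin] with k hk
    rw [hfe, smul_sub, smul_inv_smul₀ (sub_ne_zero.2 hk)]
  have hκ : Tendsto (fun k : ℂ => k - κ) (𝓝[≠] κ) (𝓝 0) := by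
    have : Tendsto (fun k : ℂ => k - κ) (𝓝 κ) (𝓝 (κ - κ)) := by
      exact (continuous_id.sub continuous_const).tendsto κ
    rw [sub_self] at this
    exact this.mono_left nhdsWithin_le_nhds
  refine ⟨Matrix.of fun a b => limUnder (𝓝[≠] κ) fun k => f k a b,
    tendsto_matrix.2 fun a b => ?_⟩
  refine Complex.tendsto_limUnder_of_differentiable_on_punctured_nhds_of_isLittleO ?_ ?_
  · have hall : ∀ᶠ k in 𝓝[≠] κ, ∀ a b, DifferentiableAt ℂ (fun z => N z a b) k :=
      eventually_all.2 fun a => eventually_all.2 fun b => hN a b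
    filter_upwards [hall, self_mem_nhdsWithin] with k hk hne
    have : (fun k => f k a b) = fun k => N k a b - (k - κ)⁻¹ * ∑ c, N k a c * R c b := by
      funext k
      rw [hfe]
      simp [Matrix.mul_apply]
    rw [this]
    have hs : DifferentiableAt ℂ (fun k => ∑ c, N k a c * R c b) k :=
      DifferentiableAt.fun_sum fun c _ => (hk a c).mul_const _
    exact (hk a b).sub (((differentiableAt_id.sub_const κ).inv (sub_ne_zero.2 hne)).mul hs)
  · rw [Asymptotics.isLittleO_iff_tendsto']
    -- The constant `f κ a b`, the value at the pole itself, is harmless because it is multiplied by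
    -- `k - κ`.
    · have := ((tendsto_matrix.1 h0 a b).sub (hκ.mul_const (f κ a b)))
      simp only [zero_mul, Matrix.zero_apply, sub_zero] at this
      refine this.congr fun k => ?_
      simp [Matrix.smul_apply]
      ring
    · filter_upwards [self_mem_nhdsWithin] with k hk h
      exact absurd h (inv_ne_zero (sub_ne_zero.2 hk))

/-- Since `R² = 0`, the pole factor fixes `R` from the left, so `N R` inherits a limit from the
regularised product. Moreover `(k - κ) N` is `(k - κ)` times that product plus `N R`, so it has the
same limit. -/
lemma poleCondition_of_tendsto (hR : R * R = 0)
    (h : Tendsto (fun k => N k * poleFactor κ R k) (𝓝[≠] κ) (𝓝 B)) : PoleCondition N κ R := by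
  have h2 := h.mul_const R
  simp only [mul_assoc, mul_poleFactor_mul _ hR] at h2
  refine ⟨B * R, ?_, h2⟩
  have hκ : Tendsto (fun k : ℂ => k - κ) (𝓝[≠] κ) (𝓝 0) := by
    have : Tendsto (fun k : ℂ => k - κ) (𝓝 κ) (𝓝 (κ - κ)) := by
      exact (continuous_id.sub continuous_const).tendsto κ
    rw [sub_self] at this
    exact this.mono_left nhdsWithin_le_nhds
  have h3 := (hκ.smul h).add h2
  rw [zero_smul, zero_add] at h3
  refine h3.congr' ?_
  filter_upwards [self_mem_nhdsWithin] with k hk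
  rw [poleFactor, mul_sub, mul_one, mul_smul_comm, smul_sub, smul_inv_smul₀ (sub_ne_zero.2 hk),
    sub_add_cancel]

lemma mul_adjugate_poleFactor (hdet : ∀ s : ℂ, (1 - s • R).det = 1) (k : ℂ) :
    poleFactor κ R k * (poleFactor κ R k).adjugate = 1 := by
  rw [Matrix.mul_adjugate, poleFactor, hdet, one_smul]

end Pole

end CMKdV
end

noncomputable section
namespace CMKdV

/-! ### The sectional matrix solves the Riemann-Hilbert problem -/

section Analytic

variable {K α : ℝ} {p q : ℝ → ℝ} {i j : Fin 3} {k : ℂ}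

lemma isOpen_Dplus (α : ℝ) : IsOpen (Dplus α) := isOpen_lt_mul_im α

lemma isOpen_Dminus (α : ℝ) : IsOpen (Dminus α) := isOpen_lt (by fun_prop) continuous_const

lemma mem_Dplus_or_mem_Dminus (hα : α ^ 2 = 1) (hk : k.im ≠ 0) : k ∈ Dplus α ∨ k ∈ Dminus α :=
  (mul_ne_zero (ne_zero_of_sq_eq_one hα) hk).lt_or_gt.symm

lemma im_ne_zero_of_mem_Dplus (hk : k ∈ Dplus α) : k.im ≠ 0 := fun h => by
  simp [Dplus, h] at hk

lemma im_ne_zero_of_mem_Dminus (hk : k ∈ Dminus α) : k.im ≠ 0 := fun h => by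
  simp [Dminus, h] at hk

lemma conj_mem_Dplus (hk : k ∈ Dminus α) : starRingEnd ℂ k ∈ Dplus α := by
  simpa [Dplus, Dminus] using hk

lemma conj_mem_Dminus (hk : k ∈ Dplus α) : starRingEnd ℂ k ∈ Dminus α := by
  simpa [Dplus, Dminus] using hk

lemma analyticAt_leftCol_zero (h : Admissible K p q) (hα : α ^ 2 = 1) (hk : k ∈ Dplus α) (x : ℝ)
    (a : Fin 3) : AnalyticAt ℂ (fun k => leftCol α p q k 0 x a) k :=
  (leftCol_differentiableOn h hα (isOpen_Dplus α) (fun _ hz => good_zero (le_of_lt hz)) x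
    a).analyticAt ((isOpen_Dplus α).mem_nhds hk)

lemma analyticAt_leftCol_of_ne_zero (h : Admissible K p q) (hα : α ^ 2 = 1) (hj : j ≠ 0)
    (hk : k ∈ Dminus α) (x : ℝ) (a : Fin 3) : AnalyticAt ℂ (fun k => leftCol α p q k j x a) k :=
  (leftCol_differentiableOn h hα (isOpen_Dminus α) (fun _ hz => good_of_ne_zero hj (le_of_lt hz)) x
    a).analyticAt ((isOpen_Dminus α).mem_nhds hk)

lemma good_neg_zero (hk : α * k.im ≤ 0) : Good α (-k) 0 := good_zero (by simpa using hk)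

lemma analyticAt_rightCol_zero (h : Admissible K p q) (hα : α ^ 2 = 1) (hk : k ∈ Dminus α) (x : ℝ)
    (a : Fin 3) : AnalyticAt ℂ (fun k => rightCol α p q k 0 x a) k :=
  (rightCol_differentiableOn h hα (isOpen_Dminus α) (fun _ hz => good_neg_zero (le_of_lt hz)) x
    a).analyticAt ((isOpen_Dminus α).mem_nhds hk)

lemma analyticAt_rightCol_of_ne_zero (h : Admissible K p q) (hα : α ^ 2 = 1) (hj : j ≠ 0)
    (hk : k ∈ Dplus α) (x : ℝ) (a : Fin 3) : AnalyticAt ℂ (fun k => rightCol α p q k j x a) k :=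
  (rightCol_differentiableOn h hα (isOpen_Dplus α)
    (fun _ hz => good_neg_of_ne_zero hj (le_of_lt hz)) x a).analyticAt
    ((isOpen_Dplus α).mem_nhds hk)

lemma analyticAt_scattering_zero (h : Admissible K p q) (hα : α ^ 2 = 1) (hk : k ∈ Dplus α) :
    AnalyticAt ℂ (fun k => scattering α p q k 0 0) k :=
  (holomorphicUpTo_scattering_zero h hα).2.analyticAt ((isOpen_Dplus α).mem_nhds hk)

lemma analyticAt_scattering_block (h : Admissible K p q) (hα : α ^ 2 = 1) (hi : i ≠ 0) (hj : j ≠ 0)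
    (hk : k ∈ Dminus α) : AnalyticAt ℂ (fun k => scattering α p q k i j) k := by
  refine (holomorphicUpTo_scattering_block h hα hi hj).2.analyticAt
    ((isOpen_lt_mul_im (-α)).mem_nhds ?_)
  have : α * k.im < 0 := hk
  change 0 < -α * k.im
  linarith

lemma analyticAt_bigDelta (h : Admissible K p q) (hα : α ^ 2 = 1) (hk : k ∈ Dminus α) :
    AnalyticAt ℂ (fun k => bigDelta (scattering α p q k)) k := by
  have n1 : (1 : Fin 3) ≠ 0 := by decide
  have n2 : (2 : Fin 3) ≠ 0 := by decide
  exact ((analyticAt_scattering_block h hα n1 n1 hk).mul (analyticAt_scattering_block h hα n2 n2 hk)).sub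
    ((analyticAt_scattering_block h hα n1 n2 hk).mul (analyticAt_scattering_block h hα n2 n1 hk))

/-- The complement of the real line, the zeros of `s₁₁` and their conjugates. -/
def regularSet (α : ℝ) (p q : ℝ → ℝ) : Set ℂ :=
  {k | k.im ≠ 0 ∧ k ∉ zeros α p q ∧ starRingEnd ℂ k ∉ zeros α p q}

lemma scattering_ne_zero_of_mem (hk : k ∈ regularSet α p q) (hD : k ∈ Dplus α) :
    scattering α p q k 0 0 ≠ 0 := fun h => hk.2.1 ⟨hD, h⟩

lemma conj_mem_regularSet (hk : k ∈ regularSet α p q) : starRingEnd ℂ k ∈ regularSet α p q := by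
  obtain ⟨h1, h2, h3⟩ := hk
  exact ⟨by simpa using h1, h3, by simpa using h2⟩

lemma bigDelta_ne_zero_of_mem (h : Admissible K p q) (hα : α ^ 2 = 1) (hk : k ∈ regularSet α p q)
    (hD : k ∈ Dminus α) : bigDelta (scattering α p q k) ≠ 0 := by
  have h1 := scattering_ne_zero_of_mem (conj_mem_regularSet hk) (conj_mem_Dplus hD)
  have h2 := bigDelta_scattering_conj h hα (le_of_lt (conj_mem_Dplus hD) : 0 ≤ α * _)
  rw [Complex.conj_conj] at h2
  rw [h2]
  simpa using h1

lemma mem_regularSet_of_mem_Dplus (hk : k ∈ Dplus α) (h : scattering α p q k 0 0 ≠ 0) :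
    k ∈ regularSet α p q :=
  ⟨im_ne_zero_of_mem_Dplus hk, fun hz => h hz.2, fun hz => not_mem_Dplus (conj_mem_Dminus hk) hz.1⟩

lemma mem_regularSet_of_mem_Dminus (h : Admissible K p q) (hα : α ^ 2 = 1) (hk : k ∈ Dminus α)
    (hd : bigDelta (scattering α p q k) ≠ 0) : k ∈ regularSet α p q := by
  refine ⟨im_ne_zero_of_mem_Dminus hk, fun hz => not_mem_Dplus hk hz.1, fun hz => hd ?_⟩
  have h2 := bigDelta_scattering_conj h hα (le_of_lt (conj_mem_Dplus hk) : 0 ≤ α * _)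
  rw [Complex.conj_conj, hz.2, map_zero] at h2
  exact h2

lemma eventually_mem_regularSet (h : Admissible K p q) (hα : α ^ 2 = 1)
    (hk : k ∈ simpleZeros α p q) : ∀ᶠ z in 𝓝[≠] k, z ∈ regularSet α p q := by
  have hd := (analyticAt_scattering_zero h hα hk.1.1).differentiableAt.hasDerivAt
  have hne := hd.eventually_ne hk.2 (c := 0)
  filter_upwards [hne, nhdsWithin_le_nhds ((isOpen_Dplus α).mem_nhds hk.1.1)] with z hz hD
  exact mem_regularSet_of_mem_Dplus hD hz

lemma tendsto_conj_nhdsNE (k : ℂ) :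
    Tendsto (starRingEnd ℂ) (𝓝[≠] (starRingEnd ℂ k)) (𝓝[≠] k) := by
  refine tendsto_nhdsWithin_iff.2 ⟨?_, ?_⟩
  · have : Tendsto (starRingEnd ℂ) (𝓝 (starRingEnd ℂ k)) (𝓝 (starRingEnd ℂ (starRingEnd ℂ k))) :=
      Complex.continuous_conj.tendsto _
    rw [Complex.conj_conj] at this
    exact this.mono_left nhdsWithin_le_nhds
  · filter_upwards [self_mem_nhdsWithin] with z hz h
    rw [← h] at hz
    simp at hz

lemma eventually_mem_regularSet_conj (h : Admissible K p q) (hα : α ^ 2 = 1)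
    (hk : k ∈ simpleZeros α p q) : ∀ᶠ z in 𝓝[≠] (starRingEnd ℂ k), z ∈ regularSet α p q := by
  filter_upwards [(tendsto_conj_nhdsNE k).eventually (eventually_mem_regularSet h hα hk)] with z hz
  simpa using conj_mem_regularSet hz

end Analytic

/-- The matrix `diag(-α, 1, 1)` of the sesquilinear form `pairing`. -/
def gram (α : ℝ) : Matrix (Fin 3) (Fin 3) ℂ := Matrix.diagonal ![-α, 1, 1]

lemma gram_mul_gram {α : ℝ} (hα : α ^ 2 = 1) : gram α * gram α = 1 := by
  have hαc : (α : ℂ) * α = 1 := by exact_mod_cast (by rw [← sq, hα] : α * α = 1)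
  rw [gram, Matrix.diagonal_mul_diagonal, ← Matrix.diagonal_one]
  congr 1
  funext i
  fin_cases i <;> simp [hαc]

lemma conjTranspose_gram (α : ℝ) : (gram α).conjTranspose = gram α := by
  rw [gram, Matrix.diagonal_conjTranspose]
  congr 1
  funext i
  fin_cases i <;> simp

lemma conjTranspose_mul_gram_mul (α : ℝ) (X Y : Matrix (Fin 3) (Fin 3) ℂ) (i j : Fin 3) :
    (X.conjTranspose * gram α * Y) i j = pairing α (fun a => X a i) (fun a => Y a j) := by
  simp only [Matrix.mul_apply, gram, Fin.sum_univ_three, pairing,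
    Matrix.conjTranspose_apply, Complex.star_def]
  simp
  ring

section Sectional

variable {α : ℝ} {u₀ v₀ : SchwartzMap ℝ ℝ} {u v : ℝ → ℝ → ℝ} {t : ℝ} {k : ℂ}

lemma rhM_eventuallyEq_Dplus {x : ℝ} (hk : k ∈ Dplus α) (a b : Fin 3) :
    (fun z => rhM α u₀ v₀ u v x t z a b) =ᶠ[𝓝 k] fun k =>
      ![leftCol α (fun y => u y t) (fun y => v y t) k 0 x a / scattering α u₀ v₀ k 0 0,
        rightCol α (fun y => u y t) (fun y => v y t) k 1 x a,
        rightCol α (fun y => u y t) (fun y => v y t) k 2 x a] b := by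
  filter_upwards [(isOpen_Dplus α).mem_nhds hk] with z hz
  exact rhM_of_mem_Dplus hz a b

lemma rhM_eventuallyEq_Dminus {x : ℝ} (hk : k ∈ Dminus α) (a b : Fin 3) :
    (fun z => rhM α u₀ v₀ u v x t z a b) =ᶠ[𝓝 k] fun k =>
      ![rightCol α (fun y => u y t) (fun y => v y t) k 0 x a,
        (scattering α u₀ v₀ k 2 2 * leftCol α (fun y => u y t) (fun y => v y t) k 1 x a -
          scattering α u₀ v₀ k 2 1 * leftCol α (fun y => u y t) (fun y => v y t) k 2 x a) /
            bigDelta (scattering α u₀ v₀ k),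
        (-scattering α u₀ v₀ k 1 2 * leftCol α (fun y => u y t) (fun y => v y t) k 1 x a +
          scattering α u₀ v₀ k 1 1 * leftCol α (fun y => u y t) (fun y => v y t) k 2 x a) /
            bigDelta (scattering α u₀ v₀ k)] b := by
  filter_upwards [(isOpen_Dminus α).mem_nhds hk] with z hz
  exact rhM_of_mem_Dminus hz a b

lemma rhM_analyticAt (hsol : IsSchwartzSolution α u₀ v₀ u v) (hα : α ^ 2 = 1) (ht : 0 ≤ t)
    (x : ℝ) (hk : k ∈ regularSet α u₀ v₀) (a b : Fin 3) :
    AnalyticAt ℂ (fun z => rhM α u₀ v₀ u v x t z a b) k := by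
  obtain ⟨K, h⟩ := hsol.exists_admissible_at ht
  obtain ⟨K₀, h₀⟩ := hsol.exists_admissible_init
  have n1 : (1 : Fin 3) ≠ 0 := by decide
  have n2 : (2 : Fin 3) ≠ 0 := by decide
  obtain hD | hD := mem_Dplus_or_mem_Dminus hα hk.1
  · refine AnalyticAt.congr ?_ (rhM_eventuallyEq_Dplus hD a b).symm
    fin_cases b
    · exact (analyticAt_leftCol_zero h hα hD x a).div (analyticAt_scattering_zero h₀ hα hD)
        (scattering_ne_zero_of_mem hk hD)
    · exact analyticAt_rightCol_of_ne_zero h hα n1 hD x a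
    · exact analyticAt_rightCol_of_ne_zero h hα n2 hD x a
  · refine AnalyticAt.congr ?_ (rhM_eventuallyEq_Dminus hD a b).symm
    have l1 := analyticAt_leftCol_of_ne_zero h hα n1 hD x a
    have l2 := analyticAt_leftCol_of_ne_zero h hα n2 hD x a
    have hd := analyticAt_bigDelta h₀ hα hD
    have hd0 := bigDelta_ne_zero_of_mem h₀ hα hk hD
    fin_cases b
    · exact analyticAt_rightCol_zero h hα hD x a
    · exact (((analyticAt_scattering_block h₀ hα n2 n2 hD).mul l1).sub
        ((analyticAt_scattering_block h₀ hα n2 n1 hD).mul l2)).div hd hd0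
    · exact (((analyticAt_scattering_block h₀ hα n1 n2 hD).neg.mul l1).add
        ((analyticAt_scattering_block h₀ hα n1 n1 hD).mul l2)).div hd hd0

lemma rhM_meromorphicAt (hsol : IsSchwartzSolution α u₀ v₀ u v) (hα : α ^ 2 = 1) (ht : 0 ≤ t)
    (x : ℝ) (hk : k.im ≠ 0) (a b : Fin 3) :
    MeromorphicAt (fun z => rhM α u₀ v₀ u v x t z a b) k := by
  obtain ⟨K, h⟩ := hsol.exists_admissible_at ht
  obtain ⟨K₀, h₀⟩ := hsol.exists_admissible_init
  have n1 : (1 : Fin 3) ≠ 0 := by decide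
  have n2 : (2 : Fin 3) ≠ 0 := by decide
  obtain hD | hD := mem_Dplus_or_mem_Dminus hα hk
  · refine MeromorphicAt.congr ?_ ((rhM_eventuallyEq_Dplus hD a b).symm.filter_mono
      nhdsWithin_le_nhds)
    fin_cases b
    · exact (analyticAt_leftCol_zero h hα hD x a).meromorphicAt.div
        (analyticAt_scattering_zero h₀ hα hD).meromorphicAt
    · exact (analyticAt_rightCol_of_ne_zero h hα n1 hD x a).meromorphicAt
    · exact (analyticAt_rightCol_of_ne_zero h hα n2 hD x a).meromorphicAt
  · refine MeromorphicAt.congr ?_ ((rhM_eventuallyEq_Dminus hD a b).symm.filter_mono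
      nhdsWithin_le_nhds)
    have l1 := analyticAt_leftCol_of_ne_zero h hα n1 hD x a
    have l2 := analyticAt_leftCol_of_ne_zero h hα n2 hD x a
    have hd := analyticAt_bigDelta h₀ hα hD
    fin_cases b
    · exact (analyticAt_rightCol_zero h hα hD x a).meromorphicAt
    · exact (((analyticAt_scattering_block h₀ hα n2 n2 hD).mul l1).sub
        ((analyticAt_scattering_block h₀ hα n2 n1 hD).mul l2)).meromorphicAt.div hd.meromorphicAt
    · exact (((analyticAt_scattering_block h₀ hα n1 n2 hD).neg.mul l1).add
        ((analyticAt_scattering_block h₀ hα n1 n1 hD).mul l2)).meromorphicAt.div hd.meromorphicAt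

lemma pairing_div_right (α : ℝ) (w z : Fin 3 → ℂ) (s : ℂ) :
    pairing α w (fun a => z a / s) = pairing α w z / s := by
  simp only [pairing]
  ring

lemma pairing_combination_left (α : ℝ) (w₁ w₂ z : Fin 3 → ℂ) (b c s : ℂ) :
    pairing α (fun a => (b * w₁ a + c * w₂ a) / s) z =
      (starRingEnd ℂ b * pairing α w₁ z + starRingEnd ℂ c * pairing α w₂ z) / starRingEnd ℂ s := by
  simp only [pairing, map_div₀, map_add, map_mul]
  ring

/-- All entries are pairings of Jost columns. The mixed ones vanish, the top one is normalised by
`s₁₁`, and the lower block of pairings is `S`-valued; the combinations of columns of `J₁` in `M` on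
`D₋` invert precisely this block. -/
lemma rhM_conj_mul_of_mem_Dplus (hsol : IsSchwartzSolution α u₀ v₀ u v) (hα : α ^ 2 = 1)
    (ht : 0 ≤ t) (x : ℝ) (hk : k ∈ regularSet α u₀ v₀) (hD : k ∈ Dplus α) :
    (rhM α u₀ v₀ u v x t (starRingEnd ℂ k)).conjTranspose * gram α * rhM α u₀ v₀ u v x t k =
      gram α := by
  obtain ⟨K, h⟩ := hsol.exists_admissible_at ht
  obtain ⟨K₀, h₀⟩ := hsol.exists_admissible_init
  have n1 : (1 : Fin 3) ≠ 0 := by decide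
  have n2 : (2 : Fin 3) ≠ 0 := by decide
  have hk0 : 0 ≤ α * k.im := le_of_lt hD
  have hDc := conj_mem_Dminus hD
  have hs := scattering_ne_zero_of_mem hk hD
  have hkc : α * (starRingEnd ℂ k).im ≤ 0 := le_of_lt hDc
  have hd := bigDelta_ne_zero_of_mem h₀ hα (conj_mem_regularSet hk) hDc
  have hd' : starRingEnd ℂ (bigDelta (scattering α u₀ v₀ (starRingEnd ℂ k))) ≠ 0 := by simpa using hd
  -- The pairings at time `t` involve the limits at time `t`, whereas `M` is built from the initial
  -- scattering data; time invariance reconciles the two.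
  have hs0 : leftLimit α (fun y => u y t) (fun y => v y t) k 0 0 = scattering α u₀ v₀ k 0 0 := by
    rw [← scattering_zero_zero h hα hk0, scattering_zero_time hsol hα hk0 ht]
  have hblock : ∀ i j : Fin 3, i ≠ 0 → j ≠ 0 →
      leftLimit α (fun y => u y t) (fun y => v y t) (starRingEnd ℂ k) i j =
        scattering α u₀ v₀ (starRingEnd ℂ k) i j := fun i j hi hj => by
    rw [← scattering_block h hα hi hj, scattering_block_time hsol hα hkc ht hi hj]
  have hdef : starRingEnd ℂ (bigDelta (scattering α u₀ v₀ (starRingEnd ℂ k))) =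
      starRingEnd ℂ (scattering α u₀ v₀ (starRingEnd ℂ k) 1 1) *
        starRingEnd ℂ (scattering α u₀ v₀ (starRingEnd ℂ k) 2 2) -
      starRingEnd ℂ (scattering α u₀ v₀ (starRingEnd ℂ k) 1 2) *
        starRingEnd ℂ (scattering α u₀ v₀ (starRingEnd ℂ k) 2 1) := by
    simp [bigDelta]
  ext i j
  rw [conjTranspose_mul_gram_mul]
  simp only [rhM_of_mem_Dplus hD, rhM_of_mem_Dminus hDc]
  have e1 := pairing_right_left_zero h hα hk0 x
  have e2 := fun (j : Fin 3) (hj : j ≠ 0) => pairing_right_right h hα hk0 hj x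
  have e3 := fun (i : Fin 3) (hi : i ≠ 0) => pairing_left_left h hα hk0 hi x
  have e4 := fun (i j : Fin 3) (hi : i ≠ 0) (hj : j ≠ 0) => pairing_left_right h hα hk0 hi hj x
  simp only [sub_eq_add_neg, ← neg_mul]
  fin_cases i <;> fin_cases j <;>
    simp only [Fin.zero_eta, Fin.mk_one, Fin.reduceFinMk, Matrix.cons_val, gram,
      Matrix.diagonal_apply_eq, pairing_div_right, pairing_combination_left]
  · rw [e1, hs0]
    field_simp
  · rw [e2 1 n1]; rfl
  · rw [e2 2 n2]; rfl
  · rw [e3 1 n1, e3 2 n2]; simp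
  · rw [e4 1 1 n1 n1, e4 2 1 n2 n1, hblock 1 1 n1 n1, hblock 1 2 n1 n2, div_eq_iff hd', hdef]
    simp
    ring
  · rw [e4 1 2 n1 n2, e4 2 2 n2 n2, hblock 2 1 n2 n1, hblock 2 2 n2 n2]
    simp
    left
    ring
  · rw [e3 1 n1, e3 2 n2]; simp
  · rw [e4 1 1 n1 n1, e4 2 1 n2 n1, hblock 1 1 n1 n1, hblock 1 2 n1 n2]
    simp
    left
    ring
  · rw [e4 1 2 n1 n2, e4 2 2 n2 n2, hblock 2 1 n2 n1, hblock 2 2 n2 n2, div_eq_iff hd', hdef]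
    simp
    ring

lemma rhM_conj_mul (hsol : IsSchwartzSolution α u₀ v₀ u v) (hα : α ^ 2 = 1)
    (ht : 0 ≤ t) (x : ℝ) (hk : k ∈ regularSet α u₀ v₀) :
    (rhM α u₀ v₀ u v x t (starRingEnd ℂ k)).conjTranspose * gram α * rhM α u₀ v₀ u v x t k =
      gram α := by
  obtain hD | hD := mem_Dplus_or_mem_Dminus hα hk.1
  · exact rhM_conj_mul_of_mem_Dplus hsol hα ht x hk hD
  · have := congrArg Matrix.conjTranspose (rhM_conj_mul_of_mem_Dplus hsol hα ht x
      (conj_mem_regularSet hk) (conj_mem_Dplus hD))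
    rw [Complex.conj_conj, Matrix.conjTranspose_mul, Matrix.conjTranspose_mul,
      Matrix.conjTranspose_conjTranspose, conjTranspose_gram, ← mul_assoc] at this
    exact this

/-- On `D₊` the determinant is the Wronskian `s₁₁` divided by `s₁₁`. The symmetry `rhM_conj_mul`
transfers the value to `D₋`. -/
lemma det_rhM (hsol : IsSchwartzSolution α u₀ v₀ u v) (hα : α ^ 2 = 1)
    (ht : 0 ≤ t) (x : ℝ) (hk : k ∈ regularSet α u₀ v₀) : (rhM α u₀ v₀ u v x t k).det = 1 := by
  obtain ⟨K, h⟩ := hsol.exists_admissible_at ht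
  have hplus : ∀ k ∈ regularSet α u₀ v₀, k ∈ Dplus α → (rhM α u₀ v₀ u v x t k).det = 1 := by
    intro k hk hD
    have hk0 : 0 ≤ α * k.im := le_of_lt hD
    have hs := scattering_ne_zero_of_mem hk hD
    have := det3_left_right_right h hα hk0 x
    rw [← scattering_zero_zero h hα hk0, scattering_zero_time hsol hα hk0 ht] at this
    rw [det_eq_det3]
    simp only [rhM_of_mem_Dplus hD, Matrix.cons_val]
    rw [← div_self hs]
    nth_rw 2 [← this]
    simp only [det3]
    ring
  obtain hD | hD := mem_Dplus_or_mem_Dminus hα hk.1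
  · exact hplus k hk hD
  · have h1 := congrArg Matrix.det (rhM_conj_mul hsol hα ht x hk)
    have hg : (gram α).det ≠ 0 := fun h0 => by
      have := congrArg Matrix.det (gram_mul_gram hα)
      simp [h0] at this
    rw [Matrix.det_mul, Matrix.det_mul, Matrix.det_conjTranspose,
      hplus _ (conj_mem_regularSet hk) (conj_mem_Dplus hD), star_one, one_mul] at h1
    exact mul_left_cancel₀ hg (by rw [h1, mul_one])

lemma adjugate_rhM (hsol : IsSchwartzSolution α u₀ v₀ u v) (hα : α ^ 2 = 1)
    (ht : 0 ≤ t) (x : ℝ) (hk : k ∈ regularSet α u₀ v₀) :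
    (rhM α u₀ v₀ u v x t k).adjugate =
      gram α * (rhM α u₀ v₀ u v x t (starRingEnd ℂ k)).conjTranspose * gram α := by
  have h1 := rhM_conj_mul hsol hα ht x hk
  have h2 := Matrix.mul_adjugate (rhM α u₀ v₀ u v x t k)
  rw [det_rhM hsol hα ht x hk, one_smul] at h2
  calc _ = gram α * gram α * (rhM α u₀ v₀ u v x t k).adjugate := by
        rw [gram_mul_gram hα, one_mul]
    _ = gram α * ((rhM α u₀ v₀ u v x t (starRingEnd ℂ k)).conjTranspose * gram α *
          rhM α u₀ v₀ u v x t k) * (rhM α u₀ v₀ u v x t k).adjugate := by rw [h1]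
    _ = _ := by simp only [mul_assoc, h2, mul_one]

end Sectional

end CMKdV
end

noncomputable section
namespace CMKdV

/-! ### Jump and pole conditions of the sectional matrix -/

lemma conj_theta (α x t : ℝ) (k : ℂ) :
    starRingEnd ℂ (theta α x t k) = -theta α x t (starRingEnd ℂ k) := by
  simp [theta, Complex.conj_ofNat]

section Poles

variable {a b : ℂ}

/-- The nilpotent matrix of a pole condition at a zero of `s₁₁`. -/
def lowerNilpotent (a b : ℂ) : Matrix (Fin 3) (Fin 3) ℂ := !![0, 0, 0; a, 0, 0; b, 0, 0]

/-- The nilpotent matrix of a pole condition at the conjugate of a zero of `s₁₁`. -/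
def upperNilpotent (a b : ℂ) : Matrix (Fin 3) (Fin 3) ℂ := !![0, a, b; 0, 0, 0; 0, 0, 0]

lemma lowerNilpotent_mul_self : lowerNilpotent a b * lowerNilpotent a b = 0 := by
  ext i j
  fin_cases i <;> fin_cases j <;> simp [lowerNilpotent, Matrix.mul_apply, Fin.sum_univ_three]

lemma upperNilpotent_mul_self : upperNilpotent a b * upperNilpotent a b = 0 := by
  ext i j
  fin_cases i <;> fin_cases j <;> simp [upperNilpotent, Matrix.mul_apply, Fin.sum_univ_three]

lemma det_one_sub_lowerNilpotent (s : ℂ) : (1 - s • lowerNilpotent a b).det = 1 := by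
  simp [Matrix.det_fin_three, lowerNilpotent]

lemma det_one_sub_upperNilpotent (s : ℂ) : (1 - s • upperNilpotent a b).det = 1 := by
  simp [Matrix.det_fin_three, upperNilpotent]

/-- Here `gram (-1)` is the identity; it is kept to match the shape of `adjugate_rhM` at `α = -1`.
-/
lemma upperNilpotent_eq : upperNilpotent (-starRingEnd ℂ a) (-starRingEnd ℂ b) =
    -(gram (-1) * (lowerNilpotent a b).conjTranspose * gram (-1)) := by
  ext i j
  fin_cases i <;> fin_cases j <;>
    simp [lowerNilpotent, upperNilpotent, gram, Matrix.mul_apply, Matrix.diagonal_apply]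

lemma adjugate_poleFactor {κ : ℂ} {R : Matrix (Fin 3) (Fin 3) ℂ} (hR : R * R = 0)
    (hdet : ∀ s : ℂ, (1 - s • R).det = 1) (k : ℂ) :
    (poleFactor κ R k).adjugate = poleFactor κ (-R) k := by
  have h1 := Matrix.adjugate_mul (poleFactor κ R k)
  rw [poleFactor, hdet, one_smul, ← poleFactor] at h1
  rw [← mul_one (poleFactor κ R k).adjugate, ← poleFactor_mul_neg hR k, ← mul_assoc, h1, one_mul]

end Poles

section Sectional

variable {α : ℝ} {u₀ v₀ : SchwartzMap ℝ ℝ} {u v : ℝ → ℝ → ℝ} {t : ℝ} {k κ : ℂ} {c d : ℂ → ℂ}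

lemma leftCol_tendsto_within {K : ℝ} {p q : ℝ → ℝ} (h : Admissible K p q) (hα : α ^ 2 = 1)
    {D : Set ℂ} {j : Fin 3} (hk : Good α k j) (hD : ∀ z ∈ D, Good α z j) (x : ℝ) (a : Fin 3) :
    Tendsto (fun k => leftCol α p q k j x a) (𝓝[D] k) (𝓝 (leftCol α p q k j x a)) :=
  ((leftCol_continuousOn h hα j x a).continuousWithinAt hk).mono_left (nhdsWithin_mono _ hD)

lemma rightCol_tendsto_within {K : ℝ} {p q : ℝ → ℝ} (h : Admissible K p q) (hα : α ^ 2 = 1)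
    {D : Set ℂ} {j : Fin 3} (hk : Good α (-k) j) (hD : ∀ z ∈ D, Good α (-z) j) (x : ℝ) (a : Fin 3) :
    Tendsto (fun k => rightCol α p q k j x a) (𝓝[D] k) (𝓝 (rightCol α p q k j x a)) :=
  ((rightCol_continuousOn h hα j x a).continuousWithinAt hk).mono_left (nhdsWithin_mono _ hD)

lemma scattering_zero_tendsto_within {K : ℝ} {p q : ℝ → ℝ} (h : Admissible K p q) (hα : α ^ 2 = 1)
    (hk : k.im = 0) : Tendsto (fun k => scattering α p q k 0 0) (𝓝[Dplus α] k)
      (𝓝 (scattering α p q k 0 0)) :=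
  ((holomorphicUpTo_scattering_zero h hα).1.continuousWithinAt (by simp [hk])).mono_left
    (nhdsWithin_mono _ fun z hz => le_of_lt (show 0 < α * z.im from hz))

lemma scattering_block_tendsto_within {K : ℝ} {p q : ℝ → ℝ} (h : Admissible K p q)
    (hα : α ^ 2 = 1) {i j : Fin 3} (hi : i ≠ 0) (hj : j ≠ 0) (hk : k.im = 0) :
    Tendsto (fun k => scattering α p q k i j) (𝓝[Dminus α] k) (𝓝 (scattering α p q k i j)) :=
  ((holomorphicUpTo_scattering_block h hα hi hj).1.continuousWithinAt (by simp [hk])).mono_left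
    (nhdsWithin_mono _ fun z hz => by
      have : α * z.im < 0 := hz
      change 0 ≤ -α * z.im
      linarith)

lemma bigDelta_tendsto_within {K : ℝ} {p q : ℝ → ℝ} (h : Admissible K p q) (hα : α ^ 2 = 1)
    (hk : k.im = 0) : Tendsto (fun k => bigDelta (scattering α p q k)) (𝓝[Dminus α] k)
      (𝓝 (bigDelta (scattering α p q k))) := by
  have n1 : (1 : Fin 3) ≠ 0 := by decide
  have n2 : (2 : Fin 3) ≠ 0 := by decide
  exact ((scattering_block_tendsto_within h hα n1 n1 hk).mul
    (scattering_block_tendsto_within h hα n2 n2 hk)).sub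
    ((scattering_block_tendsto_within h hα n1 n2 hk).mul
    (scattering_block_tendsto_within h hα n2 n1 hk))

lemma bigDelta_ne_zero_of_im_eq_zero {K : ℝ} {p q : ℝ → ℝ} (h : Admissible K p q) (hα : α ^ 2 = 1)
    (hk : k.im = 0) (hs : scattering α p q k 0 0 ≠ 0) : bigDelta (scattering α p q k) ≠ 0 := by
  have := bigDelta_scattering_conj (k := k) h hα (by simp [hk])
  rw [conj_eq_of_im_eq_zero hk] at this
  rw [this]
  simpa using hs

/-- The exponentials cancel in pairs, and what remains is the expansion of `det S = 1` along the
first column. -/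
lemma det_jump {S : Matrix (Fin 3) (Fin 3) ℂ} (hS : S.det = 1) (h0 : S 0 0 ≠ 0)
    (hd : bigDelta S ≠ 0) (θ : ℂ) : (jump S θ).det = 1 := by
  have hee : Complex.exp (-2 * θ) * Complex.exp (2 * θ) = 1 := by
    rw [← Complex.exp_add]
    simp
  rw [Matrix.det_fin_three] at hS
  rw [Matrix.det_fin_three]
  simp only [jump, Matrix.of_apply, Matrix.cons_val]
  generalize Complex.exp (-2 * θ) = e' at *
  generalize Complex.exp (2 * θ) = e at *
  have hdef : bigDelta S = S 1 1 * S 2 2 - S 1 2 * S 2 1 := rfl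
  generalize bigDelta S = D at *
  field_simp
  have h1 : (1 : ℂ) - (S 1 0 * (S 0 2 * S 2 1 - S 0 1 * S 2 2) + S 2 0 * (S 0 1 * S 1 2 - S 0 2 * S 1 1))
      = S 0 0 * D := by
    rw [hdef]
    linear_combination -hS
  linear_combination h1 - (S 1 0 * (S 0 2 * S 2 1 - S 0 1 * S 2 2) +
    S 2 0 * (S 0 1 * S 1 2 - S 0 2 * S 1 1)) * hee

lemma leftCol_entries (hsol : IsSchwartzSolution α u₀ v₀ u v) (hα : α ^ 2 = 1) (ht : 0 ≤ t)
    (hk : k.im = 0) (x : ℝ) (j a : Fin 3) :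
    leftCol α (fun y => u y t) (fun y => v y t) k j x a =
      Complex.exp (theta α x t k * (lam 0 - lam j)) *
          (rightCol α (fun y => u y t) (fun y => v y t) k 0 x a * scattering α u₀ v₀ k 0 j) +
        Complex.exp (theta α x t k * (1 - lam j)) *
          (rightCol α (fun y => u y t) (fun y => v y t) k 1 x a * scattering α u₀ v₀ k 1 j +
          rightCol α (fun y => u y t) (fun y => v y t) k 2 x a * scattering α u₀ v₀ k 2 j) := by
  have := congrFun (congrFun (jostLeft_eq hsol hα (x := x) ht hk) a) j
  rw [Matrix.mul_apply, Fin.sum_univ_three] at this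
  simp only [expAd, Matrix.mul_diagonal, Matrix.diagonal_mul] at this
  have e : ∀ i : Fin 3, Complex.exp (theta α x t k * (lam i - lam j)) =
      Complex.exp (theta α x t k * lam i) * Complex.exp (-(theta α x t k * lam j)) := fun i => by
    rw [← Complex.exp_add]
    congr 1
    ring
  have l1 : lam 1 = 1 := rfl
  have l2 : lam 2 = 1 := rfl
  have e1 := e 1
  rw [l1] at e1
  rw [l1, l2] at this
  rw [e, e1]
  refine this.trans ?_
  simp only [rightCol, jostRight, Matrix.of_apply]
  ring

/-- Boundary values exist by continuity of the columns up to the axis. The jump relation is linear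
algebra: with the columns of `J₁` expressed through those of `J₂`, both sides become combinations of
three vectors with coefficients from `S`. -/
lemma rhM_jump (hsol : IsSchwartzSolution α u₀ v₀ u v) (hα : α ^ 2 = 1) (ht : 0 ≤ t)
    (x : ℝ) (hk : k.im = 0) (hs : scattering α u₀ v₀ k 0 0 ≠ 0) :
    ∃ Np Nm : Matrix (Fin 3) (Fin 3) ℂ,
      Tendsto (rhM α u₀ v₀ u v x t) (𝓝[Dplus α] k) (𝓝 Np) ∧
      Tendsto (rhM α u₀ v₀ u v x t) (𝓝[Dminus α] k) (𝓝 Nm) ∧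
      Np = Nm * CMKdV.jump (scattering α u₀ v₀ k) (theta α x t k) := by
  obtain ⟨K, h⟩ := hsol.exists_admissible_at ht
  obtain ⟨K₀, h₀⟩ := hsol.exists_admissible_init
  have n1 : (1 : Fin 3) ≠ 0 := by decide
  have n2 : (2 : Fin 3) ≠ 0 := by decide
  have hd := bigDelta_ne_zero_of_im_eq_zero h₀ hα hk hs
  set p := fun y => u y t
  set q := fun y => v y t
  refine ⟨Matrix.of fun a => ![leftCol α p q k 0 x a / scattering α u₀ v₀ k 0 0,
      rightCol α p q k 1 x a, rightCol α p q k 2 x a],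
    Matrix.of fun a => ![rightCol α p q k 0 x a,
        (scattering α u₀ v₀ k 2 2 * leftCol α p q k 1 x a -
          scattering α u₀ v₀ k 2 1 * leftCol α p q k 2 x a) / bigDelta (scattering α u₀ v₀ k),
        (-scattering α u₀ v₀ k 1 2 * leftCol α p q k 1 x a +
          scattering α u₀ v₀ k 1 1 * leftCol α p q k 2 x a) / bigDelta (scattering α u₀ v₀ k)],
    tendsto_matrix.2 fun a b => ?_, tendsto_matrix.2 fun a b => ?_, ?_⟩
  · refine Tendsto.congr' (f₁ := fun k => ![_, _, _] b) (eventually_nhdsWithin_of_forall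
      fun z hz => (rhM_of_mem_Dplus hz a b).symm) ?_
    fin_cases b
    · exact (leftCol_tendsto_within h hα (good_of_im_eq_zero hk 0)
        (fun z hz => good_zero (le_of_lt hz)) x a).div
        (scattering_zero_tendsto_within h₀ hα hk) hs
    · exact rightCol_tendsto_within h hα (good_neg_of_im_eq_zero hk 1)
        (fun z hz => good_neg_of_ne_zero n1 (le_of_lt hz)) x a
    · exact rightCol_tendsto_within h hα (good_neg_of_im_eq_zero hk 2)
        (fun z hz => good_neg_of_ne_zero n2 (le_of_lt hz)) x a
  · refine Tendsto.congr' (f₁ := fun k => ![_, _, _] b) (eventually_nhdsWithin_of_forall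
      fun z hz => (rhM_of_mem_Dminus hz a b).symm) ?_
    have l1 := leftCol_tendsto_within h hα (good_of_im_eq_zero hk 1)
        (fun z hz => good_of_ne_zero n1 (le_of_lt (show z ∈ Dminus α from hz))) x a
    have l2 := leftCol_tendsto_within h hα (good_of_im_eq_zero hk 2)
        (fun z hz => good_of_ne_zero n2 (le_of_lt (show z ∈ Dminus α from hz))) x a
    have hdt := bigDelta_tendsto_within h₀ hα hk
    fin_cases b
    · exact rightCol_tendsto_within h hα (good_neg_of_im_eq_zero hk 0)
        (fun z hz => good_neg_zero (le_of_lt hz)) x a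
    · exact (((scattering_block_tendsto_within h₀ hα n2 n2 hk).mul l1).sub
        ((scattering_block_tendsto_within h₀ hα n2 n1 hk).mul l2)).div hdt hd
    · exact (((scattering_block_tendsto_within h₀ hα n1 n2 hk).neg.mul l1).add
        ((scattering_block_tendsto_within h₀ hα n1 n1 hk).mul l2)).div hdt hd
  · have hS := det_scattering h₀ hα hk
    rw [Matrix.det_fin_three] at hS
    have hL := fun j a => leftCol_entries hsol hα ht hk x j a
    have l0 : lam 0 = -1 := rfl
    have l1 : lam 1 = 1 := rfl
    have l2 : lam 2 = 1 := rfl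
    have hdef : bigDelta (scattering α u₀ v₀ k) = scattering α u₀ v₀ k 1 1 * scattering α u₀ v₀ k 2 2
      - scattering α u₀ v₀ k 1 2 * scattering α u₀ v₀ k 2 1 := rfl
    ext a b
    have hL0 := hL 0 a
    have hL1 := hL 1 a
    have hL2 := hL 2 a
    simp only [l0, l1, l2, sub_self, mul_zero, Complex.exp_zero, one_mul] at hL0 hL1 hL2
    rw [show theta α x t k * (1 - -1) = 2 * theta α x t k by ring] at hL0
    rw [show theta α x t k * (-1 - 1) = -2 * theta α x t k by ring] at hL1 hL2
    have hee : Complex.exp (-2 * theta α x t k) * Complex.exp (2 * theta α x t k) = 1 := by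
      rw [← Complex.exp_add]
      simp
    rw [Matrix.mul_apply, Fin.sum_univ_three]
    simp only [jump, Matrix.of_apply]
    change leftCol α p q k 0 x a = _ at hL0
    change leftCol α p q k 1 x a = _ at hL1
    change leftCol α p q k 2 x a = _ at hL2
    rw [hL0, hL1, hL2]
    generalize Complex.exp (-2 * theta α x t k) = e' at *
    generalize Complex.exp (2 * theta α x t k) = e at *
    generalize bigDelta (scattering α u₀ v₀ k) = D at *
    generalize scattering α u₀ v₀ k = S at *
    generalize rightCol α p q k 0 x a = R₀ at *
    generalize rightCol α p q k 1 x a = R₁ at *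
    generalize rightCol α p q k 2 x a = R₂ at *
    -- Cramer's rule for the lower block isolates one column of `J₂`; the remaining multiple of `R₀`
    -- is what the first row of the jump matrix removes.
    have m1 : (S 2 2 * (e' * (R₀ * S 0 1) + (R₁ * S 1 1 + R₂ * S 2 1)) -
        S 2 1 * (e' * (R₀ * S 0 2) + (R₁ * S 1 2 + R₂ * S 2 2))) / D =
        R₁ + e' * R₀ * (S 0 1 * S 2 2 - S 0 2 * S 2 1) / D := by
      field_simp
      rw [hdef]
      ring
    have m2 : (-S 1 2 * (e' * (R₀ * S 0 1) + (R₁ * S 1 1 + R₂ * S 2 1)) +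
        S 1 1 * (e' * (R₀ * S 0 2) + (R₁ * S 1 2 + R₂ * S 2 2))) / D =
        R₂ + e' * R₀ * (S 1 1 * S 0 2 - S 1 2 * S 0 1) / D := by
      field_simp
      rw [hdef]
      ring
    fin_cases b
    · simp only [Fin.zero_eta, Matrix.cons_val, m1, m2]
      have h1 : (1 : ℂ) + (S 1 0 * (S 0 1 * S 2 2 - S 0 2 * S 2 1) +
          S 2 0 * (S 1 1 * S 0 2 - S 1 2 * S 0 1)) = S 0 0 * D := by
        rw [hdef]
        linear_combination -hS
      field_simp
      linear_combination -R₀ * h1 - R₀ * (S 1 0 * (S 0 1 * S 2 2 - S 0 2 * S 2 1) +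
          S 2 0 * (S 1 1 * S 0 2 - S 1 2 * S 0 1)) * hee
    · simp only [Fin.mk_one, Matrix.cons_val, m1]
      ring
    · simp only [Fin.reduceFinMk, Matrix.cons_val, m2]
      ring

lemma rhM_pole (hsol : IsSchwartzSolution α u₀ v₀ u v) (hα : α ^ 2 = 1) (ht : 0 ≤ t)
    (x : ℝ) (hcd : IsNorming α u₀ v₀ c d) (hκ : κ ∈ simpleZeros α u₀ v₀) :
    PoleCondition (rhM α u₀ v₀ u v x t) κ
      (lowerNilpotent (c κ * Complex.exp (2 * theta α x t κ))
        (d κ * Complex.exp (2 * theta α x t κ))) := by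
  obtain ⟨K, h⟩ := hsol.exists_admissible_at ht
  obtain ⟨K₀, h₀⟩ := hsol.exists_admissible_init
  have n1 : (1 : Fin 3) ≠ 0 := by decide
  have n2 : (2 : Fin 3) ≠ 0 := by decide
  have hD := hκ.1.1
  have hev : ∀ᶠ z in 𝓝[≠] κ, z ∈ Dplus α := nhdsWithin_le_nhds ((isOpen_Dplus α).mem_nhds hD)
  have hsd := (analyticAt_scattering_zero h₀ hα hD).differentiableAt.hasDerivAt
  have hL := fun a => leftCol_eq_norming hsol hα (x := x) ht (le_of_lt hD : 0 ≤ α * κ.im)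
    (c := deriv (fun z => scattering α u₀ v₀ z 0 0) κ * c κ)
    (d := deriv (fun z => scattering α u₀ v₀ z 0 0) κ * d κ)
    (fun a => (hcd κ hκ a).trans (by simp only [rightCol, jostRight, Matrix.of_apply]; ring)) a
  set p := fun y => u y t
  set q := fun y => v y t
  set E := Complex.exp (2 * theta α x t κ)
  have hκ0 : Tendsto (fun k : ℂ => k - κ) (𝓝[≠] κ) (𝓝 0) := by
    have : Tendsto (fun k : ℂ => k - κ) (𝓝 κ) (𝓝 (κ - κ)) :=
      (continuous_id.sub continuous_const).tendsto κ
    rw [sub_self] at this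
    exact this.mono_left nhdsWithin_le_nhds
  have cL := fun a => ((analyticAt_leftCol_zero h hα hD x a).continuousAt.tendsto.mono_left
    (nhdsWithin_le_nhds (s := {κ}ᶜ)))
  have c1 := fun a => ((analyticAt_rightCol_of_ne_zero h hα n1 hD x a).continuousAt.tendsto.mono_left
    (nhdsWithin_le_nhds (s := {κ}ᶜ)))
  have c2 := fun a => ((analyticAt_rightCol_of_ne_zero h hα n2 hD x a).continuousAt.tendsto.mono_left
    (nhdsWithin_le_nhds (s := {κ}ᶜ)))
  refine ⟨Matrix.of fun a => ![E * (c κ * rightCol α p q κ 1 x a + d κ * rightCol α p q κ 2 x a),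
    0, 0], tendsto_matrix.2 fun a b => ?_, tendsto_matrix.2 fun a b => ?_⟩
  · fin_cases b
    · have hsl := hasDerivAt_iff_tendsto_slope.1 hsd
      -- As `s₁₁(κ) = 0`, the factor `(k - κ) / s₁₁(k)` is the reciprocal of a difference quotient.
      -- Its limit `1 / s₁₁'(κ)` cancels the derivative in the definition of the norming constants.
      have := (cL a).div hsl hκ.2
      have he : leftCol α p q κ 0 x a / deriv (fun z => scattering α u₀ v₀ z 0 0) κ =
          E * (c κ * rightCol α p q κ 1 x a + d κ * rightCol α p q κ 2 x a) := by
        rw [hL, div_eq_iff hκ.2]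
        ring
      rw [he] at this
      refine this.congr' ?_
      filter_upwards [hev] with z hz
      simp only [Pi.div_apply, slope_def_field, hκ.1.2, sub_zero, Fin.zero_eta, Matrix.smul_apply,
        rhM_of_mem_Dplus hz, Matrix.cons_val, smul_eq_mul]
      rw [div_div_eq_mul_div]
      ring
    · have := hκ0.mul (c1 a)
      rw [zero_mul] at this
      refine this.congr' ?_
      filter_upwards [hev] with z hz
      simp only [Matrix.smul_apply, rhM_of_mem_Dplus hz, smul_eq_mul]
      rfl
    · have := hκ0.mul (c2 a)
      rw [zero_mul] at this
      refine this.congr' ?_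
      filter_upwards [hev] with z hz
      simp only [Matrix.smul_apply, rhM_of_mem_Dplus hz, smul_eq_mul]
      rfl
  · fin_cases b
    · refine ((((c1 a).const_mul (c κ)).add ((c2 a).const_mul (d κ))).const_mul E).congr' ?_
      filter_upwards [hev] with z hz
      simp only [lowerNilpotent, Matrix.mul_apply, Fin.sum_univ_three, rhM_of_mem_Dplus hz,
        Matrix.of_apply, Matrix.cons_val, Fin.zero_eta]
      ring
    all_goals
      refine tendsto_const_nhds.congr fun z => ?_
      simp [lowerNilpotent, Matrix.mul_apply, Fin.sum_univ_three]

/-- Poles occur only for `α = -1`; this fixes the sign in the residue condition at the conjugate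
point. -/
lemma eq_neg_one_of_mem_zeros {K : ℝ} {p q : ℝ → ℝ} (h : Admissible K p q) (hα : α ^ 2 = 1)
    (hκ : κ ∈ zeros α p q) : α = -1 := by
  refine (eq_or_eq_neg_of_sq_eq_one hα).resolve_left ?_
  rintro rfl
  have hD : (0 : ℝ) ≤ 1 * κ.im := le_of_lt hκ.1
  have h0 := hκ.2
  rw [scattering_zero_zero h hα hD] at h0
  exact leftLimit_ne_zero_of_defocusing h (by linarith) h0

/-- The condition at `κ` is reflected. Taking adjugate and conjugate transpose of the regularised
product at `κ` gives, by `adjugate_rhM`, a regularised product for `M` at `conj κ`, whose nilpotent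
matrix is `-R†`. A limit of this product implies the pole condition. -/
lemma rhM_pole_conj (hsol : IsSchwartzSolution α u₀ v₀ u v) (hα : α ^ 2 = 1) (ht : 0 ≤ t)
    (x : ℝ) (hcd : IsNorming α u₀ v₀ c d) (hκ : κ ∈ simpleZeros α u₀ v₀) :
    PoleCondition (rhM α u₀ v₀ u v x t) (starRingEnd ℂ κ)
      (upperNilpotent (-starRingEnd ℂ (c κ) * Complex.exp (-2 * theta α x t (starRingEnd ℂ κ)))
        (-starRingEnd ℂ (d κ) * Complex.exp (-2 * theta α x t (starRingEnd ℂ κ)))) := by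
  obtain ⟨K₀, h₀⟩ := hsol.exists_admissible_init
  have hα1 := eq_neg_one_of_mem_zeros h₀ hα hκ.1
  subst hα1
  have hR := lowerNilpotent_mul_self (a := c κ * Complex.exp (2 * theta (-1) x t κ))
    (b := d κ * Complex.exp (2 * theta (-1) x t κ))
  have hdet := det_one_sub_lowerNilpotent (a := c κ * Complex.exp (2 * theta (-1) x t κ))
    (b := d κ * Complex.exp (2 * theta (-1) x t κ))
  have hpole := rhM_pole hsol hα ht x hcd hκ
  -- Conjugation turns `e^{2θ(κ)}` into `e^{-2θ(conj κ)}`, by `conj_theta`.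
  have hexp : ∀ z : ℂ, -starRingEnd ℂ z * Complex.exp (-2 * theta (-1) x t (starRingEnd ℂ κ)) =
      -starRingEnd ℂ (z * Complex.exp (2 * theta (-1) x t κ)) := fun z => by
    rw [map_mul, ← Complex.exp_conj, map_mul, conj_theta, Complex.conj_ofNat]
    ring_nf
  have hRc := upperNilpotent_eq (a := c κ * Complex.exp (2 * theta (-1) x t κ))
    (b := d κ * Complex.exp (2 * theta (-1) x t κ))
  rw [← hexp, ← hexp] at hRc
  have hev := eventually_mem_regularSet h₀ hα hκ
  have hU := upperNilpotent_mul_self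
    (a := -starRingEnd ℂ (c κ) * Complex.exp (-2 * theta (-1) x t (starRingEnd ℂ κ)))
    (b := -starRingEnd ℂ (d κ) * Complex.exp (-2 * theta (-1) x t (starRingEnd ℂ κ)))
  set M := rhM (-1) u₀ v₀ u v x t
  set R := lowerNilpotent (c κ * Complex.exp (2 * theta (-1) x t κ))
    (d κ * Complex.exp (2 * theta (-1) x t κ))
  obtain ⟨B, hB⟩ := hpole.exists_tendsto fun a b => hev.mono fun z hz =>
    (rhM_analyticAt hsol hα ht x hz a b).differentiableAt
  have hadj : Tendsto (fun k => (M k * poleFactor κ R k).adjugate) (𝓝[≠] κ) (𝓝 B.adjugate) :=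
    ((Continuous.matrix_adjugate continuous_id).tendsto B).comp hB
  have hstar : Continuous fun X : Matrix (Fin 3) (Fin 3) ℂ => X.conjTranspose :=
    Continuous.matrix_conjTranspose continuous_id
  have hlim := (((hstar.tendsto _).comp (hadj.comp (tendsto_conj_nhdsNE κ))).const_mul
    (gram (-1))).mul_const (gram (-1))
  refine poleCondition_of_tendsto hU (hlim.congr' ?_)
  filter_upwards [eventually_mem_regularSet_conj h₀ hα hκ] with z hz
  have hz' := adjugate_rhM hsol hα ht x (conj_mem_regularSet hz)
  rw [Complex.conj_conj] at hz'
  simp only [Function.comp]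
  rw [Matrix.adjugate_mul_distrib, adjugate_poleFactor hR hdet, hz', hRc]
  have hg := gram_mul_gram hα
  have hpf : (poleFactor κ (-R) (starRingEnd ℂ z)).conjTranspose * gram (-1) =
      gram (-1) * poleFactor (starRingEnd ℂ κ) (-(gram (-1) * R.conjTranspose * gram (-1))) z := by
    simp only [poleFactor, smul_neg, sub_neg_eq_add, Matrix.conjTranspose_add,
      Matrix.conjTranspose_one, Matrix.conjTranspose_smul, mul_add, add_mul, mul_one, one_mul,
      mul_smul_comm, smul_mul_assoc]
    rw [← mul_assoc, ← mul_assoc, hg, one_mul]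
    congr 3
    simp
  rw [Matrix.conjTranspose_mul, Matrix.conjTranspose_mul, Matrix.conjTranspose_mul,
    Matrix.conjTranspose_conjTranspose, conjTranspose_gram]
  simp only [mul_assoc]
  rw [hpf]
  simp only [← mul_assoc, hg, one_mul]
  rfl

lemma isRHPSolution_rhM (hsol : IsSchwartzSolution α u₀ v₀ u v) (hα : α ^ 2 = 1) (ht : 0 ≤ t)
    (x : ℝ) (hcd : IsNorming α u₀ v₀ c d) :
    IsRHPSolution α u₀ v₀ c d x t (rhM α u₀ v₀ u v x t) where
  meromorphic _ hk := rhM_meromorphicAt hsol hα ht x hk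
  analytic _ h1 h2 h3 := rhM_analyticAt hsol hα ht x ⟨h1, h2, h3⟩
  jump k hk := rhM_jump hsol hα ht x (Complex.ofReal_im k) hk
  normalization := rhM_normalization hsol hα ht x
  pole _ hκ := rhM_pole hsol hα ht x hcd hκ
  pole_conj _ hκ := rhM_pole_conj hsol hα ht x hcd hκ

end Sectional

end CMKdV
end

noncomputable section
namespace CMKdV

/-! ### Uniqueness for the Riemann-Hilbert problem -/

lemma differentiableAt_adjugate {X : ℂ → Matrix (Fin 3) (Fin 3) ℂ} {k : ℂ}
    (hX : ∀ a b, DifferentiableAt ℂ (fun z => X z a b) k) (a b : Fin 3) :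
    DifferentiableAt ℂ (fun z => (X z).adjugate a b) k := by
  have hU : ∀ i j, DifferentiableAt ℂ (fun z => (X z).updateRow b (Pi.single a 1) i j) k := by
    intro i j
    by_cases hi : i = b
    · subst hi
      simp
    · simpa [Matrix.updateRow_ne hi] using hX i j
  simp only [Matrix.adjugate_apply, Matrix.det_fin_three]
  have h00 := hU 0 0
  have h01 := hU 0 1
  have h02 := hU 0 2
  have h10 := hU 1 0
  have h11 := hU 1 1
  have h12 := hU 1 2
  have h20 := hU 2 0
  have h21 := hU 2 1
  have h22 := hU 2 2
  exact ((((((h00.mul h11).mul h22).sub ((h00.mul h12).mul h21)).sub ((h01.mul h10).mul h22)).add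
    ((h01.mul h12).mul h20)).add ((h02.mul h10).mul h21)).sub ((h02.mul h11).mul h20)

lemma tendsto_mul_adjugate {l : Filter ℂ} {X Y : ℂ → Matrix (Fin 3) (Fin 3) ℂ}
    {A B : Matrix (Fin 3) (Fin 3) ℂ} (hX : Tendsto X l (𝓝 A)) (hY : Tendsto Y l (𝓝 B)) :
    Tendsto (fun k => X k * (Y k).adjugate) l (𝓝 (A * B.adjugate)) :=
  hX.mul (((Continuous.matrix_adjugate continuous_id).tendsto B).comp hY)

/-- The product of a matrix with the adjugate of another one has a limit at a common pole. -/
lemma PoleCondition.exists_tendsto_mul_adjugate {N M : ℂ → Matrix (Fin 3) (Fin 3) ℂ} {κ : ℂ}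
    {R : Matrix (Fin 3) (Fin 3) ℂ} (hdet : ∀ s : ℂ, (1 - s • R).det = 1)
    (hN : PoleCondition N κ R) (hM : PoleCondition M κ R)
    (hNd : ∀ a b, ∀ᶠ k in 𝓝[≠] κ, DifferentiableAt ℂ (fun z => N z a b) k)
    (hMd : ∀ a b, ∀ᶠ k in 𝓝[≠] κ, DifferentiableAt ℂ (fun z => M z a b) k) :
    ∃ L, Tendsto (fun k => N k * (M k).adjugate) (𝓝[≠] κ) (𝓝 L) := by
  obtain ⟨B, hB⟩ := hN.exists_tendsto hNd
  obtain ⟨B', hB'⟩ := hM.exists_tendsto hMd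
  refine ⟨_, (tendsto_mul_adjugate hB hB').congr fun k => ?_⟩
  rw [Matrix.adjugate_mul_distrib, mul_assoc, ← mul_assoc (poleFactor κ R k),
    mul_adjugate_poleFactor hdet, one_mul]

/-! ### Density of the regular points, also near infinity -/

section Regular

variable {K α : ℝ} {p q : ℝ → ℝ} {k : ℂ}

lemma eventually_mem_regularSet_Dplus (h : Admissible K p q) (hα : α ^ 2 = 1) (hk : k.im = 0)
    (hs : scattering α p q k 0 0 ≠ 0) : ∀ᶠ z in 𝓝[Dplus α] k, z ∈ regularSet α p q := by
  filter_upwards [(scattering_zero_tendsto_within h hα hk).eventually_ne hs, self_mem_nhdsWithin]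
    with z hz hD
  exact mem_regularSet_of_mem_Dplus hD hz

lemma nhdsWithin_Dplus_neBot (hα : α ^ 2 = 1) (hk : k.im = 0) : (𝓝[Dplus α] k).NeBot := by
  rw [← mem_closure_iff_nhdsWithin_neBot, Metric.mem_closure_iff]
  intro ε hε
  have hα1 : |α| = 1 := by rw [← sq_eq_sq₀ (abs_nonneg _) zero_le_one, sq_abs, hα, one_pow]
  refine ⟨k + ((α * (ε / 2) : ℝ) : ℂ) * Complex.I, ?_, ?_⟩
  · simp only [Dplus, mem_ofPred_eq, Complex.add_im, hk, Complex.mul_im,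
      Complex.ofReal_re, Complex.I_im, Complex.ofReal_im, Complex.I_re]
    nlinarith
  · rw [dist_eq_norm, sub_add_cancel_left, norm_neg, norm_mul, Complex.norm_real, Complex.norm_I,
      Real.norm_eq_abs, abs_mul, hα1, abs_of_pos (half_pos hε)]
    linarith

lemma eventually_nhdsNE_mem_regularSet (h : Admissible K p q) (hα : α ^ 2 = 1)
    (hz : zeros α p q ⊆ simpleZeros α p q) (hk : k.im ≠ 0) :
    ∀ᶠ z in 𝓝[≠] k, z ∈ regularSet α p q := by
  by_cases h1 : k ∈ zeros α p q
  · exact eventually_mem_regularSet h hα (hz h1)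
  by_cases h2 : starRingEnd ℂ k ∈ zeros α p q
  · simpa using eventually_mem_regularSet_conj h hα (hz h2)
  have hr : k ∈ regularSet α p q := ⟨hk, h1, h2⟩
  refine Eventually.filter_mono nhdsWithin_le_nhds ?_
  obtain hD | hD := mem_Dplus_or_mem_Dminus hα hk
  · filter_upwards [(analyticAt_scattering_zero h hα hD).continuousAt.eventually_ne
      (scattering_ne_zero_of_mem hr hD), (isOpen_Dplus α).mem_nhds hD] with z hz hzD
    exact mem_regularSet_of_mem_Dplus hzD hz
  · filter_upwards [(analyticAt_bigDelta h hα hD).continuousAt.eventually_ne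
      (bigDelta_ne_zero_of_mem h hα hr hD), (isOpen_Dminus α).mem_nhds hD] with z hz hzD
    exact mem_regularSet_of_mem_Dminus h hα hzD hz

lemma dense_regularSet (h : Admissible K p q) (hα : α ^ 2 = 1)
    (hreal : ∀ k : ℝ, scattering α p q k 0 0 ≠ 0) (hz : zeros α p q ⊆ simpleZeros α p q) :
    Dense (regularSet α p q) := by
  intro k
  rw [mem_closure_iff_frequently]
  by_cases hk : k.im = 0
  · have hne := nhdsWithin_Dplus_neBot hα hk
    have hs := hreal k.re
    rw [show ((k.re : ℝ) : ℂ) = k from Complex.ext rfl (by simp [hk])] at hs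
    exact (eventually_mem_regularSet_Dplus h hα hk hs).frequently.filter_mono nhdsWithin_le_nhds
  · exact (eventually_nhdsNE_mem_regularSet h hα hz hk).frequently.filter_mono nhdsWithin_le_nhds

lemma eventually_atInfty_mem_regularSet (h : Admissible K p q) (hα : α ^ 2 = 1) :
    ∀ᶠ k in atInfty, k ∈ regularSet α p q := by
  rw [atInfty_eq hα, eventually_sup]
  constructor
  · filter_upwards [(tendsto_scattering_zero h hα).eventually_ne one_ne_zero,
      eventually_mem_inftyWithin _] with k hk hD
    exact mem_regularSet_of_mem_Dplus hD hk
  · filter_upwards [(tendsto_bigDelta h hα).eventually_ne one_ne_zero,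
      eventually_mem_inftyWithin _] with k hk hD
    exact mem_regularSet_of_mem_Dminus h hα hD hk

end Regular

section Unique

variable {K α : ℝ} {u₀ v₀ : ℝ → ℝ} {x t : ℝ} {c d : ℂ → ℂ}
  {N M : ℂ → Matrix (Fin 3) (Fin 3) ℂ}

lemma IsRHPSolution.differentiableAt (hN : IsRHPSolution α u₀ v₀ c d x t N) {k : ℂ}
    (hk : k ∈ regularSet α u₀ v₀) (a b : Fin 3) : DifferentiableAt ℂ (fun z => N z a b) k :=
  (hN.analytic k hk.1 hk.2.1 hk.2.2 a b).differentiableAt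

/-- Three cancellations are at work: continuity at regular points, the jump matrix against its
adjugate on the real axis, and the common pole factor against its adjugate at the poles. -/
lemma IsRHPSolution.exists_tendsto_mul_adjugate (h : Admissible K u₀ v₀) (hα : α ^ 2 = 1)
    (hreal : ∀ k : ℝ, scattering α u₀ v₀ k 0 0 ≠ 0) (hz : zeros α u₀ v₀ ⊆ simpleZeros α u₀ v₀)
    (hN : IsRHPSolution α u₀ v₀ c d x t N) (hM : IsRHPSolution α u₀ v₀ c d x t M) (k : ℂ) :
    ∃ L, Tendsto (fun k => N k * (M k).adjugate) (𝓝[regularSet α u₀ v₀] k) (𝓝 L) := by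
  by_cases hr : k ∈ regularSet α u₀ v₀
  · exact ⟨_, tendsto_mul_adjugate
      (tendsto_matrix.2 fun a b => (hN.differentiableAt hr a b).continuousAt.continuousWithinAt)
      (tendsto_matrix.2 fun a b => (hM.differentiableAt hr a b).continuousAt.continuousWithinAt)⟩
  by_cases hk : k.im = 0
  · have hkk : ((k.re : ℝ) : ℂ) = k := Complex.ext rfl (by simp [hk])
    have hs := hreal k.re
    obtain ⟨Np, Nm, n1, n2, n3⟩ := hN.jump k.re hs
    obtain ⟨Mp, Mm, m1, m2, m3⟩ := hM.jump k.re hs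
    rw [hkk] at hs n1 n2 n3 m1 m2 m3
    have hJ := det_jump (det_scattering h hα hk) hs (bigDelta_ne_zero_of_im_eq_zero h hα hk hs)
      (theta α x t k)
    have hp := tendsto_mul_adjugate n1 m1
    have hm := tendsto_mul_adjugate n2 m2
    -- The jump matrix times its adjugate is its determinant, which is 1, so the one-sided limits
    -- agree.
    have heq : Np * Mp.adjugate = Nm * Mm.adjugate := by
      rw [n3, m3, Matrix.adjugate_mul_distrib, mul_assoc, ← mul_assoc (CMKdV.jump _ _),
        Matrix.mul_adjugate, hJ, one_smul, one_mul]
    rw [heq] at hp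
    refine ⟨_, (hp.sup hm).mono_left ?_⟩
    rw [← nhdsWithin_union]
    exact nhdsWithin_mono _ fun z hz => mem_Dplus_or_mem_Dminus hα hz.1
  · have hle : 𝓝[regularSet α u₀ v₀] k ≤ 𝓝[≠] k := nhdsWithin_mono _ fun z hz hzk => hr (hzk ▸ hz)
    have hev := eventually_nhdsNE_mem_regularSet h hα hz hk
    have hNd := fun a b => hev.mono fun z hz => hN.differentiableAt hz a b
    have hMd := fun a b => hev.mono fun z hz => hM.differentiableAt hz a b
    by_cases h1 : k ∈ zeros α u₀ v₀
    · obtain ⟨L, hL⟩ := PoleCondition.exists_tendsto_mul_adjugate det_one_sub_lowerNilpotent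
        (hN.pole k (hz h1)) (hM.pole k (hz h1)) hNd hMd
      exact ⟨L, hL.mono_left hle⟩
    by_cases h2 : starRingEnd ℂ k ∈ zeros α u₀ v₀
    · have pN := hN.pole_conj _ (hz h2)
      have pM := hM.pole_conj _ (hz h2)
      rw [Complex.conj_conj] at pN pM
      obtain ⟨L, hL⟩ := PoleCondition.exists_tendsto_mul_adjugate det_one_sub_upperNilpotent
        pN pM hNd hMd
      exact ⟨L, hL.mono_left hle⟩
    exact absurd ⟨hk, h1, h2⟩ hr

/-- The entries of `N adj M` satisfy the Liouville theorem above and equal those of the identity.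
Using the adjugate instead of an inverse keeps them holomorphic wherever `N` and `M` are; the
determinant is needed for `M` alone, and only to cancel `adj M` at the end. -/
lemma IsRHPSolution.eq_of_mem_regularSet (h : Admissible K u₀ v₀) (hα : α ^ 2 = 1)
    (hreal : ∀ k : ℝ, scattering α u₀ v₀ k 0 0 ≠ 0) (hz : zeros α u₀ v₀ ⊆ simpleZeros α u₀ v₀)
    (hN : IsRHPSolution α u₀ v₀ c d x t N) (hM : IsRHPSolution α u₀ v₀ c d x t M)
    (hdet : ∀ k ∈ regularSet α u₀ v₀, (M k).det = 1) {k : ℂ} (hk : k ∈ regularSet α u₀ v₀) :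
    N k = M k := by
  have hF : N k * (M k).adjugate = 1 := by
    ext a b
    refine eq_of_sectionally_differentiable (dense_regularSet h hα hreal hz)
      (f := fun k => (N k * (M k).adjugate) a b) (c := (1 : Matrix (Fin 3) (Fin 3) ℂ) a b)
      (fun k hk => eventually_nhdsNE_mem_regularSet h hα hz hk) (fun k hk => hk.1)
      (fun k hk => ?_) (fun k => ?_) ?_ hk
    · simp only [Matrix.mul_apply]
      exact DifferentiableAt.fun_sum fun i _ => (hN.differentiableAt hk a i).mul
        (differentiableAt_adjugate (hM.differentiableAt hk) i b)
    · obtain ⟨L, hL⟩ := hN.exists_tendsto_mul_adjugate h hα hreal hz hM k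
      exact ⟨_, tendsto_matrix.1 hL a b⟩
    · have := tendsto_mul_adjugate hN.normalization hM.normalization
      rw [Matrix.adjugate_one, mul_one] at this
      exact tendsto_matrix.1 this a b
  calc N k = N k * ((M k).adjugate * M k) := by
        rw [Matrix.adjugate_mul, hdet k hk, one_smul, mul_one]
    _ = M k := by rw [← mul_assoc, hF, one_mul]

end Unique

end CMKdV
end
-- The main theorem
theorem mainTheorem1 (α : ℝ) (hα : α = 1 ∨ α = -1) (u₀ v₀ : SchwartzMap ℝ ℝ)
    (u v : ℝ → ℝ → ℝ) (hsol : CMKdV.IsSchwartzSolution α u₀ v₀ u v) :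
    -- the Jost columns, the scattering matrix and the norming constants are well defined
    (∀ t : ℝ, 0 ≤ t → CMKdV.JostWellPosed α (fun y => u y t) (fun y => v y t)) ∧
    (∀ x t k : ℝ, 0 ≤ t →
      CMKdV.jostLeft α (fun y => u y t) (fun y => v y t) x k =
        CMKdV.jostRight α (fun y => u y t) (fun y => v y t) x k *
          CMKdV.expAd (CMKdV.theta α x t k) (CMKdV.scattering α u₀ v₀ k)) ∧
    CMKdV.HolomorphicUpTo α (fun k => CMKdV.scattering α u₀ v₀ k 0 0) ∧
    (∀ i j : Fin 3, i ≠ 0 → j ≠ 0 →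
      CMKdV.HolomorphicUpTo (-α) (fun k => CMKdV.scattering α u₀ v₀ k i j)) ∧
    (α = 1 → ∀ k : ℂ, 0 ≤ k.im → CMKdV.scattering α u₀ v₀ k 0 0 ≠ 0) ∧
    (∃ c d : ℂ → ℂ, CMKdV.IsNorming α u₀ v₀ c d) ∧
    ∀ x t : ℝ, 0 ≤ t →
      -- the matrix `M` solves the Riemann-Hilbert problem
      (∀ c d : ℂ → ℂ, CMKdV.IsNorming α u₀ v₀ c d →
        CMKdV.IsRHPSolution α u₀ v₀ c d x t (CMKdV.rhM α u₀ v₀ u v x t)) ∧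
      -- the solution is recovered from `M`
      (Filter.Tendsto (fun k : ℂ => 2 * Complex.I * (k * CMKdV.rhM α u₀ v₀ u v x t k 0 1))
          CMKdV.atInfty (nhds (u x t : ℂ)) ∧
        Filter.Tendsto (fun k : ℂ => 2 * Complex.I * (k * CMKdV.rhM α u₀ v₀ u v x t k 0 2))
          CMKdV.atInfty (nhds (v x t : ℂ))) ∧
      -- the solution is recovered from any solution of the Riemann-Hilbert problem, when the jump
      -- matrix is defined on all of `ℝ` and all poles are simple
      ((∀ k : ℝ, CMKdV.scattering α u₀ v₀ k 0 0 ≠ 0) →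
        CMKdV.zeros α u₀ v₀ ⊆ CMKdV.simpleZeros α u₀ v₀ →
        ∀ c d : ℂ → ℂ, CMKdV.IsNorming α u₀ v₀ c d →
        ∀ N : ℂ → Matrix (Fin 3) (Fin 3) ℂ, CMKdV.IsRHPSolution α u₀ v₀ c d x t N →
          Filter.Tendsto (fun k : ℂ => 2 * Complex.I * (k * N k 0 1))
            CMKdV.atInfty (nhds (u x t : ℂ)) ∧
          Filter.Tendsto (fun k : ℂ => 2 * Complex.I * (k * N k 0 2))
            CMKdV.atInfty (nhds (v x t : ℂ))) := by
  have hα2 : α ^ 2 = 1 := by rcases hα with rfl | rfl <;> norm_num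
  obtain ⟨K₀, h₀⟩ := hsol.exists_admissible_init
  have n1 : (1 : Fin 3) ≠ 0 := by decide
  have n2 : (2 : Fin 3) ≠ 0 := by decide
  refine ⟨fun t ht => ?_, fun x t k ht => CMKdV.jostLeft_eq hsol hα2 ht (Complex.ofReal_im k),
    CMKdV.holomorphicUpTo_scattering_zero h₀ hα2,
    fun i j hi hj => CMKdV.holomorphicUpTo_scattering_block h₀ hα2 hi hj, ?_,
    CMKdV.exists_isNorming h₀ hα2, fun x t ht => ⟨fun c d hcd =>
      CMKdV.isRHPSolution_rhM hsol hα2 ht x hcd, ?_, fun hreal hz c d hcd N hN => ?_⟩⟩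
  · obtain ⟨K, h⟩ := hsol.exists_admissible_at ht
    exact ⟨fun k hk => ⟨CMKdV.existsUnique_left h hα2 (CMKdV.good_zero hk),
        CMKdV.existsUnique_right h hα2 (CMKdV.good_neg_of_ne_zero n1 hk),
        CMKdV.existsUnique_right h hα2 (CMKdV.good_neg_of_ne_zero n2 hk)⟩,
      fun k hk => ⟨CMKdV.existsUnique_right h hα2 (CMKdV.good_neg_zero hk),
        CMKdV.existsUnique_left h hα2 (CMKdV.good_of_ne_zero n1 hk),
        CMKdV.existsUnique_left h hα2 (CMKdV.good_of_ne_zero n2 hk)⟩⟩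
  · rintro rfl k hk
    rw [CMKdV.scattering_zero_zero h₀ hα2 (by linarith)]
    exact CMKdV.leftLimit_ne_zero_of_defocusing h₀ hk
  · exact ⟨CMKdV.rhM_recovery hsol hα2 ht x n1, CMKdV.rhM_recovery hsol hα2 ht x n2⟩
  -- For large nonreal `k` both `s₁₁` on `D₊` and `Δ` on `D₋` are close to 1, so such `k` are
  -- regular. There `N` coincides with `M`, and the limits for `M` carry over.
  · have hev : ∀ b : Fin 3, (fun k : ℂ => 2 * Complex.I *
        (k * CMKdV.rhM α u₀ v₀ u v x t k 0 b)) =ᶠ[CMKdV.atInfty]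
        fun k => 2 * Complex.I * (k * N k 0 b) := fun b => by
      filter_upwards [CMKdV.eventually_atInfty_mem_regularSet h₀ hα2] with k hk
      rw [hN.eq_of_mem_regularSet h₀ hα2 hreal hz (CMKdV.isRHPSolution_rhM hsol hα2 ht x hcd)
        (fun k hk => CMKdV.det_rhM hsol hα2 ht x hk) hk]
    exact ⟨(CMKdV.rhM_recovery hsol hα2 ht x n1).congr' (hev 1),
      (CMKdV.rhM_recovery hsol hα2 ht x n2).congr' (hev 2)⟩
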